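/- Let $k$ be a commutative ring. For closed oriented $0$-manifolds $Y_0,Y_1$ let $k\mathbf{Cob}_2(Y_0,Y_1)$ be the $k$-linear category whose objects are oriented $1$-dimensional cobordisms $W:Y_0\to Y_1$ and whose morphisms $W_0\to W_1$ are $k$-linear combinations of diffeomorphism classes (relative to the boundary structure) of compact oriented $2$-bordisms, composed by gluing. Let $\mathcal C(Y_0,Y_1)$ be the additive category of formal finite direct sums and matrices over the quotient of $k\mathbf{Cob}_2(Y_0,Y_1)$ by the relations ($S$) $S\amalg S^2=0$, ($T$) $S\amalg T^2=2S$, and ($4Tu$) $S_{12}+S_{34}=S_{13}+S_{24}$, where $S_{ij}$ is obtained from $S$ by joining the $i$-th and the $j$-th of four disjoint discs in $S$ by a tube. Let $D$ be an oriented singular tangle diagram in $\mathbb R\times[0,1]$ with linearly ordered set $V$ of vertices (crossings and double points), and let $\chi$ be a checkerboard coloring of its complement. For a set $r$ of double points and $s\subset V$ let $D_{r,s}$ be the smoothing of $D$ in which the double points in $r$ (not in $r$) are first replaced by positive (negative) crossings, and then each crossing is replaced by its $1$-smoothing if it lies in $s$ and by its $0$-smoothing otherwise; the orientation-respecting smoothing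 is the $0$-smoothing of a positive and the $1$-smoothing of a negative crossing. Orient $D_{r,s}$ as the boundary of the black region. The universal bracket complex $[\![D^\chi]\!]$ is $$[\![D^\chi]\!]^i=\bigoplus_{|s|+2|r|=i}D_{r,s}\in\mathcal C(\partial^-D^\chi,\partial^+D^\chi),$$ with differential the sum of the following two kinds of components: * for $c\in V\setminus s$, the saddle $D_{r,s}\to D_{r,s\cup\{c\}}$ at $c$, with sign $(-1)^{\#\{a\in s\,:\,a<c\}}$; * for a double point $b\in s\setminus r$, the genus-one morphism $\Phi_b:D_{r,s}\to D_{r\cup\{b\},s\setminus\{b\}}$ (the two smoothings agree), with sign $(-1)^{\#\{a\in s\,:\,a<b\}}$. Here, with both strands at $b$ drawn upwards, $\Phi_b$ is the identity cobordism with a tube joining the two sheets at $b$, minus the identity cobordism with a handle attached to the left sheet at $b$. Suppose that a double point of $D$ is of FI (kink) type: two neighbouring half-edges at it form an edge of $D$, and this edge together with the double point bounds a disc in $\mathbb R\times[0,1]$ whose interior does not meet $D$. Then for every checkerboard coloring $\chi$ the above is a cochain complex $[\![D^\chi]\!]$ and it is contractible, i.e. its identity is null-homotopic. Consequently, if $\chi_w$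 is the coloring with white negatively unbounded region, $n_-$ the number of negative crossings and $n_\times$ the number of double points of $D$, then the universal Khovanov complex $[\![D^{\chi_w}]\!][-n_--2n_\times]$ (where $W[m]^i=W^{i-m}$) is contractible as well. -/

import Mathlib

open CategoryTheory

universe u

namespace SingTangle

/-! ### Oriented 1-dimensional cobordisms -/

/-- A closed oriented `0`-manifold: a finite set of points with signs (`true` is `+`). -/
structure SignedSet where
  Pt : Type
  [finite : Finite Pt]
  sign : Pt → Bool

attribute [instance] SignedSet.finite

/-- A compact oriented `1`-manifold `W` with `∂W` identified with the disjoint union of `Y₁` and of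
`Y₀` with reversed signs, presented by a cell structure.

The manifold is cut into finitely many oriented edges.  `End` is the set of ends of edges, `tail x`
says whether the edge starts (`true`) or finishes (`false`) at the end `x`, and `other x` is the
opposite end of the same edge.  At a point where the manifold has been cut, two ends meet and are
exchanged by `glue`; the ends at boundary points are the fixed points of `glue`. -/
structure Cobordism (Y₀ Y₁ : SignedSet) where
  End : Type
  [finite : Finite End]
  tail : End → Bool
  other : End → End
  other_other : ∀ x, other (other x) = x
  tail_other : ∀ x, tail (other x) = !tail x
  glue : End → End
  glue_glue : ∀ x, glue (glue x) = x
  tail_glue : ∀ x, glue x ≠ x → tail (glue x) = !tail x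
  bdry : Y₀.Pt ⊕ Y₁.Pt → End
  bdry_injective : Function.Injective bdry
  glue_eq_self_iff : ∀ x, glue x = x ↔ ∃ p, bdry p = x
  tail_bdry₀ : ∀ y, tail (bdry (.inl y)) = Y₀.sign y
  tail_bdry₁ : ∀ y, tail (bdry (.inr y)) = !Y₁.sign y

attribute [instance] Cobordism.finite

variable {Y₀ Y₁ : SignedSet}

/-- Two ends that belong to the same edge or are glued together. -/
def Cobordism.Adj (W : Cobordism Y₀ Y₁) (x y : W.End) : Prop :=
  y = W.other x ∨ y = W.glue x

/-- Two ends that lie on the same connected component of the `1`-manifold. -/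
def Cobordism.Joined (W : Cobordism Y₀ Y₁) : W.End → W.End → Prop :=
  Relation.EqvGen W.Adj

/-! ### 2-bordisms

By the classification of compact oriented surfaces, a `2`-bordism `S : W₀ → W₁` is determined, up to
orientation preserving diffeomorphisms compatible with the structure maps, by its finite set of
connected components, by the component in which each piece of the boundary lies, and by the Euler
characteristic of each component.  `SurfData` is the type of such records.  Those that come from
actual oriented surfaces are singled out by `IsSurface` below, which builds surfaces from handles. -/

/-- The connected components of a `2`-bordism `W₀ → W₁`, the maps that send a point of `W₀`, `W₁` to
the component containing it, and for each component `F` the relative Euler characteristic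
`χ(F) - χ(F ∩ W₀)`. Because of the vertical boundary `(Y₀ ⊔ Y₁) × [0,1]`, the two ends of `W₀` and
`W₁` over the same boundary point lie in the same component. -/
structure SurfData (W₀ W₁ : Cobordism Y₀ Y₁) where
  Comp : Type
  [finite : Finite Comp]
  in₀ : W₀.End → Comp
  in₀_adj : ∀ x y, W₀.Adj x y → in₀ x = in₀ y
  in₁ : W₁.End → Comp
  in₁_adj : ∀ x y, W₁.Adj x y → in₁ x = in₁ y
  compat : ∀ p, in₀ (W₀.bdry p) = in₁ (W₁.bdry p)
  euler : Comp →₀ ℤ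

attribute [instance] SurfData.finite

namespace SurfData

variable {W₀ W₁ W₂ W₃ : Cobordism Y₀ Y₁}

/-- Diffeomorphism of bordisms relative to the structure maps, on the level of invariants. -/
def Iso (S T : SurfData W₀ W₁) : Prop :=
  ∃ e : S.Comp ≃ T.Comp, (∀ x, e (S.in₀ x) = T.in₀ x) ∧ (∀ x, e (S.in₁ x) = T.in₁ x) ∧
    S.euler.mapDomain e = T.euler

/-- The identifications of components made by gluing `S` and `T` along `W₁`. -/
inductive GlueRel (S : SurfData W₀ W₁) (T : SurfData W₁ W₂) : S.Comp ⊕ T.Comp → S.Comp ⊕ T.Comp → Prop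
  | mk (x : W₁.End) : GlueRel S T (.inl (S.in₁ x)) (.inr (T.in₀ x))

/-- Gluing along `W₁`.  The components of the result are obtained by merging components that share a
component of `W₁`; relative Euler characteristics are additive. -/
noncomputable def comp (S : SurfData W₀ W₁) (T : SurfData W₁ W₂) : SurfData W₀ W₂ where
  Comp := Quot (GlueRel S T)
  in₀ x := Quot.mk _ (.inl (S.in₀ x))
  in₀_adj x y h := by rw [S.in₀_adj x y h]
  in₁ x := Quot.mk _ (.inr (T.in₁ x))
  in₁_adj x y h := by rw [T.in₁_adj x y h]
  compat p := by
    rw [S.compat, ← T.compat]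
    exact Quot.sound (GlueRel.mk _)
  euler := S.euler.mapDomain (fun a => Quot.mk (GlueRel S T) (.inl a)) +
    T.euler.mapDomain (fun a => Quot.mk (GlueRel S T) (.inr a))

/-- The cylinder `W × [0,1]`. -/
noncomputable def id (W : Cobordism Y₀ Y₁) : SurfData W W where
  Comp := Quot W.Adj
  in₀ x := Quot.mk _ x
  in₀_adj _ _ h := Quot.sound h
  in₁ x := Quot.mk _ x
  in₁_adj _ _ h := Quot.sound h
  compat _ := rfl
  euler := 0

/-- The disjoint union with a `2`-sphere. -/
noncomputable def addSphere (S : SurfData W₀ W₁) : SurfData W₀ W₁ where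
  Comp := Option S.Comp
  in₀ x := some (S.in₀ x)
  in₀_adj x y h := by rw [S.in₀_adj x y h]
  in₁ x := some (S.in₁ x)
  in₁_adj x y h := by rw [S.in₁_adj x y h]
  compat p := by rw [S.compat]
  euler := S.euler.mapDomain some + Finsupp.single none 2

/-- Remove the interiors of two disjoint discs, one in the component `a` and one in the component
`b`, and join the two boundary circles by a tube.  For `a = b` this adds a handle to `a`. -/
noncomputable def addTube (S : SurfData W₀ W₁) (a b : S.Comp) : SurfData W₀ W₁ where
  Comp := Quot (fun x y : S.Comp => x = a ∧ y = b)
  in₀ x := Quot.mk _ (S.in₀ x)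
  in₀_adj x y h := by rw [S.in₀_adj x y h]
  in₁ x := Quot.mk _ (S.in₁ x)
  in₁_adj x y h := by rw [S.in₁_adj x y h]
  compat p := by rw [S.compat]
  euler := S.euler.mapDomain (Quot.mk _) + Finsupp.single (Quot.mk _ a) (-2)

/-- The disjoint union with a torus, that is, with a sphere with one handle. -/
noncomputable def addTorus (S : SurfData W₀ W₁) : SurfData W₀ W₁ :=
  S.addSphere.addTube (none : Option S.Comp) (none : Option S.Comp)

/-- Different components of `W₀` lie in different components of the bordism. -/
def Inj₀ (S : SurfData W₀ W₁) : Prop := ∀ x y, S.in₀ x = S.in₀ y → W₀.Joined x y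

/-- Different components of `W₁` lie in different components of the bordism. -/
def Inj₁ (S : SurfData W₀ W₁) : Prop := ∀ x y, S.in₁ x = S.in₁ y → W₁.Joined x y

/-- The mapping cylinder of a diffeomorphism `W₀ ≅ W₁` relative to the boundary. -/
structure IsCylinder (S : SurfData W₀ W₁) : Prop where
  inj₀ : S.Inj₀
  surj₀ : ∀ a, ∃ x, S.in₀ x = a
  inj₁ : S.Inj₁
  surj₁ : ∀ a, ∃ x, S.in₁ x = a
  euler_eq : S.euler = 0

/-- The component `a` is a disc bounded by a circle of `W₁`, the others form a mapping cylinder. -/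
structure IsBirth (S : SurfData W₀ W₁) (a : S.Comp) : Prop where
  inj₀ : S.Inj₀
  range₀ : ∀ c, (∃ x, S.in₀ x = c) ↔ c ≠ a
  inj₁ : S.Inj₁
  surj₁ : ∀ c, ∃ x, S.in₁ x = c
  euler_eq : S.euler = Finsupp.single a 1

/-- The component `a` is a disc bounded by a circle of `W₀`, the others form a mapping cylinder. -/
structure IsDeath (S : SurfData W₀ W₁) (a : S.Comp) : Prop where
  inj₀ : S.Inj₀
  surj₀ : ∀ c, ∃ x, S.in₀ x = c
  inj₁ : S.Inj₁
  range₁ : ∀ c, (∃ x, S.in₁ x = c) ↔ c ≠ a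
  euler_eq : S.euler = Finsupp.single a 1

/-- A saddle. The cobordism `W₁` is identified by `φ` with the result of an oriented surgery on
`W₀`: the manifold `W₀` is cut at two different interior points, where the ends `x`, `glue x` and
`y`, `glue y` meet, and reglued crosswise (`x` with `glue y` and `y` with `glue x`), which makes
sense for oriented manifolds as `x` and `y` have the same direction.  The bordism is `W₀ × [0,1]`
with a band attached at these two points. -/
structure IsSaddle (S : SurfData W₀ W₁) (φ : W₀.End ≃ W₁.End) (x y : W₀.End) : Prop where
  other_eq : ∀ z, W₁.other (φ z) = φ (W₀.other z)
  tail_eq : ∀ z, W₁.tail (φ z) = W₀.tail z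
  bdry_eq : ∀ p, W₁.bdry p = φ (W₀.bdry p)
  ne : x ≠ y
  tail_xy : W₀.tail x = W₀.tail y
  interior_x : W₀.glue x ≠ x
  interior_y : W₀.glue y ≠ y
  glue_x : W₁.glue (φ x) = φ (W₀.glue y)
  glue_y : W₁.glue (φ y) = φ (W₀.glue x)
  glue_eq : ∀ z, z ≠ x → z ≠ y → z ≠ W₀.glue x → z ≠ W₀.glue y → W₁.glue (φ z) = φ (W₀.glue z)
  in₁_eq : ∀ z, S.in₁ (φ z) = S.in₀ z
  surj₀ : ∀ c, ∃ z, S.in₀ z = c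
  in₀_eq_iff : ∀ z w, S.in₀ z = S.in₀ w ↔
    Relation.EqvGen (fun s t => W₀.Adj s t ∨ (s = x ∧ t = y)) z w
  euler_eq : S.euler = Finsupp.single (S.in₀ x) (-1)

end SurfData

/-- The records of invariants that come from compact oriented `2`-bordisms.  By Morse theory every
`2`-bordism is a composition of mapping cylinders, births, deaths and saddles; disjoint unions with
spheres and surgeries along interior tubes are listed as well since the relations use them. -/
inductive IsSurface : ∀ {W₀ W₁ : Cobordism Y₀ Y₁}, SurfData W₀ W₁ → Prop
  | cylinder {W₀ W₁ : Cobordism Y₀ Y₁} {S : SurfData W₀ W₁} (h : S.IsCylinder) : IsSurface S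
  | birth {W₀ W₁ : Cobordism Y₀ Y₁} {S : SurfData W₀ W₁} (a : S.Comp) (h : S.IsBirth a) :
      IsSurface S
  | death {W₀ W₁ : Cobordism Y₀ Y₁} {S : SurfData W₀ W₁} (a : S.Comp) (h : S.IsDeath a) :
      IsSurface S
  | saddle {W₀ W₁ : Cobordism Y₀ Y₁} {S : SurfData W₀ W₁} (φ : W₀.End ≃ W₁.End) (x y : W₀.End)
      (h : S.IsSaddle φ x y) : IsSurface S
  | comp {W₀ W₁ W₂ : Cobordism Y₀ Y₁} {S : SurfData W₀ W₁} {T : SurfData W₁ W₂}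
      (hS : IsSurface S) (hT : IsSurface T) : IsSurface (S.comp T)
  | addSphere {W₀ W₁ : Cobordism Y₀ Y₁} {S : SurfData W₀ W₁} (hS : IsSurface S) :
      IsSurface S.addSphere
  | addTube {W₀ W₁ : Cobordism Y₀ Y₁} {S : SurfData W₀ W₁} (hS : IsSurface S) (a b : S.Comp) :
      IsSurface (S.addTube a b)

namespace SurfData

variable {W₀ W₁ W₂ W₃ : Cobordism Y₀ Y₁}

theorem Iso.refl (S : SurfData W₀ W₁) : Iso S S :=
  ⟨Equiv.refl _, fun _ => rfl, fun _ => rfl, by simp⟩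

theorem Iso.symm {S T : SurfData W₀ W₁} : Iso S T → Iso T S := by
  rintro ⟨e, h₀, h₁, h⟩
  refine ⟨e.symm, fun x => ?_, fun x => ?_, ?_⟩
  · rw [← h₀, e.symm_apply_apply]
  · rw [← h₁, e.symm_apply_apply]
  · rw [← h, ← Finsupp.mapDomain_comp]
    simp

theorem Iso.trans {S T U : SurfData W₀ W₁} : Iso S T → Iso T U → Iso S U := by
  rintro ⟨e, h₀, h₁, h⟩ ⟨f, k₀, k₁, k⟩
  refine ⟨e.trans f, fun x => ?_, fun x => ?_, ?_⟩
  · simp [h₀, k₀]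
  · simp [h₁, k₁]
  · rw [← k, ← h, ← Finsupp.mapDomain_comp]
    rfl

/-- The map induced on components by gluing compatible maps. -/
def glueMap {S S' : SurfData W₀ W₁} {T T' : SurfData W₁ W₂} (e : S.Comp → S'.Comp)
    (f : T.Comp → T'.Comp) (he : ∀ x, e (S.in₁ x) = S'.in₁ x) (hf : ∀ x, f (T.in₀ x) = T'.in₀ x) :
    Quot (GlueRel S T) → Quot (GlueRel S' T') :=
  Quot.lift (fun a => Quot.mk _ (Sum.map e f a)) (by
    rintro _ _ ⟨x⟩
    simp only [Sum.map_inl, Sum.map_inr, he, hf]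
    exact Quot.sound (GlueRel.mk _))

theorem Iso.comp {S S' : SurfData W₀ W₁} {T T' : SurfData W₁ W₂} :
    Iso S S' → Iso T T' → Iso (S.comp T) (S'.comp T') := by
  rintro ⟨e, h₀, h₁, h⟩ ⟨f, k₀, k₁, k⟩
  have h₁' : ∀ x, e.symm (S'.in₁ x) = S.in₁ x := fun x => by rw [← h₁, e.symm_apply_apply]
  have k₀' : ∀ x, f.symm (T'.in₀ x) = T.in₀ x := fun x => by rw [← k₀, f.symm_apply_apply]
  refine ⟨⟨glueMap e f h₁ k₀, glueMap e.symm f.symm h₁' k₀', ?_, ?_⟩, fun x => ?_, fun x => ?_, ?_⟩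
  · rintro ⟨a | a⟩
    · exact congrArg (fun z => Quot.mk (GlueRel S T) (.inl z)) (e.symm_apply_apply a)
    · exact congrArg (fun z => Quot.mk (GlueRel S T) (.inr z)) (f.symm_apply_apply a)
  · rintro ⟨a | a⟩
    · exact congrArg (fun z => Quot.mk (GlueRel S' T') (.inl z)) (e.apply_symm_apply a)
    · exact congrArg (fun z => Quot.mk (GlueRel S' T') (.inr z)) (f.apply_symm_apply a)
  · exact congrArg (fun z => Quot.mk (GlueRel S' T') (.inl z)) (h₀ x)
  · exact congrArg (fun z => Quot.mk (GlueRel S' T') (.inr z)) (k₁ x)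
  · simp only [SurfData.comp, Finsupp.mapDomain_add, ← h, ← k, ← Finsupp.mapDomain_comp]
    rfl

theorem id_comp (S : SurfData W₀ W₁) : Iso ((SurfData.id W₀).comp S) S := by
  let F : Quot (GlueRel (SurfData.id W₀) S) → S.Comp :=
    Quot.lift (Sum.elim (Quot.lift S.in₀ S.in₀_adj) (fun a => a)) (by rintro _ _ ⟨x⟩; rfl)
  refine ⟨⟨F, fun a => Quot.mk _ (.inr a), ?_, fun _ => rfl⟩, fun _ => rfl, fun _ => rfl, ?_⟩
  · rintro ⟨a | a⟩
    · obtain ⟨x, rfl⟩ := Quot.exists_rep (r := W₀.Adj) a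
      exact (Quot.sound (GlueRel.mk (S := SurfData.id W₀) (T := S) x)).symm
    · rfl
  · simp only [SurfData.comp, SurfData.id, Finsupp.mapDomain_zero, zero_add,
      ← Finsupp.mapDomain_comp]
    exact Finsupp.mapDomain_id

theorem comp_id (S : SurfData W₀ W₁) : Iso (S.comp (SurfData.id W₁)) S := by
  let F : Quot (GlueRel S (SurfData.id W₁)) → S.Comp :=
    Quot.lift (Sum.elim (fun a => a) (Quot.lift S.in₁ S.in₁_adj)) (by rintro _ _ ⟨x⟩; rfl)
  refine ⟨⟨F, fun a => Quot.mk _ (.inl a), ?_, fun _ => rfl⟩, fun _ => rfl, fun _ => rfl, ?_⟩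
  · rintro ⟨a | a⟩
    · rfl
    · obtain ⟨x, rfl⟩ := Quot.exists_rep (r := W₁.Adj) a
      exact Quot.sound (GlueRel.mk (S := S) (T := SurfData.id W₁) x)
  · simp only [SurfData.comp, SurfData.id, Finsupp.mapDomain_zero, add_zero,
      ← Finsupp.mapDomain_comp]
    exact Finsupp.mapDomain_id

theorem comp_assoc (S : SurfData W₀ W₁) (T : SurfData W₁ W₂) (U : SurfData W₂ W₃) :
    Iso ((S.comp T).comp U) (S.comp (T.comp U)) := by
  let F : Quot (GlueRel (S.comp T) U) → Quot (GlueRel S (T.comp U)) :=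
    Quot.lift (Sum.elim
      (Quot.lift (Sum.elim (fun a => Quot.mk _ (.inl a))
        (fun b => Quot.mk _ (.inr (Quot.mk _ (.inl b)))))
        (by rintro _ _ ⟨x⟩; exact Quot.sound (GlueRel.mk x)))
      (fun c => Quot.mk _ (.inr (Quot.mk _ (.inr c)))))
      (by
        rintro _ _ ⟨x⟩
        exact congrArg (fun z => Quot.mk (GlueRel S (T.comp U)) (.inr z))
          (Quot.sound (GlueRel.mk x)))
  let G : Quot (GlueRel S (T.comp U)) → Quot (GlueRel (S.comp T) U) :=
    Quot.lift (Sum.elim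
      (fun a => Quot.mk _ (.inl (Quot.mk _ (.inl a))))
      (Quot.lift (Sum.elim (fun b => Quot.mk _ (.inl (Quot.mk _ (.inr b))))
        (fun c => Quot.mk _ (.inr c)))
        (by rintro _ _ ⟨x⟩; exact Quot.sound (GlueRel.mk x))))
      (by
        rintro _ _ ⟨x⟩
        exact congrArg (fun z => Quot.mk (GlueRel (S.comp T) U) (.inl z))
          (Quot.sound (GlueRel.mk x)))
  refine ⟨⟨F, G, ?_, ?_⟩, fun _ => rfl, fun _ => rfl, ?_⟩
  · rintro ⟨a | c⟩
    · obtain ⟨a | b, rfl⟩ := Quot.exists_rep (r := GlueRel S T) a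
      · rfl
      · rfl
    · rfl
  · rintro ⟨a | b⟩
    · rfl
    · obtain ⟨b | c, rfl⟩ := Quot.exists_rep (r := GlueRel T U) b
      · rfl
      · rfl
  · simp only [SurfData.comp, Finsupp.mapDomain_add, ← Finsupp.mapDomain_comp, add_assoc]
    rfl

theorem isCylinder_id (W : Cobordism Y₀ Y₁) : (SurfData.id W).IsCylinder where
  inj₀ _ _ h := Quot.eqvGen_exact h
  surj₀ := Quot.exists_rep
  inj₁ _ _ h := Quot.eqvGen_exact h
  surj₁ := Quot.exists_rep
  euler_eq := rfl

end SurfData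

/-- Equality of `2`-bordisms up to diffeomorphism. -/
instance bordismSetoid (W₀ W₁ : Cobordism Y₀ Y₁) : Setoid {S : SurfData W₀ W₁ // IsSurface S} where
  r S T := S.1.Iso T.1
  iseqv := ⟨fun S => .refl S.1, fun h => h.symm, fun h k => h.trans k⟩

/-- The category `Cob₂(Y₀, Y₁)`: its objects are cobordisms from `Y₀` to `Y₁`, its morphisms are
diffeomorphism classes of `2`-bordisms, composed by gluing. -/
noncomputable instance : Category (Cobordism Y₀ Y₁) where
  Hom W₀ W₁ := Quotient (bordismSetoid W₀ W₁)
  id W := Quotient.mk _ ⟨SurfData.id W, .cylinder (SurfData.isCylinder_id W)⟩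
  comp := Quotient.map₂ (fun S T => ⟨S.1.comp T.1, .comp S.2 T.2⟩) (fun _ _ h _ _ k => h.comp k)
  id_comp := by
    rintro _ _ ⟨S⟩
    exact Quotient.sound (SurfData.id_comp S.1)
  comp_id := by
    rintro _ _ ⟨S⟩
    exact Quotient.sound (SurfData.comp_id S.1)
  assoc := by
    rintro _ _ _ _ ⟨S⟩ ⟨T⟩ ⟨U⟩
    exact Quotient.sound (SurfData.comp_assoc S.1 T.1 U.1)

/-- The class of a `2`-bordism. -/
noncomputable def bordismMk {W₀ W₁ : Cobordism Y₀ Y₁} (S : SurfData W₀ W₁) (hS : IsSurface S) : W₀ ⟶ W₁ :=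
  Quotient.mk (bordismSetoid W₀ W₁) ⟨S, hS⟩

/-! ### The linear category of cobordisms modulo the relations `S`, `T`, `4Tu` -/

section Linear

variable (k : Type u) [CommRing k]

/-- A `2`-bordism as a morphism of the `k`-linear category `kCob₂(Y₀, Y₁)`. -/
noncomputable def bordismLin {W₀ W₁ : Cobordism Y₀ Y₁} (S : SurfData W₀ W₁) (hS : IsSurface S) :
    Free.of k W₀ ⟶ Free.of k W₁ :=
  (Free.embedding k (Cobordism Y₀ Y₁)).map (bordismMk S hS)

/-- The congruence of the `k`-linear category `kCob₂(Y₀, Y₁)` generated by the relations `S`, `T` and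
`4Tu`.  In `4Tu`, the four bordisms agree outside four discs lying in components `a`, `b`, `c`, `d`
(not necessarily different) of `S`, and are obtained by joining two of the discs by a tube. -/
inductive BNRel : HomRel (Free k (Cobordism Y₀ Y₁))
  | sphere {W₀ W₁ : Cobordism Y₀ Y₁} (S : SurfData W₀ W₁) (hS : IsSurface S) :
      BNRel (bordismLin k S.addSphere hS.addSphere) 0
  | torus {W₀ W₁ : Cobordism Y₀ Y₁} (S : SurfData W₀ W₁) (hS : IsSurface S) :
      BNRel (bordismLin k S.addTorus (hS.addSphere.addTube _ _)) ((2 : k) • bordismLin k S hS)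
  | fourTu {W₀ W₁ : Cobordism Y₀ Y₁} (S : SurfData W₀ W₁) (hS : IsSurface S) (a b c d : S.Comp) :
      BNRel
        (bordismLin k (S.addTube a b) (hS.addTube a b) +
          bordismLin k (S.addTube c d) (hS.addTube c d))
        (bordismLin k (S.addTube a c) (hS.addTube a c) +
          bordismLin k (S.addTube b d) (hS.addTube b d))
  | refl {X Y : Free k (Cobordism Y₀ Y₁)} (f : X ⟶ Y) : BNRel f f
  | symm {X Y : Free k (Cobordism Y₀ Y₁)} {f g : X ⟶ Y} : BNRel f g → BNRel g f
  | trans {X Y : Free k (Cobordism Y₀ Y₁)} {f g h : X ⟶ Y} : BNRel f g → BNRel g h → BNRel f h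
  | add {X Y : Free k (Cobordism Y₀ Y₁)} {f₁ f₂ g₁ g₂ : X ⟶ Y} :
      BNRel f₁ f₂ → BNRel g₁ g₂ → BNRel (f₁ + g₁) (f₂ + g₂)
  | smul {X Y : Free k (Cobordism Y₀ Y₁)} (t : k) {f g : X ⟶ Y} : BNRel f g → BNRel (t • f) (t • g)
  | comp_left {X Y Z : Free k (Cobordism Y₀ Y₁)} (f : X ⟶ Y) {g g' : Y ⟶ Z} :
      BNRel g g' → BNRel (f ≫ g) (f ≫ g')
  | comp_right {X Y Z : Free k (Cobordism Y₀ Y₁)} {f f' : X ⟶ Y} (g : Y ⟶ Z) :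
      BNRel f f' → BNRel (f ≫ g) (f' ≫ g)

instance : Congruence (BNRel (Y₀ := Y₀) (Y₁ := Y₁) k) where
  comp_left f _ _ h := .comp_left f h
  comp_right g h := .comp_right g h
  equivalence := ⟨.refl, .symm, .trans⟩

variable (Y₀ Y₁)

/-- The quotient category of `kCob₂(Y₀, Y₁)` by the relations `S`, `T`, `4Tu`. -/
abbrev CobMod : Type _ := Quotient (BNRel (Y₀ := Y₀) (Y₁ := Y₁) k)

noncomputable instance : Preadditive (CobMod Y₀ Y₁ k) :=
  Quotient.preadditive _ (fun _ _ _ _ _ _ h₁ h₂ => .add h₁ h₂)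

/-- The additive category of formal direct sums and matrices in which complexes are formed. -/
abbrev CobMat : Type _ := Mat_ (CobMod Y₀ Y₁ k)

variable {Y₀ Y₁}

/-- A cobordism as an object of the quotient category. -/
noncomputable def cobObj (W : Cobordism Y₀ Y₁) : CobMod Y₀ Y₁ k :=
  (Quotient.functor (BNRel (Y₀ := Y₀) (Y₁ := Y₁) k)).obj (Free.of k W)

/-- A `2`-bordism as a morphism of the quotient category. -/
noncomputable def cobMap {W₀ W₁ : Cobordism Y₀ Y₁} (S : SurfData W₀ W₁) (hS : IsSurface S) :
    cobObj k W₀ ⟶ cobObj k W₁ :=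
  (Quotient.functor (BNRel (Y₀ := Y₀) (Y₁ := Y₁) k)).map (bordismLin k S hS)

end Linear

/-! ### Singular tangle diagrams -/

/-- The vertices of a singular tangle diagram: negative crossings, positive crossings, double
points. -/
inductive Kind
  | neg
  | pos
  | dbl
  deriving DecidableEq

/-- The four half-edges at a vertex, drawn such that both strands run upwards: one strand runs from
`sw` to `ne`, the other one from `se` to `nw`.  The strand from `sw` to `ne` is the upper one at a
positive crossing and the lower one at a negative crossing. -/
inductive Quad
  | ne
  | nw
  | sw
  | se
  deriving DecidableEq

namespace Quad

instance : Fintype Quad := ⟨{ne, nw, sw, se}, by rintro ⟨⟩ <;> simp⟩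

/-- The next half-edge in counterclockwise order. -/
def rot : Quad → Quad
  | ne => nw
  | nw => sw
  | sw => se
  | se => ne

/-- Whether the strand leaves the vertex along this half-edge. -/
def isOut : Quad → Bool
  | ne => true
  | nw => true
  | sw => false
  | se => false

/-- The arcs of the smoothing `)(`, the one that respects the orientation of the strands. -/
def vert : Quad → Quad
  | ne => se
  | se => ne
  | nw => sw
  | sw => nw

/-- The arcs of the other smoothing: the two upper half-edges are joined, and the two lower ones. -/
def horiz : Quad → Quad
  | ne => nw
  | nw => ne
  | sw => se
  | se => sw

end Quad

/-- Half-edges of a diagram in the strip `ℝ × [0,1]`: four at each crossing or double point, two at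
each `2`-valent vertex (`true` for the outgoing one), and one at each endpoint on the boundary.
The endpoints are numbered counterclockwise as seen from infinity: first those on `ℝ × {1}` from
left to right, then those on `ℝ × {0}` from right to left. -/
abbrev Dart (V M : Type) (n : ℕ) : Type := (V × Quad) ⊕ (M × Bool) ⊕ Fin n

namespace Dart

variable {V M : Type} {n : ℕ}

/-- The counterclockwise next half-edge at the same vertex, where the boundary of the strip together
with the outside is collapsed to a vertex at infinity. -/
def rot : Dart V M n → Dart V M n
  | .inl (v, q) => .inl (v, q.rot)
  | .inr (.inl (p, o)) => .inr (.inl (p, !o))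
  | .inr (.inr i) => .inr (.inr (finRotate n i))

/-- The vertex of a half-edge; `none` is the vertex at infinity. -/
def vertex : Dart V M n → Option (V ⊕ M)
  | .inl (v, _) => some (.inl v)
  | .inr (.inl (p, _)) => some (.inr p)
  | .inr (.inr _) => none

/-- Whether the strand leaves the vertex along this half-edge, given the directions at the
endpoints. -/
def isOut (endOut : Fin n → Bool) : Dart V M n → Bool
  | .inl (_, q) => q.isOut
  | .inr (.inl (_, o)) => o
  | .inr (.inr i) => endOut i

/-- The half-edge to which a half-edge is connected at its vertex after every crossing has been
smoothed (`σ v = true` means the smoothing `)(`); the half-edges at endpoints are fixed. -/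
def smooth (σ : V → Bool) : Dart V M n → Dart V M n
  | .inl (v, q) => .inl (v, if σ v then q.vert else q.horiz)
  | .inr (.inl (p, o)) => .inr (.inl (p, !o))
  | .inr (.inr i) => .inr (.inr i)

end Dart

/-- An oriented singular tangle diagram in `ℝ × [0,1]`, as a plane graph with `4`-valent vertices
(crossings and double points), with endpoints on `ℝ × {0}` and `ℝ × {1}`, and with auxiliary
`2`-valent vertices, which subdivide edges (so that closed components without crossings occur).
The graph is given by its half-edges with their cyclic order at each vertex, and by its
complementary regions. The crossings are linearly ordered, as the signs in the complex require. -/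
structure SingularTangleDiagram where
  Vtx : Type
  [fintypeVtx : Fintype Vtx]
  [orderVtx : LinearOrder Vtx]
  kind : Vtx → Kind
  Mark : Type
  [fintypeMark : Fintype Mark]
  /-- the number of endpoints on `ℝ × {0}` -/
  bot : ℕ
  /-- the number of endpoints on `ℝ × {1}` -/
  top : ℕ
  /-- the opposite half of the same edge -/
  edge : Dart Vtx Mark (top + bot) → Dart Vtx Mark (top + bot)
  edge_edge : ∀ d, edge (edge d) = d
  /-- whether the strand at an endpoint leads from the boundary into the strip -/
  endOut : Fin (top + bot) → Bool
  isOut_edge : ∀ d, (edge d).isOut endOut = !d.isOut endOut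
  /-- the connected components of the complement of the diagram in the strip -/
  Region : Type
  [fintypeRegion : Fintype Region]
  /-- the region to the left of a half-edge, as seen from its vertex -/
  left : Dart Vtx Mark (top + bot) → Region
  /-- the region to the right of a half-edge is the one to the left of the clockwise previous
  half-edge -/
  left_edge_rot : ∀ d, left (edge d.rot) = left d
  /-- the negatively unbounded region -/
  west : Region
  left_last : ∀ i : Fin (top + bot), (i : ℕ) + 1 = top + bot → left (.inr (.inr i)) = west
  /-- the dual graph is connected -/
  region_connected : ∀ r r', Relation.EqvGen (fun a b => ∃ d, left d = a ∧ left (edge d) = b) r r'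
  /-- Euler's formula `v - e + f = 1 + c` on the sphere (doubled, as `2 e` is the number of
  half-edges), where `c` is the number of components of the graph, including the vertex at infinity.
  Together with the connectedness of the dual graph it says that the graph is embedded in the
  sphere. -/
  planar : 2 * (Nat.card (Option (Vtx ⊕ Mark)) + Nat.card Region) =
    Nat.card (Dart Vtx Mark (top + bot)) +
      2 * (1 + Nat.card (Quot (fun a b : Option (Vtx ⊕ Mark) =>
        ∃ d, d.vertex = a ∧ (edge d).vertex = b)))

namespace SingularTangleDiagram

attribute [instance] fintypeVtx orderVtx fintypeMark fintypeRegion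

variable (D : SingularTangleDiagram)

/-- The half-edges of the diagram. -/
abbrev HalfEdge : Type := Dart D.Vtx D.Mark (D.top + D.bot)

/-- The half-edge `q` at the crossing or double point `v`. -/
abbrev halfAt (v : D.Vtx) (q : Quad) : D.HalfEdge := .inl (v, q)

/-- The endpoint number `i` on `ℝ × {1}`, counted from the left. -/
def topEnd (i : Fin D.top) : Fin (D.top + D.bot) := Fin.castAdd D.bot i

/-- The endpoint number `i` on `ℝ × {0}`, counted from the left. -/
def botEnd (i : Fin D.bot) : Fin (D.top + D.bot) := Fin.natAdd D.top i.rev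

/-- A double point as in the FI relation: two neighbouring half-edges at the double point are joined
to an edge, and this edge bounds a disc whose interior does not meet the diagram, i.e. the region
cut off by the kink is bounded (hence not the negatively unbounded one) and has no other sides. -/
def IsFIPoint (b : D.Vtx) : Prop :=
  D.kind b = .dbl ∧ ∃ q : Quad, D.edge (D.halfAt b q) = D.halfAt b q.rot ∧
    D.left (D.halfAt b q) ≠ D.west ∧ ∀ d, D.left d = D.left (D.halfAt b q) → d = D.halfAt b q

/-- A checkerboard coloring of the complement (`true` is black): adjacent regions have different
colors. -/
structure Coloring where
  black : D.Region → Bool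
  black_edge : ∀ d, black (D.left (D.edge d)) = !black (D.left d)

variable {D}

namespace Coloring

variable (χ : D.Coloring)

/-- The edges are oriented as the boundary of the black part, which thus lies to the left: `start d`
says that the orientation leads away from the vertex of `d`. -/
def start (d : D.HalfEdge) : Bool := χ.black (D.left d)

theorem start_edge (d : D.HalfEdge) : χ.start (D.edge d) = !χ.start d := χ.black_edge d

theorem start_rot (d : D.HalfEdge) : χ.start d.rot = !χ.start d := by
  have h := χ.start_edge d.rot
  have h' : χ.start (D.edge d.rot) = χ.start d := congrArg χ.black (D.left_edge_rot d)
  rw [← h', h, Bool.not_not]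

/-- `∂⁻D`, the oriented `0`-manifold on `ℝ × {0}` (with the orientation reversed). -/
def bdryMinus : SignedSet where
  Pt := Fin D.bot
  sign i := χ.start (.inr (.inr (D.botEnd i)))

/-- `∂⁺D`, the oriented `0`-manifold on `ℝ × {1}`. -/
def bdryPlus : SignedSet where
  Pt := Fin D.top
  sign i := !χ.start (.inr (.inr (D.topEnd i)))

/-- The two half-edges that are joined by a smoothing of `v` have different orientations. -/
theorem start_quad (v : D.Vtx) (q : Quad) :
    χ.start (D.halfAt v q.vert) = !χ.start (D.halfAt v q) ∧
      χ.start (D.halfAt v q.horiz) = !χ.start (D.halfAt v q) := by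
  have h := fun q => χ.start_rot (D.halfAt v q)
  have h₁ := h .ne
  have h₂ := h .nw
  have h₃ := h .sw
  have h₄ := h .se
  simp only [Dart.rot, Quad.rot] at h₁ h₂ h₃ h₄
  cases q <;> simp only [Quad.vert, Quad.horiz, halfAt] at * <;> constructor <;> grind

theorem start_smooth (σ : D.Vtx → Bool) (d : D.HalfEdge) (hd : d.smooth σ ≠ d) :
    χ.start (d.smooth σ) = !χ.start d := by
  rcases d with ⟨v, q⟩ | ⟨p, o⟩ | i
  · have h := χ.start_quad v q
    by_cases hv : σ v = true
    · simpa [Dart.smooth, hv] using h.1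
    · simpa [Dart.smooth, hv] using h.2
  · exact χ.start_rot (.inr (.inl (p, o)))
  · exact absurd rfl hd

/-- The smoothing `D_s^χ` of the diagram, where `σ v` says how the vertex `v` is smoothed, with the
orientation given by the checkerboard coloring. -/
def smoothing (σ : D.Vtx → Bool) : Cobordism χ.bdryMinus χ.bdryPlus where
  End := D.HalfEdge
  tail := χ.start
  other := D.edge
  other_other := D.edge_edge
  tail_other := χ.start_edge
  glue d := d.smooth σ
  glue_glue := by
    rintro (⟨v, q⟩ | ⟨p, o⟩ | i)
    · by_cases hv : σ v = true <;> cases q <;> simp [Dart.smooth, hv, Quad.vert, Quad.horiz]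
    · simp [Dart.smooth]
    · rfl
  tail_glue := χ.start_smooth σ
  bdry := Sum.elim (fun i => .inr (.inr (D.botEnd i))) (fun i => .inr (.inr (D.topEnd i)))
  bdry_injective := by
    have key : ∀ (i : Fin D.bot) (j : Fin D.top), D.botEnd i ≠ D.topEnd j := by
      intro i j h
      have h' := congrArg Fin.val h
      simp only [botEnd, topEnd, Fin.val_natAdd, Fin.val_castAdd] at h'
      omega
    rintro (i | i) (j | j) h
    · have h' : D.botEnd i = D.botEnd j := Sum.inr_injective (Sum.inr_injective h)
      exact congrArg Sum.inl (Fin.rev_injective (Fin.natAdd_injective _ _ h'))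
    · exact absurd (Sum.inr_injective (Sum.inr_injective h)) (key i j)
    · exact absurd (Sum.inr_injective (Sum.inr_injective h)).symm (key j i)
    · have h' : D.topEnd i = D.topEnd j := Sum.inr_injective (Sum.inr_injective h)
      exact congrArg Sum.inr (Fin.castAdd_injective _ _ h')
  glue_eq_self_iff := by
    rintro (⟨v, q⟩ | ⟨p, o⟩ | i)
    · by_cases hv : σ v = true <;> cases q <;> simp [Dart.smooth, hv, Quad.vert, Quad.horiz]
    · simp [Dart.smooth]
    · refine ⟨fun _ => ?_, fun _ => rfl⟩
      refine Fin.addCases (fun j => ⟨.inr j, rfl⟩) (fun j => ⟨.inl j.rev, ?_⟩) i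
      change Sum.inr (Sum.inr (Fin.natAdd D.top j.rev.rev)) = _
      rw [Fin.rev_rev]
  tail_bdry₀ _ := rfl
  tail_bdry₁ _ := (Bool.not_not _).symm

/-- The saddle between two smoothings at the vertex `c`: the components are those of the union of
both smoothings, and a band is attached at `c`. -/
noncomputable def saddle (σ τ : D.Vtx → Bool) (c : D.Vtx) :
    SurfData (χ.smoothing σ) (χ.smoothing τ) where
  Comp := Quot (fun x y : D.HalfEdge => (χ.smoothing σ).Adj x y ∨ (χ.smoothing τ).Adj x y)
  finite := Quot.finite (α := D.HalfEdge) _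
  in₀ := Quot.mk _
  in₀_adj _ _ h := Quot.sound (.inl h)
  in₁ := Quot.mk _
  in₁_adj _ _ h := Quot.sound (.inr h)
  compat _ := rfl
  euler := Finsupp.single (Quot.mk _ (D.halfAt c .nw)) (-1)

/-- The smoothings `σ` and `τ` differ exactly at the vertex `c`. -/
def DifferAt (σ τ : D.Vtx → Bool) (c : D.Vtx) : Prop :=
  τ c ≠ σ c ∧ ∀ v, v ≠ c → τ v = σ v

theorem saddle_isSurface {σ τ : D.Vtx → Bool} {c : D.Vtx} (h : DifferAt σ τ c) :
    IsSurface (χ.saddle σ τ c) := by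
  obtain ⟨hc, hv⟩ := h
  refine .saddle (Equiv.refl D.HalfEdge) (D.halfAt c .nw) (D.halfAt c .se) ?_
  have hq : ∀ q : Quad, (D.halfAt c q).smooth σ =
      D.halfAt c (if σ c then q.vert else q.horiz) := fun _ => rfl
  have hq' : ∀ q : Quad, (D.halfAt c q).smooth τ =
      D.halfAt c (if τ c then q.vert else q.horiz) := fun _ => rfl
  have hττ : ∀ z : D.HalfEdge, (z.smooth τ).smooth τ = z := (χ.smoothing τ).glue_glue
  have hglue : ∀ z : D.HalfEdge, z ≠ D.halfAt c .nw → z ≠ D.halfAt c .se →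
      z ≠ (D.halfAt c .nw).smooth σ → z ≠ (D.halfAt c .se).smooth σ →
      z.smooth τ = z.smooth σ := by
    rintro (⟨v, q⟩ | ⟨p, o⟩ | i) h₁ h₂ h₃ h₄
    · by_cases hvc : v = c
      · subst hvc
        rw [hq] at h₃ h₄
        cases hs : σ v <;> cases q <;> simp_all [Quad.vert, Quad.horiz]
      · change Sum.inl _ = Sum.inl _
        rw [hv v hvc]
    · rfl
    · rfl
  have hx : (D.halfAt c .nw).smooth τ = (D.halfAt c .se).smooth σ := by
    rw [hq, hq']
    cases hs : σ c <;> cases ht : τ c <;> simp [hs, ht, Quad.vert, Quad.horiz] at hc ⊢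
  have hy : (D.halfAt c .se).smooth τ = (D.halfAt c .nw).smooth σ := by
    rw [hq, hq']
    cases hs : σ c <;> cases ht : τ c <;> simp [hs, ht, Quad.vert, Quad.horiz] at hc ⊢
  have hxy : (D.halfAt c .nw : D.HalfEdge) ≠ D.halfAt c .se := by simp
  refine
    { other_eq := fun _ => rfl
      tail_eq := fun _ => rfl
      bdry_eq := fun _ => rfl
      ne := hxy
      tail_xy := ?_
      interior_x := ?_
      interior_y := ?_
      glue_x := hx
      glue_y := hy
      glue_eq := hglue
      in₁_eq := fun _ => rfl
      surj₀ := Quot.exists_rep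
      in₀_eq_iff := ?_
      euler_eq := rfl }
  · have h₁ := χ.start_rot (D.halfAt c .nw)
    have h₂ := χ.start_rot (D.halfAt c .sw)
    simp only [Dart.rot, Quad.rot, halfAt] at h₁ h₂
    change χ.start (.inl (c, .nw)) = χ.start (.inl (c, .se))
    rw [h₂, h₁, Bool.not_not]
  · change Dart.smooth σ (D.halfAt c _) ≠ D.halfAt c _
    rw [hq]
    cases σ c <;> simp [Quad.vert, Quad.horiz]
  · change Dart.smooth σ (D.halfAt c _) ≠ D.halfAt c _
    rw [hq]
    cases σ c <;> simp [Quad.vert, Quad.horiz]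
  · intro z w
    let R : D.HalfEdge → D.HalfEdge → Prop := fun s t =>
      (χ.smoothing σ).Adj s t ∨ (s = D.halfAt c .nw ∧ t = D.halfAt c .se)
    let R' : D.HalfEdge → D.HalfEdge → Prop := fun s t =>
      (χ.smoothing σ).Adj s t ∨ (χ.smoothing τ).Adj s t
    change Quot.mk R' z = Quot.mk R' w ↔ Relation.EqvGen R z w
    have hRxy : Quot.mk R (D.halfAt c .nw) = Quot.mk R (D.halfAt c .se) :=
      Quot.sound (.inr ⟨rfl, rfl⟩)
    have hRg : ∀ s : D.HalfEdge, Quot.mk R (s.smooth σ) = Quot.mk R s :=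
      fun s => (Quot.sound (.inl (.inr rfl))).symm
    have hτ : ∀ s : D.HalfEdge, Quot.mk R (s.smooth τ) = Quot.mk R s := by
      intro s
      by_cases e₁ : s = D.halfAt c .nw
      · rw [e₁, hx, hRg, hRxy]
      by_cases e₂ : s = D.halfAt c .se
      · rw [e₂, hy, hRg, hRxy]
      by_cases e₃ : s = (D.halfAt c .nw).smooth σ
      · rw [e₃, ← hy, hττ, hy, hRg, hRxy]
      by_cases e₄ : s = (D.halfAt c .se).smooth σ
      · rw [e₄, ← hx, hττ, hx, hRg, hRxy]
      rw [hglue s e₁ e₂ e₃ e₄, hRg]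
    constructor
    · intro e
      apply Quot.eqvGen_exact
      have key : ∀ s t, R' s t → Quot.mk R s = Quot.mk R t := by
        rintro s t (h | h | h)
        · exact Quot.sound (.inl h)
        · exact Quot.sound (.inl (.inl h))
        · exact (hτ s).symm.trans (congrArg (Quot.mk R) h.symm)
      exact congrArg (Quot.lift (Quot.mk R) key) e
    · intro e
      induction e with
      | rel s t h =>
        rcases h with h | ⟨rfl, rfl⟩
        · exact Quot.sound (.inl h)
        · have h₁ : Quot.mk R' (D.halfAt c .nw) =
              Quot.mk R' ((D.halfAt c .nw).smooth τ) := Quot.sound (.inr (.inr rfl))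
          have h₂ : Quot.mk R' (D.halfAt c .se) =
              Quot.mk R' ((D.halfAt c .se).smooth σ) := Quot.sound (.inl (.inr rfl))
          rw [h₁, h₂, hx]
      | refl => rfl
      | symm _ _ _ ih => exact ih.symm
      | trans _ _ _ _ _ ih₁ ih₂ => exact ih₁.trans ih₂

/-- The identity bordism of a smoothing with a tube that joins the sheet over the half-edge `x` and
the sheet over the half-edge `y`. -/
noncomputable def tube (σ : D.Vtx → Bool) (x y : D.HalfEdge) :
    SurfData (χ.smoothing σ) (χ.smoothing σ) :=
  (SurfData.id (χ.smoothing σ)).addTube (Quot.mk _ x) (Quot.mk _ y)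

theorem tube_isSurface (σ : D.Vtx → Bool) (x y : D.HalfEdge) : IsSurface (χ.tube σ x y) :=
  .addTube (.cylinder (SurfData.isCylinder_id _)) _ _

variable (k : Type u) [CommRing k]

/-- The genus-one morphism `Φ` of a smoothing that is `)(` at `b`: the cobordism with a tube between
the two sheets at `b`, minus the cobordism with a handle on the left sheet. -/
noncomputable def genusOne (σ : D.Vtx → Bool) (b : D.Vtx) :
    cobObj k (χ.smoothing σ) ⟶ cobObj k (χ.smoothing σ) :=
  cobMap k (χ.tube σ (D.halfAt b .nw) (D.halfAt b .ne)) (χ.tube_isSurface σ _ _) -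
    cobMap k (χ.tube σ (D.halfAt b .nw) (D.halfAt b .nw)) (χ.tube_isSurface σ _ _)

end Coloring

/-- A resolution scheme `r` and a state `s`: the double points in `r` are resolved to positive and
the other ones to negative crossings, and then the crossings in `s` are smoothed by the
`1`-smoothing and the other ones by the `0`-smoothing. The smoothing `)(` is the `1`-smoothing of a
negative and the `0`-smoothing of a positive crossing. -/
def resolve (D : SingularTangleDiagram) (r s : Finset D.Vtx) (v : D.Vtx) : Bool :=
  if D.kind v = .pos ∨ (D.kind v = .dbl ∧ v ∈ r) then decide (v ∉ s) else decide (v ∈ s)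

theorem differAt_resolve (r : Finset D.Vtx) {s : Finset D.Vtx} {c : D.Vtx} (hc : c ∉ s) :
    Coloring.DifferAt (D.resolve r s) (D.resolve r (insert c s)) c := by
  constructor
  · simp only [resolve]
    split_ifs <;> simp [hc]
  · intro v hv
    simp [resolve, hv]

theorem resolve_insert_erase {r s : Finset D.Vtx} {b : D.Vtx} (hk : D.kind b = .dbl) (hr : b ∉ r)
    (hs : b ∈ s) : D.resolve r s = D.resolve (insert b r) (s.erase b) := by
  funext v
  by_cases hv : v = b
  · subst hv
    simp [resolve, hk, hr, hs]
  · simp [resolve, hv]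

namespace Coloring

variable (k : Type u) [CommRing k] (χ : D.Coloring)

/-- The sign `(-1) ^ #{a ∈ s | a < c}`. -/
def sign (s : Finset D.Vtx) (c : D.Vtx) : ℤ := (-1) ^ (s.filter (· < c)).card

/-- The component of the differential from the summand `(r, s)` to the summand `(r', s')`: a saddle
with sign when `r' = r` and `s' = s ∪ {c}`, a genus-one morphism with sign when `b ∉ r` is a double
point, `b ∈ s`, `r' = r ∪ {b}` and `s' = s \ {b}`, and zero otherwise. -/
noncomputable def entry (r s r' s' : Finset D.Vtx) :
    cobObj k (χ.smoothing (D.resolve r s)) ⟶ cobObj k (χ.smoothing (D.resolve r' s')) :=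
  (∑ c : D.Vtx, if h : r' = r ∧ c ∉ s ∧ s' = insert c s then
    sign s c • cobMap k (χ.saddle (D.resolve r s) (D.resolve r' s') c)
      (χ.saddle_isSurface (by rw [h.1, h.2.2]; exact differAt_resolve r h.2.1))
    else 0) +
  ∑ b : D.Vtx, if h : D.kind b = .dbl ∧ b ∉ r ∧ b ∈ s ∧ r' = insert b r ∧ s' = s.erase b then
    sign s b • (χ.genusOne k (D.resolve r s) b ≫
      eqToHom (congrArg (fun σ => cobObj k (χ.smoothing σ)) (by
        rw [h.2.2.2.1, h.2.2.2.2]; exact resolve_insert_erase h.1 h.2.1 h.2.2.1)))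
    else 0

variable (D) in
/-- The summands of the bracket complex in degree `i`: a set `r` of double points and a set `s` of
vertices with `|s| + 2 |r| = i`. -/
abbrev Summand (i : ℤ) : Type :=
  {p : Finset D.Vtx × Finset D.Vtx // (∀ v ∈ p.1, D.kind v = .dbl) ∧
    (p.2.card : ℤ) + 2 * (p.1.card : ℤ) = i}

/-- The degree `i` part of the universal bracket complex. -/
noncomputable def bracketObj (i : ℤ) : CobMat χ.bdryMinus χ.bdryPlus k where
  ι := Summand D i
  X p := cobObj k (χ.smoothing (D.resolve p.1.1 p.1.2))

/-- The differential of the universal bracket complex. -/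
noncomputable def bracketD (i : ℤ) : χ.bracketObj k i ⟶ χ.bracketObj k (i + 1) :=
  fun p q => χ.entry k p.1.1 p.1.2 q.1.1 q.1.2

/-- The maps `bracketD` form a complex. -/
def IsComplex : Prop := ∀ i : ℤ, χ.bracketD k i ≫ χ.bracketD k (i + 1) = 0

/-- The universal bracket complex of a singular tangle diagram with a checkerboard coloring. -/
noncomputable def bracket (h : χ.IsComplex k) :
    CochainComplex (CobMat χ.bdryMinus χ.bdryPlus k) ℤ :=
  CochainComplex.of (χ.bracketObj k) (χ.bracketD k) h

variable (D) in
/-- The number of vertices of a given kind. -/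
def count (κ : Kind) : ℕ := (Finset.univ.filter (fun v : D.Vtx => D.kind v = κ)).card

/-- The bracket complex shifted by `[-n₋ - 2 n×]`, where `W[m]` has `W[m]ⁱ = Wⁱ⁻ᵐ`.  For the coloring
whose negatively unbounded region is white this is the universal Khovanov complex. -/
noncomputable def khovanov (h : χ.IsComplex k) :
    CochainComplex (CobMat χ.bdryMinus χ.bdryPlus k) ℤ :=
  (CategoryTheory.shiftFunctor _ ((count D .neg : ℤ) + 2 * (count D .dbl : ℤ))).obj (χ.bracket k h)

end Coloring

end SingularTangleDiagram

/-- A complex is contractible if its identity is null-homotopic. -/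
def IsContractible {C : Type*} [Category C] [Preadditive C] (K : CochainComplex C ℤ) : Prop :=
  Nonempty (Homotopy (𝟙 K) 0)

end SingTangle

namespace SingTangle

variable {Y₀ Y₁ : SignedSet}

namespace SurfData

variable {W₀ W₁ W₂ : Cobordism Y₀ Y₁}

/-! ### Tubes and gluing -/

/-! At the kink `b` an edge joins two half-edges that the smoothing `)(` also joins, so `)(` splits
off a circle, whereas the other smoothing absorbs the loop into the strand. Let σ and τ be two
smoothings of these two types that agree elsewhere. Keeping track only of whether `b` lies in `r`
and in `s`, the complex has four terms, τ --saddle--> σ --Φ--> σ --saddle--> τ, at (b ∈ r, b ∈ s) =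
(no, no), (no, yes), (yes, no), (yes, yes). The contraction runs backwards through the death of the
circle, ∓ death followed by birth, and the birth. At the outer terms, splitting off the circle and
capping it, or creating it and merging it, gives the identity (`cobMap_saddle_death`,
`cobMap_birth_saddle`).

The middle terms need a neck-cutting formula. A tube joining the disc of the death to the disc of
the birth is a cylinder. Apply 4Tu to discs in these two components, in the strand, and once more in
one of the first two. The result is `saddle_comp_birth_sub` and `death_comp_saddle_sub`, in which Φ
appears as the tube from loop to strand minus a handle on the loop. By 4Tu again this is ±Φ,
according to the side on which the loop lies (`genusOne_eq_loopGenus`).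

For the whole complex, morphisms attached to different vertices commute. Every component of the
differential and of the homotopy toggles the membership in `s` of its own vertex and of no other, so
the signs turn commuting squares into anticommuting ones (`sum_sign_comp_sign`). Together with the
vanishing of saddle and Φ composed at one vertex this gives d² = 0, and in dh + hd only the
contributions of `b` survive (`sum_entry_kinkHomotopy`, `sum_kink_self`).

Identities between bordisms become combinatorial by presenting components as classes of half-edges.
Two presentations on the same generators agree once the functions constant on classes are the same
for both (`pres_iso`). -/

theorem Iso.addTube {S T : SurfData W₀ W₁} (e : S.Comp ≃ T.Comp) (h₀ : ∀ x, e (S.in₀ x) = T.in₀ x)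
    (h₁ : ∀ x, e (S.in₁ x) = T.in₁ x) (h : S.euler.mapDomain e = T.euler) (a b : S.Comp) :
    Iso (S.addTube a b) (T.addTube (e a) (e b)) := by
  refine ⟨⟨Quot.lift (fun c => Quot.mk _ (e c)) ?_, Quot.lift (fun c => Quot.mk _ (e.symm c)) ?_,
    ?_, ?_⟩, fun x => congrArg (Quot.mk _) (h₀ x), fun x => congrArg (Quot.mk _) (h₁ x), ?_⟩
  · rintro _ _ ⟨rfl, rfl⟩
    exact Quot.sound ⟨rfl, rfl⟩
  · rintro _ _ ⟨rfl, rfl⟩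
    exact Quot.sound ⟨e.symm_apply_apply _, e.symm_apply_apply _⟩
  · rintro ⟨c⟩
    exact congrArg (Quot.mk _) (e.symm_apply_apply c)
  · rintro ⟨c⟩
    exact congrArg (Quot.mk _) (e.apply_symm_apply c)
  · simp only [SurfData.addTube, ← h, Finsupp.mapDomain_add, ← Finsupp.mapDomain_comp,
      Finsupp.mapDomain_single]
    rfl

/-- A tube joins `a` to `b` as well as `b` to `a`. -/
theorem addTube_comm (S : SurfData W₀ W₁) (a b : S.Comp) :
    Iso (S.addTube a b) (S.addTube b a) := by
  refine ⟨⟨Quot.lift (fun c => Quot.mk _ c) ?_, Quot.lift (fun c => Quot.mk _ c) ?_, ?_, ?_⟩,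
    fun _ => rfl, fun _ => rfl, ?_⟩
  · rintro _ _ ⟨rfl, rfl⟩
    exact (Quot.sound ⟨rfl, rfl⟩).symm
  · rintro _ _ ⟨rfl, rfl⟩
    exact (Quot.sound ⟨rfl, rfl⟩).symm
  · rintro ⟨c⟩
    rfl
  · rintro ⟨c⟩
    rfl
  · simp only [SurfData.addTube, Finsupp.mapDomain_add, ← Finsupp.mapDomain_comp,
      Finsupp.mapDomain_single]
    exact congrArg₂ _ rfl (congrArg (fun c => Finsupp.single c (-2 : ℤ)) (Quot.sound ⟨rfl, rfl⟩).symm)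

/-- Tubes in the second of two glued bordisms. -/
theorem comp_addTube (S : SurfData W₀ W₁) (T : SurfData W₁ W₂) (a b : T.Comp) :
    Iso (S.comp (T.addTube a b))
      ((S.comp T).addTube (Quot.mk _ (.inr a)) (Quot.mk _ (.inr b))) := by
  refine ⟨⟨Quot.lift (Sum.elim (fun s => Quot.mk _ (Quot.mk _ (.inl s)))
      (Quot.lift (fun t => Quot.mk _ (Quot.mk _ (.inr t))) ?_)) ?_,
    Quot.lift (Quot.lift (Sum.elim (fun s => Quot.mk _ (.inl s))
      (fun t => Quot.mk _ (.inr (Quot.mk _ t)))) ?_) ?_, ?_, ?_⟩, fun _ => rfl, fun _ => rfl, ?_⟩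
  · rintro _ _ ⟨rfl, rfl⟩
    exact Quot.sound ⟨rfl, rfl⟩
  · rintro _ _ ⟨x⟩
    exact congrArg (Quot.mk _) (Quot.sound (GlueRel.mk x))
  · rintro _ _ ⟨x⟩
    exact Quot.sound (GlueRel.mk (T := T.addTube a b) x)
  · rintro _ _ ⟨rfl, rfl⟩
    exact congrArg (fun z => Quot.mk _ (Sum.inr z)) (Quot.sound ⟨rfl, rfl⟩)
  · rintro ⟨s | t⟩
    · rfl
    · obtain ⟨t, rfl⟩ := Quot.exists_rep (r := fun x y : T.Comp => x = a ∧ y = b) t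
      rfl
  · rintro ⟨⟨s | t⟩⟩ <;> rfl
  · simp only [SurfData.addTube, SurfData.comp, Finsupp.mapDomain_add, ← Finsupp.mapDomain_comp,
      Finsupp.mapDomain_single, ← add_assoc]
    rfl

/-- Tubes in the first of two glued bordisms. -/
theorem addTube_comp (S : SurfData W₀ W₁) (T : SurfData W₁ W₂) (a b : S.Comp) :
    Iso ((S.addTube a b).comp T)
      ((S.comp T).addTube (Quot.mk _ (.inl a)) (Quot.mk _ (.inl b))) := by
  refine ⟨⟨Quot.lift (Sum.elim (Quot.lift (fun s => Quot.mk _ (Quot.mk _ (.inl s))) ?_)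
      (fun t => Quot.mk _ (Quot.mk _ (.inr t)))) ?_,
    Quot.lift (Quot.lift (Sum.elim (fun s => Quot.mk _ (.inl (Quot.mk _ s)))
      (fun t => Quot.mk _ (.inr t))) ?_) ?_, ?_, ?_⟩, fun _ => rfl, fun _ => rfl, ?_⟩
  · rintro _ _ ⟨rfl, rfl⟩
    exact Quot.sound ⟨rfl, rfl⟩
  · rintro _ _ ⟨x⟩
    exact congrArg (Quot.mk _) (Quot.sound (GlueRel.mk x))
  · rintro _ _ ⟨x⟩
    exact Quot.sound (GlueRel.mk (S := S.addTube a b) x)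
  · rintro _ _ ⟨rfl, rfl⟩
    exact congrArg (fun z => Quot.mk _ (Sum.inl z)) (Quot.sound ⟨rfl, rfl⟩)
  · rintro ⟨s | t⟩
    · obtain ⟨s, rfl⟩ := Quot.exists_rep (r := fun x y : S.Comp => x = a ∧ y = b) s
      rfl
    · rfl
  · rintro ⟨⟨s | t⟩⟩ <;> rfl
  · simp only [SurfData.addTube, SurfData.comp, Finsupp.mapDomain_add, ← Finsupp.mapDomain_comp,
      Finsupp.mapDomain_single]
    rw [add_right_comm]
    rfl

theorem addTube_eq {S : SurfData W₀ W₁} {a a' b b' : S.Comp} (ha : a = a') (hb : b = b') :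
    Iso (S.addTube a b) (S.addTube a' b') := by
  subst ha hb
  exact .refl _

/-- Gluing a cylinder with a tube to the outgoing end. -/
theorem comp_idTube (S : SurfData W₀ W₁) (x y : W₁.End) :
    Iso (S.comp ((SurfData.id W₁).addTube (Quot.mk _ x) (Quot.mk _ y)))
      (S.addTube (S.in₁ x) (S.in₁ y)) := by
  refine (comp_addTube _ _ _ _).trans ?_
  obtain ⟨e, h₀, h₁, h⟩ := S.comp_id
  exact (Iso.addTube e h₀ h₁ h _ _).trans (addTube_eq (h₁ x) (h₁ y))

/-- Gluing a cylinder with a tube to the incoming end. -/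
theorem idTube_comp (S : SurfData W₀ W₁) (x y : W₀.End) :
    Iso (((SurfData.id W₀).addTube (Quot.mk _ x) (Quot.mk _ y)).comp S)
      (S.addTube (S.in₀ x) (S.in₀ y)) := by
  refine (addTube_comp _ _ _ _).trans ?_
  obtain ⟨e, h₀, h₁, h⟩ := S.id_comp
  exact (Iso.addTube e h₀ h₁ h _ _).trans (addTube_eq (h₀ x) (h₀ y))

/-! ### Bordisms presented by generators and relations of their sets of components -/

/-- The bordism whose components are the classes of the equivalence relation generated by `r`. -/
noncomputable def pres {Z : Type} [Finite Z] (r : Z → Z → Prop) (f : W₀.End → Z) (g : W₁.End → Z)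
    (E : Z →₀ ℤ) (hf : ∀ x y, W₀.Adj x y → Quot.mk r (f x) = Quot.mk r (f y))
    (hg : ∀ x y, W₁.Adj x y → Quot.mk r (g x) = Quot.mk r (g y))
    (hb : ∀ p, Quot.mk r (f (W₀.bdry p)) = Quot.mk r (g (W₁.bdry p))) : SurfData W₀ W₁ where
  Comp := Quot r
  in₀ x := Quot.mk r (f x)
  in₀_adj := hf
  in₁ x := Quot.mk r (g x)
  in₁_adj := hg
  compat := hb
  euler := E.mapDomain (Quot.mk r)

section

variable {Z : Type} [Finite Z] {r r' : Z → Z → Prop} {E E' : Z →₀ ℤ}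

/-- Together with `quotMk_map`, supplies the well-definedness conditions of `pres` when a gluing or
a tube enlarges the relation. -/
theorem quotMk_or {Z : Type} {r s : Z → Z → Prop} {z w : Z} (h : Quot.mk r z = Quot.mk r w) :
    Quot.mk (fun x y => r x y ∨ s x y) z = Quot.mk (fun x y => r x y ∨ s x y) w :=
  congrArg (Quot.map (fun x => x) fun _ _ => Or.inl) h

theorem quotMk_map {Z Z' : Type} {r : Z' → Z' → Prop} {q : Z → Z → Prop} {f : Z → Z'} {x y : Z}
    (h : Quot.mk q x = Quot.mk q y) :
    Quot.mk (fun z w => r z w ∨ ∃ x y, q x y ∧ f x = z ∧ f y = w) (f x) =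
      Quot.mk (fun z w => r z w ∨ ∃ x y, q x y ∧ f x = z ∧ f y = w) (f y) :=
  congrArg (Quot.map f fun x y h => .inr ⟨x, y, h, rfl, rfl⟩) h

/-- The map `m` is constant on the classes of the equivalence relation generated by `r`. -/
def Respects {Z Q : Type} (r : Z → Z → Prop) (m : Z → Q) : Prop :=
  ∀ z w, r z w → m z = m w

theorem respects_or {Z Q : Type} {r s : Z → Z → Prop} {m : Z → Q} :
    Respects (fun z w => r z w ∨ s z w) m ↔ Respects r m ∧ Respects s m :=
  ⟨fun h => ⟨fun z w k => h z w (.inl k), fun z w k => h z w (.inr k)⟩,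
    fun h z w k => k.elim (h.1 z w) (h.2 z w)⟩

theorem respects_map {Z Z' Q : Type} {q : Z → Z → Prop} {f : Z → Z'} {m : Z' → Q} :
    Respects (fun z w => ∃ x y, q x y ∧ f x = z ∧ f y = w) m ↔ Respects q (fun x => m (f x)) := by
  constructor
  · exact fun h x y k => h _ _ ⟨x, y, k, rfl, rfl⟩
  · rintro h _ _ ⟨x, y, k, rfl, rfl⟩
    exact h x y k

theorem respects_pair {Z Q : Type} {a b : Z} {m : Z → Q} :
    Respects (fun z w => z = a ∧ w = b) m ↔ m a = m b := by
  constructor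
  · exact fun h => h _ _ ⟨rfl, rfl⟩
  · rintro h _ _ ⟨rfl, rfl⟩
    exact h

theorem mapDomain_map_single_add {Z Z' Q : Type} (m : Z → Q) (f : Z' → Z) (a : Z') (b : Z)
    (i j : ℤ) : ((Finsupp.single a i).mapDomain f + Finsupp.single b j).mapDomain m =
      Finsupp.single (m (f a)) i + Finsupp.single (m b) j := by
  simp only [Finsupp.mapDomain_add, Finsupp.mapDomain_single]

theorem mapDomain_single_add_map {Z Z' Q : Type} (m : Z → Q) (f : Z' → Z) (a : Z) (b : Z')
    (i j : ℤ) : (Finsupp.single a i + (Finsupp.single b j).mapDomain f).mapDomain m =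
      Finsupp.single (m a) i + Finsupp.single (m (f b)) j := by
  simp only [Finsupp.mapDomain_add, Finsupp.mapDomain_single]

/-- Universal property of quotients: if each relation is respected by the maps that respect the
other, the identity of `Z` descends to mutually inverse maps. Only the relations and the boundary
markings and Euler characteristics after projection have to be compared, so no bijection of
components is ever built by hand. -/
theorem pres_iso {f f' : W₀.End → Z} {g g' : W₁.End → Z} {hf hg hb hf' hg' hb'}
    (h : ∀ m : Z → Quot r', Respects r' m → Respects r m ∧ (∀ x, m (f x) = m (f' x)) ∧
      (∀ x, m (g x) = m (g' x)) ∧ E.mapDomain m = E'.mapDomain m)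
    (h' : ∀ m : Z → Quot r, Respects r m → Respects r' m) :
    Iso (pres (W₀ := W₀) (W₁ := W₁) r f g E hf hg hb) (pres r' f' g' E' hf' hg' hb') := by
  obtain ⟨h, h₀, h₁, hE⟩ := h (Quot.mk r') fun _ _ => Quot.sound
  refine ⟨⟨Quot.lift (Quot.mk r') h, Quot.lift (Quot.mk r) (h' _ fun _ _ => Quot.sound), ?_, ?_⟩,
    h₀, h₁, ?_⟩
  · rintro ⟨z⟩
    rfl
  · rintro ⟨z⟩
    rfl
  · simp only [pres, ← Finsupp.mapDomain_comp]
    exact hE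

/-- In terms of presentations a tube is one more relation, together with -2 in the Euler
characteristic. -/
theorem pres_addTube {f : W₀.End → Z} {g : W₁.End → Z} {hf hg hb} (z w : Z) :
    Iso ((pres (W₀ := W₀) (W₁ := W₁) r f g E hf hg hb).addTube (Quot.mk r z) (Quot.mk r w))
      (pres (fun x y => r x y ∨ (x = z ∧ y = w)) f g (E + Finsupp.single z (-2))
        (fun x y h => quotMk_or (hf x y h))
        (fun x y h => quotMk_or (hg x y h))
        (fun p => quotMk_or (hb p))) := by
  refine ⟨⟨Quot.lift (Quot.lift (fun z => Quot.mk _ z) fun _ _ h => Quot.sound (.inl h)) ?_,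
    Quot.lift (fun c => Quot.mk _ (Quot.mk _ c)) ?_, ?_, ?_⟩, fun _ => rfl, fun _ => rfl, ?_⟩
  · rintro _ _ ⟨rfl, rfl⟩
    exact Quot.sound (.inr ⟨rfl, rfl⟩)
  · rintro x y (h | ⟨rfl, rfl⟩)
    · exact congrArg (Quot.mk _) (Quot.sound h)
    · exact Quot.sound ⟨rfl, rfl⟩
  · rintro ⟨⟨c⟩⟩
    rfl
  · rintro ⟨c⟩
    rfl
  · simp only [pres, SurfData.addTube, Finsupp.mapDomain_add, ← Finsupp.mapDomain_comp,
      Finsupp.mapDomain_single]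
    rfl

/-- Gluing when the first bordism has its components marked by ends of the middle manifold. -/
theorem pres_comp_right {q : W₁.End → W₁.End → Prop} {F : W₁.End →₀ ℤ} {f : W₀.End → W₁.End}
    {f' : W₁.End → Z} {g' : W₂.End → Z} {hf hg hb hf' hg' hb'} :
    Iso ((pres (W₀ := W₀) (W₁ := W₁) q f (fun x => x) F hf hg hb).comp
        (pres (W₁ := W₂) r f' g' E hf' hg' hb'))
      (pres (fun z w => r z w ∨ ∃ x y, q x y ∧ f' x = z ∧ f' y = w) (fun x => f' (f x)) g'
        (F.mapDomain f' + E) (fun x y h => quotMk_map (hf x y h)) (fun x y h => quotMk_or (hg' x y h))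
        (fun p => (quotMk_map (hb p)).trans (quotMk_or (hb' p)))) := by
  refine ⟨⟨Quot.lift (Sum.elim (Quot.lift (fun x => Quot.mk _ (f' x)) ?_)
      (Quot.lift (fun z => Quot.mk _ z) fun _ _ h => Quot.sound (.inl h))) ?_,
    Quot.lift (fun z => Quot.mk _ (.inr (Quot.mk _ z))) ?_, ?_, ?_⟩, fun _ => rfl, fun _ => rfl, ?_⟩
  · exact fun x y h => Quot.sound (.inr ⟨x, y, h, rfl, rfl⟩)
  · rintro _ _ ⟨x⟩
    rfl
  · rintro _ _ (h | ⟨x, y, h, rfl, rfl⟩)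
    · exact congrArg (fun z => Quot.mk _ (Sum.inr z)) (Quot.sound h)
    · refine ((Quot.sound (GlueRel.mk x)).symm.trans ?_).trans (Quot.sound (GlueRel.mk y))
      exact congrArg (fun z => Quot.mk _ (Sum.inl z)) (Quot.sound h)
  · rintro ⟨x | z⟩
    · obtain ⟨x, rfl⟩ := Quot.exists_rep (r := q) x
      exact (Quot.sound (GlueRel.mk x)).symm
    · obtain ⟨z, rfl⟩ := Quot.exists_rep (r := r) z
      rfl
  · rintro ⟨z⟩
    rfl
  · simp only [pres, SurfData.comp, Finsupp.mapDomain_add, ← Finsupp.mapDomain_comp]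
    rfl

/-- Gluing when the second bordism has its components marked by ends of the middle manifold. -/
theorem pres_comp_left {q : W₁.End → W₁.End → Prop} {F : W₁.End →₀ ℤ} {f : W₀.End → Z}
    {g : W₁.End → Z} {g' : W₂.End → W₁.End} {hf hg hb hf' hg' hb'} :
    Iso ((pres (W₀ := W₀) (W₁ := W₁) r f g E hf hg hb).comp
        (pres (W₁ := W₂) q (fun x => x) g' F hf' hg' hb'))
      (pres (fun z w => r z w ∨ ∃ x y, q x y ∧ g x = z ∧ g y = w) f (fun x => g (g' x))
        (E + F.mapDomain g) (fun x y h => quotMk_or (hf x y h)) (fun x y h => quotMk_map (hg' x y h))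
        (fun p => (quotMk_or (hb p)).trans (quotMk_map (hb' p)))) := by
  refine ⟨⟨Quot.lift (Sum.elim (Quot.lift (fun z => Quot.mk _ z) fun _ _ h => Quot.sound (.inl h))
      (Quot.lift (fun x => Quot.mk _ (g x)) ?_)) ?_,
    Quot.lift (fun z => Quot.mk _ (.inl (Quot.mk _ z))) ?_, ?_, ?_⟩, fun _ => rfl, fun _ => rfl, ?_⟩
  · exact fun x y h => Quot.sound (.inr ⟨x, y, h, rfl, rfl⟩)
  · rintro _ _ ⟨x⟩
    rfl
  · rintro _ _ (h | ⟨x, y, h, rfl, rfl⟩)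
    · exact congrArg (fun z => Quot.mk _ (Sum.inl z)) (Quot.sound h)
    · refine ((Quot.sound (GlueRel.mk x)).trans ?_).trans (Quot.sound (GlueRel.mk y)).symm
      exact congrArg (fun z => Quot.mk _ (Sum.inr z)) (Quot.sound h)
  · rintro ⟨z | x⟩
    · obtain ⟨z, rfl⟩ := Quot.exists_rep (r := r) z
      rfl
    · obtain ⟨x, rfl⟩ := Quot.exists_rep (r := q) x
      exact Quot.sound (GlueRel.mk x)
  · rintro ⟨z⟩
    rfl
  · simp only [pres, SurfData.comp, Finsupp.mapDomain_add, ← Finsupp.mapDomain_comp]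
    rfl

end

end SurfData

/-! ### Calculus of morphisms given by bordisms -/

section Linear

variable (k : Type u) [CommRing k] {W₀ W₁ W₂ : Cobordism Y₀ Y₁}

theorem cobMap_congr {S T : SurfData W₀ W₁} (h : S.Iso T) (hS : IsSurface S) (hT : IsSurface T) :
    cobMap k S hS = cobMap k T hT := by
  have : bordismMk S hS = bordismMk T hT := _root_.Quotient.sound h
  exact congrArg (fun f => (Quotient.functor (BNRel (Y₀ := Y₀) (Y₁ := Y₁) k)).map
    ((Free.embedding k (Cobordism Y₀ Y₁)).map f)) this

theorem cobMap_id (W : Cobordism Y₀ Y₁) :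
    cobMap k (SurfData.id W) (.cylinder (SurfData.isCylinder_id W)) = 𝟙 (cobObj k W) :=
  (Free.embedding k (Cobordism Y₀ Y₁) ⋙ Quotient.functor (BNRel (Y₀ := Y₀) (Y₁ := Y₁) k)).map_id W

theorem cobMap_comp {S : SurfData W₀ W₁} {T : SurfData W₁ W₂} (hS : IsSurface S)
    (hT : IsSurface T) : cobMap k S hS ≫ cobMap k T hT = cobMap k (S.comp T) (hS.comp hT) :=
  ((Free.embedding k (Cobordism Y₀ Y₁) ⋙ Quotient.functor (BNRel (Y₀ := Y₀) (Y₁ := Y₁) k)).map_comp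
    (bordismMk S hS) (bordismMk T hT)).symm

/-- The entry point of the local relations: both the sign rule for Φ and neck cutting are instances.
-/
theorem cobMap_fourTu {S : SurfData W₀ W₁} (hS : IsSurface S) (a b c d : S.Comp) :
    cobMap k (S.addTube a b) (hS.addTube a b) + cobMap k (S.addTube c d) (hS.addTube c d) =
      cobMap k (S.addTube a c) (hS.addTube a c) + cobMap k (S.addTube b d) (hS.addTube b d) :=
  CategoryTheory.Quotient.sound _ (BNRel.fourTu S hS a b c d)

end Linear

/-! ### Functions on half-edges that are constant on the components of a smoothing -/

namespace SingularTangleDiagram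

variable {D : SingularTangleDiagram}

/-- A function on half-edges that is constant on the components of a smoothing. -/
def Invariant {Q : Type*} (m : D.HalfEdge → Q) (σ : D.Vtx → Bool) : Prop :=
  ∀ x, m (D.edge x) = m x ∧ m (x.smooth σ) = m x

/-- The smoothings `σ` and `τ` agree away from `b`; at `b`, the smoothing `σ` is `)(` and `τ` is
the other one. -/
structure VertHoriz (b : D.Vtx) (σ τ : D.Vtx → Bool) : Prop where
  vert : σ b = true
  horiz : τ b = false
  off : ∀ v, v ≠ b → σ v = τ v

theorem smooth_vert {σ : D.Vtx → Bool} {b : D.Vtx} (h : σ b = true) (q : Quad) :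
    (D.halfAt b q).smooth σ = D.halfAt b q.vert := by
  simp [Dart.smooth, h]

theorem smooth_horiz {σ : D.Vtx → Bool} {b : D.Vtx} (h : σ b = false) (q : Quad) :
    (D.halfAt b q).smooth σ = D.halfAt b q.horiz := by
  simp [Dart.smooth, h]

theorem smooth_congr {σ τ : D.Vtx → Bool} {b : D.Vtx} (h : ∀ v, v ≠ b → σ v = τ v)
    {x : D.HalfEdge} (hx : ∀ q, x ≠ D.halfAt b q) : x.smooth σ = x.smooth τ := by
  rcases x with ⟨v, q⟩ | ⟨p, o⟩ | i
  · have hv : v ≠ b := by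
      rintro rfl
      exact hx q rfl
    simp [Dart.smooth, h v hv]
  · rfl
  · rfl

theorem smooth_ne_halfAt {σ : D.Vtx → Bool} {b : D.Vtx} {x : D.HalfEdge}
    (hx : ∀ q, x ≠ D.halfAt b q) (q : Quad) : x.smooth σ ≠ D.halfAt b q := by
  rcases x with ⟨v, q'⟩ | ⟨p, o⟩ | i
  · intro h
    have hv : v = b := congrArg Prod.fst (Sum.inl_injective h)
    subst hv
    exact hx q' rfl
  · simp [Dart.smooth]
  · simp [Dart.smooth]

section

variable {Q : Type*} {m : D.HalfEdge → Q} {σ τ ρ : D.Vtx → Bool} {b : D.Vtx} {q : Quad}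

/-- Invariance is a condition vertex by vertex, so it passes to any smoothing pieced together from σ
and ρ. -/
theorem Invariant.of_mix (hσ : Invariant m σ) (hρ : Invariant m ρ)
    (h : ∀ v, τ v = σ v ∨ τ v = ρ v) : Invariant m τ := by
  refine fun x => ⟨(hσ x).1, ?_⟩
  rcases x with ⟨v, q⟩ | ⟨p, o⟩ | i
  · have h₁ := (hσ (.inl (v, q))).2
    have h₂ := (hρ (.inl (v, q))).2
    rcases h v with h | h <;> simp_all [Dart.smooth]
  · exact (hσ (.inr (.inl (p, o)))).2
  · exact (hσ (.inr (.inr i))).2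

theorem Invariant.vert (h : Invariant m σ) (hb : σ b = true) (q : Quad) :
    m (D.halfAt b q.vert) = m (D.halfAt b q) := by
  rw [← smooth_vert hb, (h _).2]

theorem Invariant.horiz (h : Invariant m σ) (hb : σ b = false) (q : Quad) :
    m (D.halfAt b q.horiz) = m (D.halfAt b q) := by
  rw [← smooth_horiz hb, (h _).2]

/-- Vertex `b` has all its half-edges in one class. -/
theorem halfAt_eq_of_vert_of_horiz (hv : ∀ q, m (D.halfAt b q.vert) = m (D.halfAt b q))
    (hh : ∀ q, m (D.halfAt b q.horiz) = m (D.halfAt b q)) (p q : Quad) :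
    m (D.halfAt b p) = m (D.halfAt b q) := by
  have h₁ := hv .ne
  have h₂ := hv .nw
  have h₃ := hh .ne
  have h₄ := hh .se
  simp only [Quad.vert, Quad.horiz] at h₁ h₂ h₃ h₄
  cases p <;> cases q <;> simp_all

/-- If `m` does not distinguish the half-edges at `b`, the way `b` is smoothed is irrelevant. -/
theorem Invariant.of_halfAt_eq (h : Invariant m σ) (hoff : ∀ v, v ≠ b → σ v = τ v)
    (hb : ∀ p q, m (D.halfAt b p) = m (D.halfAt b q)) : Invariant m τ := by
  refine fun x => ⟨(h x).1, ?_⟩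
  by_cases hx : ∀ q, x ≠ D.halfAt b q
  · rw [← smooth_congr hoff hx, (h x).2]
  · push Not at hx
    obtain ⟨q, rfl⟩ := hx
    exact hb _ _

/-! ### Kinks -/

open Classical in
/-- Move the two half-edges of the loop of a kink at `b` to the strand. -/
noncomputable def unkink (b : D.Vtx) (q : Quad) (x : D.HalfEdge) : D.HalfEdge :=
  if x = D.halfAt b q ∨ x = D.halfAt b q.vert then D.halfAt b q.horiz else x

theorem unkink_self : unkink b q (D.halfAt b q) = D.halfAt b q.horiz := by
  simp [unkink]

theorem unkink_vert : unkink b q (D.halfAt b q.vert) = D.halfAt b q.horiz := by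
  simp [unkink]

theorem unkink_horiz : unkink b q (D.halfAt b q.horiz) = D.halfAt b q.horiz := by
  simp [unkink]

theorem unkink_of_ne {x : D.HalfEdge} (hx : ∀ q, x ≠ D.halfAt b q) : unkink b q x = x := by
  simp [unkink, hx]

theorem unkink_horiz_vert :
    unkink b q (D.halfAt b q.horiz.vert) = D.halfAt b q.horiz.vert := by
  have : q.horiz.vert ≠ q ∧ q.horiz.vert ≠ q.vert := by
    cases q <;> simp [Quad.horiz, Quad.vert]
  simp [unkink, this]

theorem quad_cases (q p : Quad) :
    p = q ∨ p = q.vert ∨ p = q.horiz ∨ p = q.horiz.vert := by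
  cases p <;> cases q <;> simp [Quad.horiz, Quad.vert]

variable (hq : D.edge (D.halfAt b q) = D.halfAt b q.vert)

-- The two ends of the loop move to the same place, and no other edge has an end that moves.
include hq in
theorem unkink_edge (x : D.HalfEdge) :
    unkink b q (D.edge x) = unkink b q x ∨
      (unkink b q x = x ∧ unkink b q (D.edge x) = D.edge x) := by
  have hq' : D.edge (D.halfAt b q.vert) = D.halfAt b q := by rw [← hq, D.edge_edge]
  by_cases h₁ : x = D.halfAt b q
  · left
    rw [h₁, hq, unkink_self, unkink_vert]
  by_cases h₂ : x = D.halfAt b q.vert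
  · left
    rw [h₂, hq', unkink_self, unkink_vert]
  right
  have h₃ : D.edge x ≠ D.halfAt b q := fun h => h₂ (by rw [← hq, ← h, D.edge_edge])
  have h₄ : D.edge x ≠ D.halfAt b q.vert := fun h => h₁ (by rw [← hq', ← h, D.edge_edge])
  exact ⟨if_neg (not_or.2 ⟨h₁, h₂⟩), if_neg (not_or.2 ⟨h₃, h₄⟩)⟩

-- The strand of τ runs into `b`, around the loop and out again. After `unkink` has pushed the loop
-- onto the strand, this passage becomes the arc of `)(` through `b` that avoids the loop.
include hq in
theorem Invariant.unkink (hm : Invariant m σ) (h : VertHoriz b σ τ) :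
    Invariant (fun x => m (unkink b q x)) τ := by
  refine fun x => ⟨?_, ?_⟩
  · rcases unkink_edge hq x with h | ⟨h, h'⟩
    · exact congrArg m h
    · simp only [h, h', (hm x).1]
  · by_cases hx : ∀ q, x ≠ D.halfAt b q
    · simp only [unkink_of_ne hx, unkink_of_ne (smooth_ne_halfAt hx), ← smooth_congr h.off hx,
        (hm x).2]
    · push Not at hx
      obtain ⟨p, rfl⟩ := hx
      rw [smooth_horiz h.horiz]
      have hv := hm.vert h.vert
      have e : q.vert.horiz = q.horiz.vert := by cases q <;> rfl
      have e' : q.horiz.horiz = q := by cases q <;> rfl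
      have e'' : q.horiz.vert.horiz = q.vert := by cases q <;> rfl
      -- The cases are the two ends of the loop and the two strand half-edges next to them; a
      -- half-edge and its partner under τ are sent either to the same half-edge or to the two ends
      -- of one arc of σ.
      rcases quad_cases q p with rfl | rfl | rfl | rfl
      · simp only [unkink_self, unkink_horiz]
      · simp only [e, unkink_vert, unkink_horiz_vert, hv]
      · simp only [e', unkink_self, unkink_horiz]
      · simp only [e'', unkink_vert, unkink_horiz_vert, hv]

-- The loop edge connects the two arcs of the smoothing τ at `b`.
include hq in
theorem Invariant.halfAt_eq (hm : Invariant m τ) (hb : τ b = false) (p p' : Quad) :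
    m (D.halfAt b p) = m (D.halfAt b p') := by
  have hh := hm.horiz hb
  have h₀ : m (D.halfAt b q.vert) = m (D.halfAt b q) := by rw [← hq, (hm _).1]
  refine halfAt_eq_of_vert_of_horiz (fun s => ?_) hh p p'
  have h₁ := hh .ne
  have h₂ := hh .se
  cases q <;> cases s <;> simp only [Quad.vert, Quad.horiz] at * <;> simp_all

/-- `unkink` only moves half-edges of `b` to half-edges of `b`. -/
theorem unkink_eq_of_halfAt_eq (h : ∀ p p', m (D.halfAt b p) = m (D.halfAt b p'))
    (x : D.HalfEdge) : m (SingularTangleDiagram.unkink b q x) = m x := by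
  unfold SingularTangleDiagram.unkink
  split_ifs with hx
  · rcases hx with rfl | rfl <;> exact h _ _
  · rfl

end

namespace Coloring

/-! ### The death and the birth of the circle cut off by a kink -/

section Kinks

open SurfData

variable (χ : D.Coloring) {σ τ τ' ρ : D.Vtx → Bool} {b c : D.Vtx} {q : Quad}

theorem respects_adj {Q : Type} {m : D.HalfEdge → Q} :
    Respects (χ.smoothing σ).Adj m ↔ Invariant m σ := by
  constructor
  · exact fun h x => ⟨(h x _ (.inl rfl)).symm, (h x _ (.inr rfl)).symm⟩
  · rintro h x y (rfl | rfl)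
    · exact (h x).1.symm
    · exact (h x).2.symm

theorem invariant_mk {r : D.HalfEdge → D.HalfEdge → Prop}
    (h : ∀ x y, (χ.smoothing σ).Adj x y → r x y) : Invariant (Quot.mk r) σ :=
  χ.respects_adj.1 fun x y hxy => Quot.sound (h x y hxy)

theorem id_eq_pres : SurfData.id (χ.smoothing σ) =
    pres (Z := D.HalfEdge) (χ.smoothing σ).Adj (fun x => x) (fun x => x) 0
      (fun _ _ h => Quot.sound h) (fun _ _ h => Quot.sound h) (fun _ => rfl) := by
  simp only [pres, SurfData.id, Finsupp.mapDomain_zero]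
  rfl

theorem saddle_eq_pres : χ.saddle σ τ c =
    pres (Z := D.HalfEdge) (fun x y => (χ.smoothing σ).Adj x y ∨ (χ.smoothing τ).Adj x y)
      (fun x => x) (fun x => x) (Finsupp.single (D.halfAt c .nw) (-1))
      (fun _ _ h => Quot.sound (.inl h)) (fun _ _ h => Quot.sound (.inr h)) (fun _ => rfl) := by
  simp only [pres, saddle, Finsupp.mapDomain_single]
  rfl

/-- The death of the circle of a kink. -/
noncomputable def death (hq : D.edge (D.halfAt b q) = D.halfAt b q.vert) (h : VertHoriz b σ τ) :
    SurfData (χ.smoothing σ) (χ.smoothing τ) :=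
  pres (Z := D.HalfEdge) (χ.smoothing σ).Adj (fun x => x) (unkink b q)
    (Finsupp.single (D.halfAt b q) 1) (fun _ _ h => Quot.sound h)
    (χ.respects_adj.2 ((χ.invariant_mk fun _ _ h => h).unkink hq h)) (by
      intro p
      have : ∀ q, (χ.smoothing τ).bdry p ≠ D.halfAt b q := by
        rcases p with i | i <;> simp [smoothing]
      rw [unkink_of_ne this]
      rfl)

/-- The birth of the circle of a kink. -/
noncomputable def birth (hq : D.edge (D.halfAt b q) = D.halfAt b q.vert) (h : VertHoriz b σ τ) :
    SurfData (χ.smoothing τ) (χ.smoothing σ) :=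
  pres (Z := D.HalfEdge) (χ.smoothing σ).Adj (unkink b q) (fun x => x)
    (Finsupp.single (D.halfAt b q) 1)
    (χ.respects_adj.2 ((χ.invariant_mk fun _ _ h => h).unkink hq h)) (fun _ _ h => Quot.sound h) (by
      intro p
      have : ∀ q, (χ.smoothing τ).bdry p ≠ D.halfAt b q := by
        rcases p with i | i <;> simp [smoothing]
      rw [unkink_of_ne this]
      rfl)

section

variable (hq : D.edge (D.halfAt b q) = D.halfAt b q.vert) (h : VertHoriz b σ τ)

-- In τ all half-edges at `b` lie on one component, so the components of τ define a function
-- invariant under σ. This function does not see `unkink`, hence recovers the components of `x` and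
-- `y`.
include hq h in
theorem joined_of_unkink {x y : D.HalfEdge}
    (hxy : Quot.mk (χ.smoothing σ).Adj (unkink b q x) = Quot.mk (χ.smoothing σ).Adj (unkink b q y)) :
    (χ.smoothing τ).Joined x y := by
  have hτ : Invariant (Quot.mk (χ.smoothing τ).Adj) τ := χ.invariant_mk fun _ _ h => h
  have hb := hτ.halfAt_eq hq h.horiz
  have hσ : Invariant (Quot.mk (χ.smoothing τ).Adj) σ :=
    hτ.of_halfAt_eq (fun v hv => (h.off v hv).symm) hb
  apply Quot.eqvGen_exact
  have := congrArg (Quot.lift (r := (χ.smoothing σ).Adj) (Quot.mk (χ.smoothing τ).Adj)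
    (χ.respects_adj.2 hσ)) hxy
  simp only [unkink_eq_of_halfAt_eq hb] at this
  exact this

-- The circle is the one component of σ that consists of loop ends alone, and `unkink` never takes a
-- loop end as its value.
include hq h in
theorem range_unkink (c : Quot (χ.smoothing σ).Adj) :
    (∃ x : D.HalfEdge, Quot.mk _ (unkink b q x) = c) ↔ c ≠ Quot.mk _ (D.halfAt b q) := by
  -- The indicator of the two loop ends: they are exchanged both by the loop edge and by the arc of
  -- `)(`, so they form a full component.
  have hm : Invariant (fun x : D.HalfEdge => x = D.halfAt b q ∨ x = D.halfAt b q.vert) σ := by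
    have hq' : D.edge (D.halfAt b q.vert) = D.halfAt b q := by rw [← hq, D.edge_edge]
    have hv : q.vert.vert = q := by cases q <;> rfl
    refine fun x => ⟨propext ⟨?_, ?_⟩, propext ⟨?_, ?_⟩⟩
    · rintro (h | h)
      · right
        rw [← hq, ← h, D.edge_edge]
      · left
        rw [← hq', ← h, D.edge_edge]
    · rintro (rfl | rfl)
      · exact .inr hq
      · exact .inl hq'
    · have := (χ.smoothing σ).glue_glue x
      rintro (h' | h')
      · right
        rw [← smooth_vert h.vert, ← h']
        exact this.symm
      · left
        rw [← hv, ← smooth_vert h.vert, ← h']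
        exact this.symm
    · rintro (rfl | rfl)
      · exact .inr (smooth_vert h.vert _)
      · left
        rw [smooth_vert h.vert, hv]
  constructor
  · rintro ⟨x, rfl⟩ h'
    have h₁ := congrArg (Quot.lift _ (χ.respects_adj.2 hm)) h'
    have h₂ : unkink b q x = D.halfAt b q ∨ unkink b q x = D.halfAt b q.vert := by
      rw [show (_ ∨ _) = (_ ∨ _) from h₁]
      exact .inl rfl
    have h₃ : q.horiz ≠ q ∧ q.horiz ≠ q.vert := by cases q <;> simp [Quad.horiz, Quad.vert]
    unfold unkink at h₂
    split_ifs at h₂ with h₄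
    · simp [h₃] at h₂
    · exact h₄ h₂
  · obtain ⟨x, rfl⟩ := Quot.exists_rep c
    intro hc
    refine ⟨x, ?_⟩
    have h₁ : x ≠ D.halfAt b q := fun h => hc (congrArg _ h)
    have h₂ : x ≠ D.halfAt b q.vert := fun h' => hc (by
      rw [h', ← hq]
      exact (Quot.sound (.inl rfl)).symm)
    exact congrArg (Quot.mk _) (if_neg (not_or.2 ⟨h₁, h₂⟩))

theorem death_isSurface : IsSurface (χ.death hq h) :=
  .death (Quot.mk _ (D.halfAt b q))
    { inj₀ := fun _ _ e => Quot.eqvGen_exact e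
      surj₀ := Quot.exists_rep
      inj₁ := fun _ _ e => χ.joined_of_unkink hq h e
      range₁ := χ.range_unkink hq h
      euler_eq := Finsupp.mapDomain_single }

theorem birth_isSurface : IsSurface (χ.birth hq h) :=
  .birth (Quot.mk _ (D.halfAt b q))
    { inj₁ := fun _ _ e => Quot.eqvGen_exact e
      surj₁ := Quot.exists_rep
      inj₀ := fun _ _ e => χ.joined_of_unkink hq h e
      range₀ := χ.range_unkink hq h
      euler_eq := Finsupp.mapDomain_single }

end

end Kinks

/-! ### Gluing identities for saddles, births and deaths -/

section Gluing

open SurfData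

variable (χ : D.Coloring) {σ τ τ' ρ : D.Vtx → Bool} {b c : D.Vtx} {q : Quad}

theorem respects_adj_or {Q : Type} {m : D.HalfEdge → Q} :
    Respects (fun x y : D.HalfEdge => (χ.smoothing σ).Adj x y ∨ (χ.smoothing τ).Adj x y) m ↔
      Invariant m σ ∧ Invariant m τ :=
  respects_or.trans (and_congr χ.respects_adj χ.respects_adj)

/-- By `Invariant.of_mix` the middle smoothing imposes no condition beyond those of σ and ρ. Both
composites therefore have the components generated by σ and ρ, with the same two contributions to
the Euler characteristic. -/
theorem saddle_comp_saddle {c' : D.Vtx} (hτ : ∀ v, τ v = σ v ∨ τ v = ρ v)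
    (hτ' : ∀ v, τ' v = σ v ∨ τ' v = ρ v) :
    Iso ((χ.saddle σ τ c).comp (χ.saddle τ ρ c')) ((χ.saddle σ τ' c').comp (χ.saddle τ' ρ c)) := by
  simp only [saddle_eq_pres]
  refine pres_comp_right.trans (Iso.trans (pres_iso ?_ ?_) pres_comp_right.symm)
  · intro m hm
    have h₂ := (χ.respects_adj_or.1 (respects_or.1 hm).1).2
    have h₃ := (χ.respects_adj_or.1 (respects_map.1 (respects_or.1 hm).2)).1
    have := h₃.of_mix h₂ hτ
    refine ⟨respects_or.2 ⟨χ.respects_adj_or.2 ⟨this, h₂⟩,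
      respects_map.2 (χ.respects_adj_or.2 ⟨h₃, this⟩)⟩, fun _ => rfl, fun _ => rfl, ?_⟩
    refine (mapDomain_map_single_add m _ _ _ _ _).trans (Eq.trans ?_
      (mapDomain_map_single_add m _ _ _ _ _).symm)
    exact add_comm _ _
  · intro m hm
    have h₂ := (χ.respects_adj_or.1 (respects_or.1 hm).1).2
    have h₃ := (χ.respects_adj_or.1 (respects_map.1 (respects_or.1 hm).2)).1
    have := h₃.of_mix h₂ hτ'
    exact respects_or.2 ⟨χ.respects_adj_or.2 ⟨this, h₂⟩,
      respects_map.2 (χ.respects_adj_or.2 ⟨h₃, this⟩)⟩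

variable (hq : D.edge (D.halfAt b q) = D.halfAt b q.vert)

/-- A saddle away from the kink does not meet the dying disc. The two presentations agree because
`unkink` fixes the half-edges at `c`. -/
theorem saddle_comp_death (hτ : VertHoriz b τ ρ) (hτ' : VertHoriz b σ τ')
    (hc : ∀ v, v ≠ c → τ v = σ v) (hcb : c ≠ b) :
    Iso ((χ.saddle σ τ c).comp (χ.death hq hτ)) ((χ.death hq hτ').comp (χ.saddle τ' ρ c)) := by
  simp only [saddle_eq_pres, death]
  have hu : ∀ p, unkink b q (D.halfAt c p) = D.halfAt c p := fun p =>
    unkink_of_ne fun q => by simp [hcb]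
  refine pres_comp_right.trans (Iso.trans (pres_iso ?_ ?_) pres_comp_left.symm)
  · intro m hm
    have h₁ := χ.respects_adj.1 (respects_or.1 hm).1
    have h₃ := (χ.respects_adj_or.1 (respects_map.1 (respects_or.1 hm).2)).2
    have : Invariant m τ := by
      refine fun x => ⟨(h₁ x).1, ?_⟩
      by_cases hx : ∀ q, x ≠ D.halfAt c q
      · rw [smooth_congr hc hx, (h₁ x).2]
      · push Not at hx
        obtain ⟨p, rfl⟩ := hx
        -- At `c` itself, τ agrees with ρ, and the condition for ρ is not distorted by `unkink`.
        have h₄ := (h₃ (D.halfAt c p)).2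
        simp only [Dart.smooth, hτ.off c hcb] at h₄ ⊢
        rwa [hu, hu] at h₄
    refine ⟨respects_or.2 ⟨χ.respects_adj.2 this,
      respects_map.2 (χ.respects_adj_or.2 ⟨h₁, this⟩)⟩, fun _ => rfl, fun _ => rfl, ?_⟩
    refine (mapDomain_map_single_add m _ _ _ _ _).trans (Eq.trans ?_
      (mapDomain_single_add_map m _ _ _ _ _).symm)
    rw [hu]
    exact add_comm _ _
  · intro m hm
    have h₁ := χ.respects_adj.1 (respects_or.1 hm).1
    have h₂ := (χ.respects_adj_or.1 (respects_map.1 (respects_or.1 hm).2)).1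
    exact respects_or.2 ⟨χ.respects_adj.2 h₂, respects_map.2
      (χ.respects_adj_or.2 ⟨h₂.unkink hq hτ', h₁.unkink hq hτ⟩)⟩

theorem birth_comp_saddle (hτ : VertHoriz b τ σ) (hτ' : VertHoriz b ρ τ')
    (hc : ∀ v, v ≠ c → ρ v = τ v) (hcb : c ≠ b) :
    Iso ((χ.birth hq hτ).comp (χ.saddle τ ρ c)) ((χ.saddle σ τ' c).comp (χ.birth hq hτ')) := by
  simp only [saddle_eq_pres, birth]
  have hu : ∀ p, unkink b q (D.halfAt c p) = D.halfAt c p := fun p =>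
    unkink_of_ne fun q => by simp [hcb]
  refine pres_comp_left.trans (Iso.trans (pres_iso ?_ ?_) pres_comp_right.symm)
  · intro m hm
    have h₁ := χ.respects_adj.1 (respects_or.1 hm).1
    have h₂ := (χ.respects_adj_or.1 (respects_map.1 (respects_or.1 hm).2)).1
    have : Invariant m τ := by
      refine fun x => ⟨(h₁ x).1, ?_⟩
      by_cases hx : ∀ q, x ≠ D.halfAt c q
      · rw [← smooth_congr hc hx, (h₁ x).2]
      · push Not at hx
        obtain ⟨p, rfl⟩ := hx
        have h₄ := (h₂ (D.halfAt c p)).2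
        simp only [Dart.smooth, hτ.off c hcb] at h₄ ⊢
        rwa [hu, hu] at h₄
    refine ⟨respects_or.2 ⟨χ.respects_adj.2 this,
      respects_map.2 (χ.respects_adj_or.2 ⟨this, h₁⟩)⟩, fun _ => rfl, fun _ => rfl, ?_⟩
    refine (mapDomain_single_add_map m _ _ _ _ _).trans (Eq.trans ?_
      (mapDomain_map_single_add m _ _ _ _ _).symm)
    rw [hu]
    exact add_comm _ _
  · intro m hm
    have h₁ := χ.respects_adj.1 (respects_or.1 hm).1
    have h₂ := (χ.respects_adj_or.1 (respects_map.1 (respects_or.1 hm).2)).2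
    exact respects_or.2 ⟨χ.respects_adj.2 h₂, respects_map.2
      (χ.respects_adj_or.2 ⟨h₁.unkink hq hτ, h₂.unkink hq hτ'⟩)⟩

variable (h : VertHoriz b σ τ)

/-- All half-edges at `b` are already connected in τ, so passing through σ identifies nothing new;
the saddle's -1 cancels the disc's 1. -/
theorem saddle_comp_death_self :
    Iso ((χ.saddle τ σ b).comp (χ.death hq h)) (SurfData.id (χ.smoothing τ)) := by
  simp only [saddle_eq_pres, death, id_eq_pres]
  refine pres_comp_right.trans (pres_iso ?_ ?_)
  · intro m hm
    replace hm := χ.respects_adj.1 hm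
    have hb := hm.halfAt_eq hq h.horiz
    have : Invariant m σ := hm.of_halfAt_eq (fun v hv => (h.off v hv).symm) hb
    refine ⟨respects_or.2 ⟨χ.respects_adj.2 this,
      respects_map.2 (χ.respects_adj_or.2 ⟨hm, this⟩)⟩, fun _ => rfl, unkink_eq_of_halfAt_eq hb, ?_⟩
    refine (mapDomain_map_single_add m _ _ _ _ _).trans (Eq.trans ?_ Finsupp.mapDomain_zero.symm)
    rw [hb .nw q, ← Finsupp.single_add]
    simp
  · exact fun m hm => χ.respects_adj.2
      (χ.respects_adj_or.1 (respects_map.1 (respects_or.1 hm).2)).1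

theorem birth_comp_saddle_self :
    Iso ((χ.birth hq h).comp (χ.saddle σ τ b)) (SurfData.id (χ.smoothing τ)) := by
  simp only [saddle_eq_pres, birth, id_eq_pres]
  refine pres_comp_left.trans (pres_iso ?_ ?_)
  · intro m hm
    replace hm := χ.respects_adj.1 hm
    have hb := hm.halfAt_eq hq h.horiz
    have : Invariant m σ := hm.of_halfAt_eq (fun v hv => (h.off v hv).symm) hb
    refine ⟨respects_or.2 ⟨χ.respects_adj.2 this,
      respects_map.2 (χ.respects_adj_or.2 ⟨this, hm⟩)⟩, unkink_eq_of_halfAt_eq hb, fun _ => rfl, ?_⟩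
    refine (mapDomain_single_add_map m _ _ _ _ _).trans (Eq.trans ?_ Finsupp.mapDomain_zero.symm)
    rw [hb .nw q, ← Finsupp.single_add]
    simp
  · exact fun m hm => χ.respects_adj.2
      (χ.respects_adj_or.1 (respects_map.1 (respects_or.1 hm).2)).2

-- The arcs of `)(` are the two sheets at `b`. One contains the loop and the other the strand, so
-- equality between the sheets makes all four half-edges equal.
include h in
theorem halfAt_eq_of_strand_eq {Q : Type} {m : D.HalfEdge → Q} (hm : Invariant m σ)
    (h' : m (D.halfAt b q.horiz) = m (D.halfAt b q)) (p p' : Quad) :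
    m (D.halfAt b p) = m (D.halfAt b p') := by
  have hv := hm.vert h.vert
  refine halfAt_eq_of_vert_of_horiz hv (fun s => ?_) p p'
  have h₁ := hv .ne
  have h₂ := hv .nw
  cases q <;> cases s <;> simp only [Quad.vert, Quad.horiz] at * <;> simp_all

/-- A new disc tubed to the strand is a band that splits off the circle; in Euler characteristics, 1
- 2 = -1. -/
theorem birth_addTube :
    Iso ((χ.birth hq h).addTube (Quot.mk _ (D.halfAt b q.horiz)) (Quot.mk _ (D.halfAt b q)))
      (χ.saddle τ σ b) := by
  simp only [saddle_eq_pres]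
  refine (pres_addTube (W₀ := χ.smoothing τ) (W₁ := χ.smoothing σ) _ _).trans (pres_iso ?_ ?_)
  · intro m hm
    obtain ⟨h₁, h₂⟩ := χ.respects_adj_or.1 hm
    have hb := h₁.halfAt_eq hq h.horiz
    refine ⟨respects_or.2 ⟨χ.respects_adj.2 h₂, respects_pair.2 (hb _ _)⟩, unkink_eq_of_halfAt_eq hb, fun _ => rfl, ?_⟩
    simp only [Finsupp.mapDomain_add, Finsupp.mapDomain_single]
    rw [hb .nw q, hb q.horiz q, ← Finsupp.single_add]
    rfl
  · intro m hm
    have h₁ := χ.respects_adj.1 (respects_or.1 hm).1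
    have h₂ := respects_pair.1 (respects_or.1 hm).2
    exact χ.respects_adj_or.2 ⟨h₁.of_halfAt_eq h.off (halfAt_eq_of_strand_eq h h₁ h₂), h₁⟩

theorem death_addTube :
    Iso ((χ.death hq h).addTube (Quot.mk _ (D.halfAt b q)) (Quot.mk _ (D.halfAt b q.horiz)))
      (χ.saddle σ τ b) := by
  simp only [saddle_eq_pres]
  refine (pres_addTube (W₀ := χ.smoothing σ) (W₁ := χ.smoothing τ) _ _).trans (pres_iso ?_ ?_)
  · intro m hm
    obtain ⟨h₁, h₂⟩ := χ.respects_adj_or.1 hm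
    have hb := h₂.halfAt_eq hq h.horiz
    refine ⟨respects_or.2 ⟨χ.respects_adj.2 h₁, respects_pair.2 (hb _ _)⟩, fun _ => rfl, unkink_eq_of_halfAt_eq hb, ?_⟩
    simp only [Finsupp.mapDomain_add, Finsupp.mapDomain_single]
    rw [hb .nw q, ← Finsupp.single_add]
    rfl
  · intro m hm
    have h₁ := χ.respects_adj.1 (respects_or.1 hm).1
    have h₂ := respects_pair.1 (respects_or.1 hm).2
    exact χ.respects_adj_or.2 ⟨h₁, h₁.of_halfAt_eq h.off (halfAt_eq_of_strand_eq h h₁ h₂.symm)⟩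

/-- The tube between the two discs bounded by the circle of a kink is a cylinder. -/
theorem death_comp_birth_addTube :
    Iso (((χ.death hq h).comp (χ.birth hq h)).addTube
        (Quot.mk _ (.inl (Quot.mk _ (D.halfAt b q)))) (Quot.mk _ (.inr (Quot.mk _ (D.halfAt b q)))))
      (SurfData.id (χ.smoothing σ)) := by
  refine ⟨⟨Quot.lift (Quot.lift (Sum.elim (fun c => c) (fun c => c)) ?_) ?_,
    fun c => Quot.mk _ (Quot.mk _ (.inl c)), ?_, fun _ => rfl⟩, fun _ => rfl, fun _ => rfl, ?_⟩
  · rintro _ _ ⟨x⟩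
    rfl
  · rintro _ _ ⟨rfl, rfl⟩
    rfl
  · have hloop := Quot.sound (r := fun x y => x = Quot.mk (GlueRel (χ.death hq h) (χ.birth hq h))
      (.inl (Quot.mk _ (D.halfAt b q))) ∧ y = Quot.mk _ (.inr (Quot.mk _ (D.halfAt b q))))
      ⟨rfl, rfl⟩
    rintro ⟨⟨c | c⟩⟩
    · rfl
    · obtain ⟨x, rfl⟩ := Quot.exists_rep (r := (χ.smoothing σ).Adj) c
      by_cases hx : Quot.mk (χ.smoothing σ).Adj x = Quot.mk _ (D.halfAt b q)
      · rw [hx]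
        exact hloop
      · obtain ⟨y, hy⟩ := (χ.range_unkink hq h _).2 hx
        rw [← hy]
        exact congrArg (Quot.mk _) (Quot.sound (GlueRel.mk (S := χ.death hq h) y))
  · simp only [SurfData.addTube, SurfData.comp, death, birth, pres, SurfData.id,
      Finsupp.mapDomain_add, Finsupp.mapDomain_single]
    -- Two discs contribute 1 + 1 and the tube -2, as a cylinder requires.
    change Finsupp.single (Quot.mk (χ.smoothing σ).Adj (D.halfAt b q)) (1 : ℤ) +
      Finsupp.single (Quot.mk (χ.smoothing σ).Adj (D.halfAt b q)) (1 : ℤ) +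
      Finsupp.single (Quot.mk (χ.smoothing σ).Adj (D.halfAt b q)) (-2 : ℤ) = 0
    rw [← Finsupp.single_add, ← Finsupp.single_add]
    simp

end Gluing

section Contraction

open SurfData

variable (k : Type u) [CommRing k] (χ : D.Coloring) {σ τ τ' ρ : D.Vtx → Bool} {b c : D.Vtx}
  {q : Quad}

/-! ### Tubes and the genus-one morphism -/

theorem cobMap_comp_tube {S : SurfData (χ.smoothing σ) (χ.smoothing τ)} (hS : IsSurface S)
    (x y : D.HalfEdge) : cobMap k S hS ≫ cobMap k (χ.tube τ x y) (χ.tube_isSurface τ x y) =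
      cobMap k (S.addTube (S.in₁ x) (S.in₁ y)) (hS.addTube _ _) :=
  (cobMap_comp k _ _).trans (cobMap_congr k (S.comp_idTube x y) _ _)

theorem cobMap_tube_comp {S : SurfData (χ.smoothing σ) (χ.smoothing τ)} (hS : IsSurface S)
    (x y : D.HalfEdge) : cobMap k (χ.tube σ x y) (χ.tube_isSurface σ x y) ≫ cobMap k S hS =
      cobMap k (S.addTube (S.in₀ x) (S.in₀ y)) (hS.addTube _ _) :=
  (cobMap_comp k _ _).trans (cobMap_congr k (S.idTube_comp x y) _ _)

theorem cobMap_addTube_congr {W₀ W₁ : Cobordism χ.bdryMinus χ.bdryPlus} {S : SurfData W₀ W₁}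
    (hS : IsSurface S) {a a' b b' : S.Comp} (ha : a = a') (hb : b = b') :
    cobMap k (S.addTube a b) (hS.addTube a b) = cobMap k (S.addTube a' b') (hS.addTube a' b') := by
  subst ha hb
  rfl

theorem cobMap_addTube_comm {W₀ W₁ : Cobordism χ.bdryMinus χ.bdryPlus} {S : SurfData W₀ W₁}
    (hS : IsSurface S) (a b : S.Comp) :
    cobMap k (S.addTube a b) (hS.addTube a b) = cobMap k (S.addTube b a) (hS.addTube b a) :=
  cobMap_congr k (S.addTube_comm a b) _ _

/-- Tubes can be moved along a bordism. -/
theorem cobMap_comp_tube_comm {S : SurfData (χ.smoothing σ) (χ.smoothing τ)} (hS : IsSurface S)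
    {x y : D.HalfEdge} (hx : S.in₀ x = S.in₁ x) (hy : S.in₀ y = S.in₁ y) :
    cobMap k S hS ≫ cobMap k (χ.tube τ x y) (χ.tube_isSurface τ x y) =
      cobMap k (χ.tube σ x y) (χ.tube_isSurface σ x y) ≫ cobMap k S hS := by
  rw [cobMap_comp_tube, cobMap_tube_comp]
  exact cobMap_addTube_congr k χ hS hx.symm hy.symm

/-- One of the two smoothings is `)(` at `c` and the other is not; together they connect all four
half-edges. -/
theorem saddle_in_eq (h : DifferAt σ τ c) (p p' : Quad) :
    (χ.saddle σ τ c).in₀ (D.halfAt c p) = (χ.saddle σ τ c).in₀ (D.halfAt c p') := by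
  obtain ⟨h₁, h₂⟩ := χ.respects_adj_or.1 fun (x y : D.HalfEdge) h => Quot.sound
    (r := fun x y : D.HalfEdge => (χ.smoothing σ).Adj x y ∨ (χ.smoothing τ).Adj x y) h
  have hc := h.1
  cases hσ : σ c <;> cases hτ : τ c <;> simp only [hσ, hτ, ne_eq, not_true_eq_false] at hc
  · exact halfAt_eq_of_vert_of_horiz (h₂.vert hτ) (h₁.horiz hσ) p p'
  · exact halfAt_eq_of_vert_of_horiz (h₁.vert hσ) (h₂.horiz hτ) p p'

/-- Next to a saddle both sheets belong to one component, so the tube between them is a handle on it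
and the two terms of Φ cancel. -/
theorem saddle_comp_genusOne (h : DifferAt σ τ c) :
    cobMap k (χ.saddle σ τ c) (χ.saddle_isSurface h) ≫ χ.genusOne k τ c = 0 := by
  rw [genusOne, Preadditive.comp_sub, cobMap_comp_tube, cobMap_comp_tube, sub_eq_zero]
  exact cobMap_addTube_congr k χ (χ.saddle_isSurface h) rfl (χ.saddle_in_eq h _ _)

theorem genusOne_comp_saddle (h : DifferAt σ τ c) :
    χ.genusOne k σ c ≫ cobMap k (χ.saddle σ τ c) (χ.saddle_isSurface h) = 0 := by
  rw [genusOne, Preadditive.sub_comp, cobMap_tube_comp, cobMap_tube_comp, sub_eq_zero]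
  exact cobMap_addTube_congr k χ (χ.saddle_isSurface h) rfl (χ.saddle_in_eq h _ _)

theorem cobMap_tube_congr {x x' y y' : D.HalfEdge}
    (hx : Quot.mk (χ.smoothing σ).Adj x = Quot.mk _ x')
    (hy : Quot.mk (χ.smoothing σ).Adj y = Quot.mk _ y') :
    cobMap k (χ.tube σ x y) (χ.tube_isSurface σ x y) =
      cobMap k (χ.tube σ x' y') (χ.tube_isSurface σ x' y') :=
  cobMap_addTube_congr k χ (.cylinder (isCylinder_id _)) hx hy

theorem cobMap_tube_comm (x y : D.HalfEdge) :
    cobMap k (χ.tube σ x y) (χ.tube_isSurface σ x y) =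
      cobMap k (χ.tube σ y x) (χ.tube_isSurface σ y x) :=
  cobMap_addTube_comm k χ (.cylinder (isCylinder_id _)) _ _

/-- The tube between the loop and the strand of a kink minus the handle on the loop. -/
noncomputable def loopGenus (σ : D.Vtx → Bool) (b : D.Vtx) (q : Quad) :
    cobObj k (χ.smoothing σ) ⟶ cobObj k (χ.smoothing σ) :=
  cobMap k (χ.tube σ (D.halfAt b q.horiz) (D.halfAt b q)) (χ.tube_isSurface σ _ _) -
    cobMap k (χ.tube σ (D.halfAt b q) (D.halfAt b q)) (χ.tube_isSurface σ _ _)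

/-- The sign is positive if the loop lies on the left sheet. -/
def loopSign : Quad → ℤ
  | .nw => 1
  | .sw => 1
  | .ne => -1
  | .se => -1

/-- By 4Tu the handles on the two sheets add up to twice the tube, so trading the handle on one
sheet for that on the other changes only the sign of tube minus handle. -/
theorem genusOne_eq_loopGenus (hb : σ b = true) :
    χ.genusOne k σ b = loopSign q • χ.loopGenus k σ b q := by
  have hv := (χ.invariant_mk (σ := σ) fun _ _ h => h).vert hb
  have hne := hv .ne
  have hnw := hv .nw
  simp only [Quad.vert] at hne hnw
  -- Two discs on each sheet: one side of 4Tu has a handle on each sheet, the other has the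
  -- connecting tube twice.
  have h4 := cobMap_fourTu k (.cylinder (isCylinder_id (χ.smoothing σ)))
    (Quot.mk _ (D.halfAt b .ne)) (Quot.mk _ (D.halfAt b .ne))
    (Quot.mk _ (D.halfAt b .nw)) (Quot.mk _ (D.halfAt b .nw))
  change cobMap k (χ.tube σ (D.halfAt b .ne) (D.halfAt b .ne)) (χ.tube_isSurface σ _ _) +
    cobMap k (χ.tube σ (D.halfAt b .nw) (D.halfAt b .nw)) (χ.tube_isSurface σ _ _) =
    cobMap k (χ.tube σ (D.halfAt b .ne) (D.halfAt b .nw)) (χ.tube_isSurface σ _ _) +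
    cobMap k (χ.tube σ (D.halfAt b .ne) (D.halfAt b .nw)) (χ.tube_isSurface σ _ _) at h4
  have h5 := χ.cobMap_tube_comm k (σ := σ) (D.halfAt b .nw) (D.halfAt b .ne)
  cases q <;> simp only [loopSign, loopGenus, genusOne, one_smul, neg_smul, Quad.horiz, neg_sub]
  · rw [h5, sub_eq_sub_iff_add_eq_add]
    exact h4.symm
  · rw [h5]
  · rw [χ.cobMap_tube_congr k hne hnw, χ.cobMap_tube_congr k hnw hnw, h5]
  · rw [χ.cobMap_tube_congr k hne hne, χ.cobMap_tube_congr k hnw hne, h5,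
      sub_eq_sub_iff_add_eq_add]
    exact h4.symm

/-! ### Contraction of a kink -/

section

variable {k} (hq : D.edge (D.halfAt b q) = D.halfAt b q.vert) (h : VertHoriz b σ τ)

theorem _root_.SingTangle.SingularTangleDiagram.VertHoriz.differAt (h : VertHoriz b σ τ) :
    DifferAt σ τ b :=
  ⟨by simp [h.vert, h.horiz], fun v hv => (h.off v hv).symm⟩

theorem _root_.SingTangle.SingularTangleDiagram.VertHoriz.differAt' (h : VertHoriz b σ τ) :
    DifferAt τ σ b :=
  ⟨by simp [h.vert, h.horiz], fun v hv => h.off v hv⟩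

variable (k)

theorem cobMap_saddle_death :
    cobMap k (χ.saddle τ σ b) (χ.saddle_isSurface h.differAt') ≫
      cobMap k (χ.death hq h) (χ.death_isSurface hq h) = 𝟙 _ :=
  (cobMap_comp k _ _).trans ((cobMap_congr k (χ.saddle_comp_death_self hq h) _ _).trans
    (cobMap_id k _))

theorem cobMap_birth_saddle :
    cobMap k (χ.birth hq h) (χ.birth_isSurface hq h) ≫
      cobMap k (χ.saddle σ τ b) (χ.saddle_isSurface h.differAt) = 𝟙 _ :=
  (cobMap_comp k _ _).trans ((cobMap_congr k (χ.birth_comp_saddle_self hq h) _ _).trans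
    (cobMap_id k _))

/-- The death of the loop of a kink followed by its birth. -/
noncomputable def deathBirth : cobObj k (χ.smoothing σ) ⟶ cobObj k (χ.smoothing σ) :=
  cobMap k (χ.death hq h) (χ.death_isSurface hq h) ≫
    cobMap k (χ.birth hq h) (χ.birth_isSurface hq h)

/-- Neck cutting for the circle, written without subtraction: each of the four terms is one term of
4Tu on death followed by birth. -/
theorem id_add_deathBirth_comp_tube :
    𝟙 _ + χ.deathBirth k hq h ≫
        cobMap k (χ.tube σ (D.halfAt b q.horiz) (D.halfAt b q)) (χ.tube_isSurface σ _ _) =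
      cobMap k (χ.saddle σ τ b) (χ.saddle_isSurface h.differAt) ≫
        cobMap k (χ.birth hq h) (χ.birth_isSurface hq h) +
      χ.deathBirth k hq h ≫
        cobMap k (χ.tube σ (D.halfAt b q) (D.halfAt b q)) (χ.tube_isSurface σ _ _) := by
  have hd := χ.death_isSurface hq h
  have hb := χ.birth_isSurface hq h
  -- Discs in the dying disc, the newborn disc, the strand and again the newborn disc. The pairings
  -- give the cylinder, tube to strand, saddle followed by birth, and handle on the loop.
  have h4 := cobMap_fourTu k (hd.comp hb) (Quot.mk _ (.inl (Quot.mk _ (D.halfAt b q))))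
    (Quot.mk _ (.inr (Quot.mk _ (D.halfAt b q))))
    (Quot.mk _ (.inr (Quot.mk _ (D.halfAt b q.horiz))))
    (Quot.mk _ (.inr (Quot.mk _ (D.halfAt b q))))
  -- The strand passes through the middle manifold, so it may be taken on either side of the gluing.
  have hs : Quot.mk (GlueRel (χ.death hq h) (χ.birth hq h))
      (.inl (Quot.mk _ (D.halfAt b q.horiz))) =
      Quot.mk _ (.inr (Quot.mk _ (D.halfAt b q.horiz))) := by
    have := Quot.sound (GlueRel.mk (S := χ.death hq h) (T := χ.birth hq h) (D.halfAt b q.horiz))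
    simp only [death, birth, pres, unkink_horiz] at this
    exact this
  have e₁ := cobMap_congr k (χ.death_comp_birth_addTube hq h) ((hd.comp hb).addTube _ _)
    (.cylinder (isCylinder_id _))
  have e₂ : ∀ x : D.HalfEdge, χ.deathBirth k hq h ≫
      cobMap k (χ.tube σ x (D.halfAt b q)) (χ.tube_isSurface σ _ _) = _ := fun x =>
    (congrArg (· ≫ _) (cobMap_comp k hd hb)).trans
      (χ.cobMap_comp_tube k (hd.comp hb) x (D.halfAt b q))
  have e₃ := (cobMap_comp k (hd.addTube (Quot.mk _ (D.halfAt b q))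
    (Quot.mk _ (D.halfAt b q.horiz))) hb).trans
    (cobMap_congr k (SurfData.addTube_comp _ _ _ _) _ ((hd.comp hb).addTube _ _))
  rw [cobMap_congr k (χ.death_addTube hq h) _ (χ.saddle_isSurface h.differAt)] at e₃
  rw [e₂, e₂, ← cobMap_id, ← e₁, e₃]
  exact h4.trans (congrArg (· + _) (χ.cobMap_addTube_congr k (hd.comp hb) rfl hs.symm))

/-- Neck cutting with Φ on the incoming side: the fourth disc now lies in the dying disc, and the
strand is tubed to the newborn one. -/
theorem id_add_tube_comp_deathBirth :
    𝟙 _ + cobMap k (χ.tube σ (D.halfAt b q.horiz) (D.halfAt b q)) (χ.tube_isSurface σ _ _) ≫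
        χ.deathBirth k hq h =
      cobMap k (χ.death hq h) (χ.death_isSurface hq h) ≫
        cobMap k (χ.saddle τ σ b) (χ.saddle_isSurface h.differAt') +
      cobMap k (χ.tube σ (D.halfAt b q) (D.halfAt b q)) (χ.tube_isSurface σ _ _) ≫
        χ.deathBirth k hq h := by
  have hd := χ.death_isSurface hq h
  have hb := χ.birth_isSurface hq h
  have h4 := cobMap_fourTu k (hd.comp hb) (Quot.mk _ (.inr (Quot.mk _ (D.halfAt b q))))
    (Quot.mk _ (.inl (Quot.mk _ (D.halfAt b q))))
    (Quot.mk _ (.inl (Quot.mk _ (D.halfAt b q.horiz))))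
    (Quot.mk _ (.inl (Quot.mk _ (D.halfAt b q))))
  have hs : Quot.mk (GlueRel (χ.death hq h) (χ.birth hq h))
      (.inl (Quot.mk _ (D.halfAt b q.horiz))) =
      Quot.mk _ (.inr (Quot.mk _ (D.halfAt b q.horiz))) := by
    have := Quot.sound (GlueRel.mk (S := χ.death hq h) (T := χ.birth hq h) (D.halfAt b q.horiz))
    simp only [death, birth, pres, unkink_horiz] at this
    exact this
  have e₁ := cobMap_congr k (χ.death_comp_birth_addTube hq h) ((hd.comp hb).addTube _ _)
    (.cylinder (isCylinder_id _))
  have e₂ : ∀ x : D.HalfEdge,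
      cobMap k (χ.tube σ x (D.halfAt b q)) (χ.tube_isSurface σ _ _) ≫ χ.deathBirth k hq h = _ :=
    fun x => (congrArg (_ ≫ ·) (cobMap_comp k hd hb)).trans
      (χ.cobMap_tube_comp k (hd.comp hb) x (D.halfAt b q))
  have e₃ := (cobMap_comp k hd (hb.addTube (Quot.mk _ (D.halfAt b q.horiz))
    (Quot.mk _ (D.halfAt b q)))).trans
    (cobMap_congr k (SurfData.comp_addTube _ _ _ _) _ ((hd.comp hb).addTube _ _))
  rw [cobMap_congr k (χ.birth_addTube hq h) _ (χ.saddle_isSurface h.differAt')] at e₃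
  rw [e₂, e₂, ← cobMap_id, ← e₁, e₃]
  refine (congrArg (· + _) (χ.cobMap_addTube_comm k (hd.comp hb) _ _)).trans
    (h4.trans (congrArg (· + _) ?_))
  exact (χ.cobMap_addTube_comm k (hd.comp hb) _ _).trans
    (χ.cobMap_addTube_congr k (hd.comp hb) hs rfl)

theorem saddle_comp_birth_sub :
    cobMap k (χ.saddle σ τ b) (χ.saddle_isSurface h.differAt) ≫
        cobMap k (χ.birth hq h) (χ.birth_isSurface hq h) -
      χ.deathBirth k hq h ≫ χ.loopGenus k σ b q = 𝟙 _ := by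
  have := χ.id_add_deathBirth_comp_tube k hq h
  rw [loopGenus, Preadditive.comp_sub, sub_sub_eq_add_sub, sub_eq_iff_eq_add]
  exact this.symm

theorem death_comp_saddle_sub :
    cobMap k (χ.death hq h) (χ.death_isSurface hq h) ≫
        cobMap k (χ.saddle τ σ b) (χ.saddle_isSurface h.differAt') -
      χ.loopGenus k σ b q ≫ χ.deathBirth k hq h = 𝟙 _ := by
  have := χ.id_add_tube_comp_deathBirth k hq h
  rw [loopGenus, Preadditive.sub_comp, sub_sub_eq_add_sub, sub_eq_iff_eq_add]
  exact this.symm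

end

end Contraction

/-! ### Commutation of morphisms attached to different vertices -/

section Families

variable (k : Type u) [CommRing k] (χ : D.Coloring) {σ τ τ' ρ : D.Vtx → Bool} {b c : D.Vtx}
  {q : Quad}

/-- Families of morphisms between the smoothings of a diagram. -/
abbrev Family : Type _ :=
  ∀ σ τ : D.Vtx → Bool, cobObj k (χ.smoothing σ) ⟶ cobObj k (χ.smoothing τ)

/-- The smoothings `σ`, `τ`, `τ'`, `ρ` form a square with sides in the directions `c` and `c'`. -/
structure Square (c c' : D.Vtx) (σ τ τ' ρ : D.Vtx → Bool) : Prop where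
  left : ∀ v, v ≠ c → τ v = σ v
  right : ∀ v, v ≠ c → ρ v = τ' v
  top : ∀ v, v ≠ c' → τ' v = σ v
  bottom : ∀ v, v ≠ c' → ρ v = τ v

theorem Square.symm {c c' : D.Vtx} (h : Square c c' σ τ τ' ρ) : Square c' c σ τ' τ ρ :=
  ⟨h.top, h.bottom, h.left, h.right⟩

variable {k χ}

/-- Families that commute around squares. -/
def Commuting (c c' : D.Vtx) (m m' : χ.Family k) : Prop :=
  ∀ ⦃σ τ τ' ρ⦄, Square c c' σ τ τ' ρ → m σ τ ≫ m' τ ρ = m' σ τ' ≫ m τ' ρ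

theorem Commuting.symm {c c' : D.Vtx} {m m' : χ.Family k} (h : Commuting c c' m m') :
    Commuting c' c m' m :=
  fun _ _ _ _ hs => (h hs.symm).symm

theorem Commuting.sub_right {c c' : D.Vtx} {m m₁ m₂ : χ.Family k} (h₁ : Commuting c c' m m₁)
    (h₂ : Commuting c c' m m₂) : Commuting c c' m (fun σ τ => m₁ σ τ - m₂ σ τ) := by
  intro σ τ τ' ρ hs
  simp only [Preadditive.comp_sub, Preadditive.sub_comp, h₁ hs, h₂ hs]

variable (k χ)

open Classical in
/-- The saddles at `c`. -/
noncomputable def saddleFamily (c : D.Vtx) : χ.Family k := fun σ τ =>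
  if h : DifferAt σ τ c then cobMap k (χ.saddle σ τ c) (χ.saddle_isSurface h) else 0

open Classical in
/-- The identity bordisms with a tube. -/
noncomputable def tubeFamily (x y : D.HalfEdge) : χ.Family k := fun σ τ =>
  if h : σ = τ then cobMap k (χ.tube σ x y) (χ.tube_isSurface σ x y) ≫
    eqToHom (congrArg (fun σ => cobObj k (χ.smoothing σ)) h) else 0

/-- The genus-one morphisms at `c`. -/
noncomputable def genusFamily (c : D.Vtx) : χ.Family k := fun σ τ =>
  tubeFamily k χ (D.halfAt c .nw) (D.halfAt c .ne) σ τ -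
    tubeFamily k χ (D.halfAt c .nw) (D.halfAt c .nw) σ τ

open Classical in
/-- The deaths of the loop of a kink at `b`. -/
noncomputable def deathFamily (hq : D.edge (D.halfAt b q) = D.halfAt b q.vert) : χ.Family k :=
  fun σ τ => if h : VertHoriz b σ τ then cobMap k (χ.death hq h) (χ.death_isSurface hq h) else 0

open Classical in
/-- The births of the loop of a kink at `b`. -/
noncomputable def birthFamily (hq : D.edge (D.halfAt b q) = D.halfAt b q.vert) : χ.Family k :=
  fun σ τ => if h : VertHoriz b τ σ then cobMap k (χ.birth hq h) (χ.birth_isSurface hq h) else 0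

/-- Death of the loop of a kink followed by its birth. -/
noncomputable def deathBirthFamily (hq : D.edge (D.halfAt b q) = D.halfAt b q.vert) :
    χ.Family k := fun σ τ =>
  deathFamily k χ hq σ (Function.update σ b false) ≫
    birthFamily k χ hq (Function.update σ b false) τ

theorem genusFamily_eq (h : σ = τ) : genusFamily k χ c σ τ =
    χ.genusOne k σ c ≫ eqToHom (congrArg (fun σ => cobObj k (χ.smoothing σ)) h) := by
  subst h
  simp [genusFamily, tubeFamily, genusOne]

theorem genusFamily_self : genusFamily k χ c σ σ = χ.genusOne k σ c := by
  simp [genusFamily_eq]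

theorem genusFamily_of_ne (h : σ ≠ τ) : genusFamily k χ c σ τ = 0 := by
  simp [genusFamily, tubeFamily, h]

theorem deathBirthFamily_self (hq : D.edge (D.halfAt b q) = D.halfAt b q.vert)
    (h : VertHoriz b σ τ) : deathBirthFamily k χ hq σ σ = χ.deathBirth k hq h := by
  have : Function.update σ b false = τ := by
    funext v
    by_cases hv : v = b
    · subst hv
      simp [h.horiz]
    · simp [hv, h.off v hv]
  subst this
  simp only [deathBirthFamily, deathFamily, birthFamily, dif_pos h, deathBirth]

/-- Tubes at `c'` commute with bordisms that are cylinders at `c'`. -/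
theorem Commuting.tube {c c' : D.Vtx} (hc : c ≠ c') {m : χ.Family k} {p p' : Quad}
    (h : ∀ σ τ, m σ τ ≠ 0 → ∃ (S : SurfData (χ.smoothing σ) (χ.smoothing τ)) (hS : IsSurface S),
      m σ τ = cobMap k S hS ∧ ∀ s, S.in₀ (D.halfAt c' s) = S.in₁ (D.halfAt c' s)) :
    Commuting c c' m (tubeFamily k χ (D.halfAt c' p) (D.halfAt c' p')) := by
  intro σ τ τ' ρ hs
  -- Opposite sides of a square change `c'` in the same way, so the tubes on them are zero or
  -- nonzero together.
  have hiff : τ = ρ ↔ σ = τ' := by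
    constructor
    · intro e
      funext v
      by_cases hv : v = c'
      · rw [hv, ← hs.left c' hc.symm, e, hs.right c' hc.symm]
      · exact (hs.top v hv).symm
    · intro e
      funext v
      by_cases hv : v = c'
      · rw [hv, hs.left c' hc.symm, e, hs.right c' hc.symm]
      · exact (hs.bottom v hv).symm
  by_cases e : τ = ρ
  · have e' := hiff.1 e
    subst e e'
    simp only [tubeFamily, dif_pos, eqToHom_refl, Category.comp_id]
    by_cases hm : m σ τ = 0
    · rw [hm, Limits.zero_comp, Limits.comp_zero]
    · obtain ⟨S, hS, e, hin⟩ := h σ τ hm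
      rw [e]
      exact χ.cobMap_comp_tube_comm k hS (hin _) (hin _)
  · simp only [tubeFamily, dif_neg e, dif_neg (mt hiff.2 e), Limits.zero_comp, Limits.comp_zero]

theorem Commuting.genus {c c' : D.Vtx} (hc : c ≠ c') {m : χ.Family k}
    (h : ∀ σ τ, m σ τ ≠ 0 → ∃ (S : SurfData (χ.smoothing σ) (χ.smoothing τ)) (hS : IsSurface S),
      m σ τ = cobMap k S hS ∧ ∀ s, S.in₀ (D.halfAt c' s) = S.in₁ (D.halfAt c' s)) :
    Commuting c c' m (genusFamily k χ c') :=
  (Commuting.tube k χ hc h).sub_right (Commuting.tube k χ hc h)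

theorem commuting_saddle_saddle {c c' : D.Vtx} (hc : c ≠ c') :
    Commuting c c' (saddleFamily k χ c) (saddleFamily k χ c') := by
  intro σ τ τ' ρ hs
  have h₁ : DifferAt τ' ρ c ↔ DifferAt σ τ c := by
    simp only [DifferAt, hs.top c hc, hs.bottom c hc]
    exact and_congr_right fun _ => ⟨fun _ => hs.left, fun _ => hs.right⟩
  have h₂ : DifferAt τ ρ c' ↔ DifferAt σ τ' c' := by
    simp only [DifferAt, hs.left c' hc.symm, hs.right c' hc.symm]
    exact and_congr_right fun _ => ⟨fun _ => hs.top, fun _ => hs.bottom⟩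
  by_cases h : DifferAt σ τ c
  · by_cases h' : DifferAt σ τ' c'
    · simp only [saddleFamily, dif_pos, h, h', h₁.2 h, h₂.2 h']
      rw [cobMap_comp, cobMap_comp]
      refine cobMap_congr k (χ.saddle_comp_saddle (fun v => ?_) (fun v => ?_)) _ _
      · by_cases hv : v = c
        · rw [hv]
          exact .inr (hs.bottom c hc).symm
        · exact .inl (hs.left v hv)
      · by_cases hv : v = c'
        · rw [hv]
          exact .inr (hs.right c' hc.symm).symm
        · exact .inl (hs.top v hv)
    · simp only [saddleFamily, dif_neg, h', mt h₂.1 h', not_false_eq_true, Limits.zero_comp,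
        Limits.comp_zero]
  · simp only [saddleFamily, dif_neg, h, mt h₁.1 h, not_false_eq_true, Limits.zero_comp,
      Limits.comp_zero]

theorem commuting_saddle_genus {c c' : D.Vtx} (hc : c ≠ c') :
    Commuting c c' (saddleFamily k χ c) (genusFamily k χ c') := by
  refine Commuting.genus k χ hc fun σ τ hm => ?_
  by_cases h : DifferAt σ τ c
  · exact ⟨_, χ.saddle_isSurface h, dif_pos h, fun _ => rfl⟩
  · exact absurd (dif_neg h) hm

theorem commuting_tube_genus {c c' : D.Vtx} (hc : c ≠ c') (x y : D.HalfEdge) :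
    Commuting c c' (tubeFamily k χ x y) (genusFamily k χ c') := by
  refine Commuting.genus k χ hc fun σ τ hm => ?_
  by_cases h : σ = τ
  · subst h
    exact ⟨_, χ.tube_isSurface σ x y, by simp [tubeFamily], fun _ => rfl⟩
  · exact absurd (dif_neg h) hm

theorem commuting_genus_genus {c c' : D.Vtx} (hc : c ≠ c') :
    Commuting c c' (genusFamily k χ c) (genusFamily k χ c') :=
  ((commuting_tube_genus k χ hc _ _).symm.sub_right (commuting_tube_genus k χ hc _ _).symm).symm

section

variable (hq : D.edge (D.halfAt b q) = D.halfAt b q.vert)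

theorem unkink_of_vtx_ne (hc : b ≠ c) (s : Quad) :
    unkink b q (D.halfAt c s) = D.halfAt c s :=
  unkink_of_ne fun q => by simp [hc.symm]

/-- `unkink` does not move half-edges at `c`, so over `c` the death is a product and tubes slide
through it. -/
theorem commuting_death_genus (hc : b ≠ c) :
    Commuting b c (deathFamily k χ hq) (genusFamily k χ c) := by
  refine Commuting.genus k χ hc fun σ τ hm => ?_
  by_cases h : VertHoriz b σ τ
  · exact ⟨_, χ.death_isSurface hq h, dif_pos h,
      fun s => congrArg (Quot.mk _) (unkink_of_vtx_ne hc s).symm⟩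
  · exact absurd (dif_neg h) hm

theorem commuting_birth_genus (hc : b ≠ c) :
    Commuting b c (birthFamily k χ hq) (genusFamily k χ c) := by
  refine Commuting.genus k χ hc fun σ τ hm => ?_
  by_cases h : VertHoriz b τ σ
  · exact ⟨_, χ.birth_isSurface hq h, dif_pos h,
      fun s => congrArg (Quot.mk _) (unkink_of_vtx_ne hc s)⟩
  · exact absurd (dif_neg h) hm

theorem vertHoriz_iff (hoff : ∀ v, v ≠ b → τ v = σ v) :
    VertHoriz b σ τ ↔ σ b = true ∧ τ b = false :=
  ⟨fun h => ⟨h.vert, h.horiz⟩, fun h => ⟨h.1, h.2, fun v hv => (hoff v hv).symm⟩⟩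

theorem commuting_saddle_death (hc : c ≠ b) :
    Commuting c b (saddleFamily k χ c) (deathFamily k χ hq) := by
  intro σ τ τ' ρ hs
  have h₁ : DifferAt τ' ρ c ↔ DifferAt σ τ c := by
    simp only [DifferAt, hs.top c hc, hs.bottom c hc]
    exact and_congr_right fun _ => ⟨fun _ => hs.left, fun _ => hs.right⟩
  have h₂ : VertHoriz b τ ρ ↔ VertHoriz b σ τ' := by
    rw [vertHoriz_iff hs.top, vertHoriz_iff hs.bottom, hs.left b hc.symm, hs.right b hc.symm]
  by_cases h : DifferAt σ τ c
  · by_cases h' : VertHoriz b σ τ'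
    · simp only [saddleFamily, deathFamily, dif_pos, h, h', h₁.2 h, h₂.2 h']
      rw [cobMap_comp, cobMap_comp]
      exact cobMap_congr k (χ.saddle_comp_death hq (h₂.2 h') h' h.2 hc) _ _
    · simp only [deathFamily, dif_neg, h', mt h₂.1 h', not_false_eq_true, Limits.zero_comp,
        Limits.comp_zero]
  · simp only [saddleFamily, dif_neg, h, mt h₁.1 h, not_false_eq_true, Limits.zero_comp,
      Limits.comp_zero]

theorem commuting_birth_saddle (hc : c ≠ b) :
    Commuting b c (birthFamily k χ hq) (saddleFamily k χ c) := by
  intro σ τ τ' ρ hs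
  have h₁ : DifferAt τ ρ c ↔ DifferAt σ τ' c := by
    simp only [DifferAt, hs.left c hc, hs.right c hc]
    exact and_congr_right fun _ => ⟨fun _ => hs.top, fun _ => hs.bottom⟩
  have h₂ : VertHoriz b ρ τ' ↔ VertHoriz b τ σ := by
    rw [vertHoriz_iff fun v hv => (hs.left v hv).symm,
      vertHoriz_iff fun v hv => (hs.right v hv).symm, hs.top b hc.symm, hs.bottom b hc.symm]
  by_cases h : DifferAt σ τ' c
  · by_cases h' : VertHoriz b τ σ
    · simp only [saddleFamily, birthFamily, dif_pos, h, h', h₁.2 h, h₂.2 h']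
      rw [cobMap_comp, cobMap_comp]
      exact cobMap_congr k (χ.birth_comp_saddle hq h' (h₂.2 h') hs.bottom hc) _ _
    · simp only [birthFamily, dif_neg, h', mt h₂.1 h', not_false_eq_true, Limits.zero_comp,
        Limits.comp_zero]
  · simp only [saddleFamily, dif_neg, h, mt h₁.1 h, not_false_eq_true, Limits.zero_comp,
      Limits.comp_zero]

-- The square is cut into two along the row of smoothings that are horizontal at `b`.
variable {k χ} in
theorem Commuting.deathBirth {m : χ.Family k}
    (h : Commuting b c (deathFamily k χ hq) m) (h' : Commuting b c (birthFamily k χ hq) m) :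
    Commuting b c (deathBirthFamily k χ hq) m := by
  intro σ τ τ' ρ hs
  have s₁ : Square b c σ (Function.update σ b false) τ' (Function.update τ' b false) :=
    ⟨fun v hv => by simp [hv], fun v hv => by simp [hv], hs.top, fun v hv => by
      by_cases hb : v = b
      · simp [hb]
      · simp [hb, hs.top v hv]⟩
  have s₂ : Square b c (Function.update σ b false) τ (Function.update τ' b false) ρ :=
    ⟨fun v hv => by simp [hv, hs.left v hv], fun v hv => by simp [hv, hs.right v hv],
      s₁.bottom, hs.bottom⟩
  simp only [deathBirthFamily, Category.assoc]
  rw [h' s₂, ← Category.assoc, h s₁, Category.assoc]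

end

end Families

/-! ### Signs -/

section Sign

variable {s t : Finset D.Vtx} {c c' : D.Vtx}

theorem sign_mul_self : sign s c * sign s c = 1 := by
  rw [sign, ← mul_pow]
  simp

theorem sign_eq_of_not_lt (h : ∀ v, v ≠ c → (v ∈ s ↔ v ∈ t)) (hc : ¬ c < c') :
    sign t c' = sign s c' := by
  have : t.filter (· < c') = s.filter (· < c') := by
    ext v
    simp only [Finset.mem_filter]
    refine and_congr_left fun hv => (h v ?_).symm
    rintro rfl
    exact hc hv
  rw [sign, sign, this]

theorem sign_insert (hs : c ∉ s) (hc : c < c') : sign (insert c s) c' = -sign s c' := by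
  rw [sign, sign, Finset.filter_insert, if_pos hc, Finset.card_insert_of_notMem (by simp [hs]),
    pow_succ]
  ring

theorem sign_eq_neg_of_lt (h : ∀ v, v ≠ c → (v ∈ s ↔ v ∈ t)) (hst : c ∈ s ↔ c ∉ t) (hc : c < c') :
    sign t c' = -sign s c' := by
  by_cases hs : c ∈ s
  · have : s = insert c t := by
      ext v
      by_cases hv : v = c
      · simp [hv, hs]
      · simp [hv, h v hv]
    rw [this, sign_insert (hst.1 hs) hc, neg_neg]
  · have : t = insert c s := by
      ext v
      by_cases hv : v = c
      · simpa [hv, hs] using hst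
      · simp [hv, h v hv]
    rw [this, sign_insert hs hc]

/-- Toggling the smaller of the two vertices changes the sign at the larger one, but not conversely.
Adding and removing a vertex need not be distinguished, which lets the same rule serve for saddles,
Φ and the homotopy. -/
theorem sign_mul_sign {t' : Finset D.Vtx} (hc : c ≠ c') (h : ∀ v, v ≠ c → (v ∈ s ↔ v ∈ t))
    (h' : ∀ v, v ≠ c' → (v ∈ s ↔ v ∈ t')) (hst : c ∈ s ↔ c ∉ t) (hst' : c' ∈ s ↔ c' ∉ t') :
    sign s c * sign t c' = -(sign s c' * sign t' c) := by
  rcases lt_or_gt_of_ne hc with hlt | hlt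
  · rw [sign_eq_neg_of_lt h hst hlt, sign_eq_of_not_lt h' hlt.asymm]
    ring
  · rw [sign_eq_neg_of_lt h' hst' hlt, sign_eq_of_not_lt h hlt.asymm]
    ring

end Sign

/-! ### Matrices of morphisms between the summands of the bracket complex -/

section Matrices

variable (D) in
/-- Pairs of a resolution scheme and a state. -/
abbrev State : Type := Finset D.Vtx × Finset D.Vtx

/-- Two states agree away from the vertex `c`. -/
def Off (c : D.Vtx) (p q : State D) : Prop :=
  ∀ v, v ≠ c → (v ∈ p.1 ↔ v ∈ q.1) ∧ (v ∈ p.2 ↔ v ∈ q.2)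

variable {c c' : D.Vtx} {p q q' p' : State D}

theorem Off.symm (h : Off c p q) : Off c q p :=
  fun v hv => ⟨(h v hv).1.symm, (h v hv).2.symm⟩

theorem Off.trans (h : Off c p q) (h' : Off c q q') : Off c p q' :=
  fun v hv => ⟨(h v hv).1.trans (h' v hv).1, (h v hv).2.trans (h' v hv).2⟩

theorem Off.eq (h : Off c p q) (h₁ : c ∈ p.1 ↔ c ∈ q.1) (h₂ : c ∈ p.2 ↔ c ∈ q.2) : p = q := by
  refine Prod.ext (Finset.ext fun v => ?_) (Finset.ext fun v => ?_)
  · by_cases hv : v = c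
    · rw [hv, h₁]
    · exact (h v hv).1
  · by_cases hv : v = c
    · rw [hv, h₂]
    · exact (h v hv).2

theorem Off.resolve_eq (h : Off c p q) (v : D.Vtx) (hv : v ≠ c) :
    D.resolve q.1 q.2 v = D.resolve p.1 p.2 v := by
  simp only [resolve, h v hv]

open Classical in
/-- The state that agrees with `q` at `c` and with `p` elsewhere. -/
noncomputable def mix (c : D.Vtx) (p q : State D) : State D :=
  (Finset.univ.filter fun v => if v = c then v ∈ q.1 else v ∈ p.1,
    Finset.univ.filter fun v => if v = c then v ∈ q.2 else v ∈ p.2)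

theorem off_mix : Off c p (mix c p q) := by
  intro v hv
  simp [mix, hv]

theorem mem_mix : (c ∈ (mix c p q).1 ↔ c ∈ q.1) ∧ (c ∈ (mix c p q).2 ↔ c ∈ q.2) := by
  simp [mix]

/-- The state halfway along a path that changes `c` and then `c'` is determined by its ends; sums
over intermediate states thus reduce to one term. -/
theorem eq_mix (hc : c ≠ c') (h : Off c p q) (h' : Off c' q p') : q = mix c p p' :=
  (h.symm.trans off_mix).eq ((h' c hc).1.trans mem_mix.1.symm) ((h' c hc).2.trans mem_mix.2.symm)

theorem off_swap (hc : c ≠ c') (h : Off c p q) (h' : Off c' q p') : Off c (mix c' p p') p' := by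
  intro v hv
  by_cases hv' : v = c'
  · subst hv'
    exact mem_mix
  · simp only [mix, Finset.mem_filter, Finset.mem_univ, hv', if_false, true_and]
    exact ⟨(h v hv).1.trans (h' v hv').1, (h v hv).2.trans (h' v hv').2⟩

variable (k : Type u) [CommRing k] (χ : D.Coloring)

/-- Matrices of morphisms between the smoothings of all states. -/
abbrev StateMatrix : Type _ :=
  ∀ p q : State D, cobObj k (χ.smoothing (D.resolve p.1 p.2)) ⟶
    cobObj k (χ.smoothing (D.resolve q.1 q.2))

variable {k χ}

/-- The entries of a matrix are only nonzero between states that agree away from `c` and of which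
exactly one has `c` in the second component. -/
def LocalAt (c : D.Vtx) (A : χ.StateMatrix k) : Prop :=
  ∀ p q, A p q ≠ 0 → Off c p q ∧ (c ∈ p.2 ↔ c ∉ q.2)

/-- The entries of two matrices commute around squares. -/
def SquareCommute (c c' : D.Vtx) (A B : χ.StateMatrix k) : Prop :=
  ∀ ⦃p q q' p'⦄, Off c p q → Off c' q p' → Off c' p q' → Off c q' p' →
    A p q ≫ B q p' = B p q' ≫ A q' p'

theorem SquareCommute.symm {A B : χ.StateMatrix k} (h : SquareCommute c c' A B) :
    SquareCommute c' c B A :=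
  fun _ _ _ _ h₁ h₂ h₃ h₄ => (h h₃ h₄ h₁ h₂).symm

theorem SquareCommute.add_right {A B₁ B₂ : χ.StateMatrix k} (h₁ : SquareCommute c c' A B₁)
    (h₂ : SquareCommute c c' A B₂) : SquareCommute c c' A (fun p q => B₁ p q + B₂ p q) := by
  intro p q q' p' a₁ a₂ a₃ a₄
  simp only [Preadditive.comp_add, Preadditive.add_comp, h₁ a₁ a₂ a₃ a₄, h₂ a₁ a₂ a₃ a₄]

theorem SquareCommute.add_left {A B₁ B₂ : χ.StateMatrix k} (h₁ : SquareCommute c c' B₁ A)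
    (h₂ : SquareCommute c c' B₂ A) : SquareCommute c c' (fun p q => B₁ p q + B₂ p q) A :=
  (h₁.symm.add_right h₂.symm).symm

theorem SquareCommute.zsmul_right {A B : χ.StateMatrix k} (h : SquareCommute c c' A B) (n : ℤ) :
    SquareCommute c c' A (fun p q => n • B p q) := by
  intro p q q' p' a₁ a₂ a₃ a₄
  simp only [Preadditive.comp_zsmul, Preadditive.zsmul_comp, h a₁ a₂ a₃ a₄]

/-- With signs, matrices at different vertices that commute around squares anticommute. -/
theorem sum_sign_comp_sign {A B : χ.StateMatrix k} (hc : c ≠ c') (hA : LocalAt c A)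
    (hB : LocalAt c' B) (h : SquareCommute c c' A B) (p p' : State D) :
    ∑ q, (sign p.2 c • A p q) ≫ (sign q.2 c' • B q p') +
      ∑ q, (sign p.2 c' • B p q) ≫ (sign q.2 c • A q p') = 0 := by
  have key : ∀ {c c' : D.Vtx} {A B : χ.StateMatrix k}, c ≠ c' → LocalAt c A → LocalAt c' B →
      ∀ q, q ≠ mix c p p' → (sign p.2 c • A p q) ≫ (sign q.2 c' • B q p') = 0 := by
    intro c c' A B hc hA hB q hq
    by_cases h₁ : A p q = 0
    · rw [h₁, smul_zero, Limits.zero_comp]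
    by_cases h₂ : B q p' = 0
    · rw [h₂, smul_zero, Limits.comp_zero]
    exact absurd (eq_mix hc (hA _ _ h₁).1 (hB _ _ h₂).1) hq
  rw [Fintype.sum_eq_single _ (key hc hA hB), Fintype.sum_eq_single _ (key hc.symm hB hA)]
  simp only [Preadditive.comp_zsmul, Preadditive.zsmul_comp, smul_smul]
  by_cases hoff : Off c' (mix c p p') p' ∧ Off c (mix c' p p') p'
  · have e := h off_mix hoff.1 off_mix hoff.2
    rw [← e]
    by_cases hz : A p (mix c p p') ≫ B (mix c p p') p' = 0
    · rw [hz, smul_zero, smul_zero, add_zero]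
    · have hA' : A p (mix c p p') ≠ 0 := fun h₀ => hz (by rw [h₀, Limits.zero_comp])
      have hB' : B p (mix c' p p') ≠ 0 := fun h₀ => hz (by rw [e, h₀, Limits.zero_comp])
      have hs := sign_mul_sign hc (fun v hv => ((hA _ _ hA').1 v hv).2)
        (fun v hv => ((hB _ _ hB').1 v hv).2) (hA _ _ hA').2 (hB _ _ hB').2
      rw [← add_smul, mul_comm, hs, mul_comm (sign (mix c' p p').2 c), neg_add_cancel, zero_smul]
  -- If one path were nonzero, its ends would differ at most at `c` and `c'`, and the other half of
  -- the square would exist as well.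
  · have h₁ : A p (mix c p p') ≫ B (mix c p p') p' = 0 := by
      by_contra hn
      have hA' : A p (mix c p p') ≠ 0 := fun h₀ => hn (by rw [h₀, Limits.zero_comp])
      have hB' : B (mix c p p') p' ≠ 0 := fun h₀ => hn (by rw [h₀, Limits.comp_zero])
      exact hoff ⟨(hB _ _ hB').1, off_swap hc (hA _ _ hA').1 (hB _ _ hB').1⟩
    have h₂ : B p (mix c' p p') ≫ A (mix c' p p') p' = 0 := by
      by_contra hn
      have hA' : B p (mix c' p p') ≠ 0 := fun h₀ => hn (by rw [h₀, Limits.zero_comp])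
      have hB' : A (mix c' p p') p' ≠ 0 := fun h₀ => hn (by rw [h₀, Limits.comp_zero])
      exact hoff ⟨off_swap hc.symm (hB _ _ hA').1 (hA _ _ hB').1, (hA _ _ hB').1⟩
    rw [h₁, h₂, smul_zero, smul_zero, add_zero]

open Classical in
/-- The matrix of a family of morphisms, restricted to the transitions of states at `c` that are
allowed by `K`. -/
noncomputable def restrict (c : D.Vtx) (K : Prop → Prop → Prop → Prop → Prop) (m : χ.Family k) :
    χ.StateMatrix k := fun p q =>
  if Off c p q ∧ K (c ∈ p.1) (c ∈ p.2) (c ∈ q.1) (c ∈ q.2) then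
    m (D.resolve p.1 p.2) (D.resolve q.1 q.2) else 0

theorem restrict_ne_zero {K : Prop → Prop → Prop → Prop → Prop} {m : χ.Family k}
    (h : restrict c K m p q ≠ 0) :
    Off c p q ∧ K (c ∈ p.1) (c ∈ p.2) (c ∈ q.1) (c ∈ q.2) := by
  by_contra hn
  exact h (if_neg hn)

/-- The condition `K` only looks at membership of `c`, which a step at `c'` leaves unchanged; hence
it holds on both parallel sides or on neither. -/
theorem squareCommute_restrict {K K' : Prop → Prop → Prop → Prop → Prop} {m m' : χ.Family k}
    (hc : c ≠ c') (h : Commuting c c' m m') :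
    SquareCommute c c' (restrict c K m) (restrict c' K' m') := by
  intro p q q' p' h₁ h₂ h₃ h₄
  have hK : (Off c p q ∧ K (c ∈ p.1) (c ∈ p.2) (c ∈ q.1) (c ∈ q.2)) ↔
      (Off c q' p' ∧ K (c ∈ q'.1) (c ∈ q'.2) (c ∈ p'.1) (c ∈ p'.2)) := by
    rw [propext (h₃ c hc).1, propext (h₃ c hc).2, propext (h₂ c hc).1, propext (h₂ c hc).2]
    exact and_congr_left fun _ => iff_of_true h₁ h₄
  have hK' : (Off c' q p' ∧ K' (c' ∈ q.1) (c' ∈ q.2) (c' ∈ p'.1) (c' ∈ p'.2)) ↔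
      (Off c' p q' ∧ K' (c' ∈ p.1) (c' ∈ p.2) (c' ∈ q'.1) (c' ∈ q'.2)) := by
    rw [propext (h₁ c' hc.symm).1, propext (h₁ c' hc.symm).2, propext (h₄ c' hc.symm).1,
      propext (h₄ c' hc.symm).2]
    exact and_congr_left fun _ => iff_of_true h₂ h₃
  unfold restrict
  by_cases a : Off c p q ∧ K (c ∈ p.1) (c ∈ p.2) (c ∈ q.1) (c ∈ q.2)
  · by_cases a' : Off c' q p' ∧ K' (c' ∈ q.1) (c' ∈ q.2) (c' ∈ p'.1) (c' ∈ p'.2)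
    · rw [if_pos a, if_pos a', if_pos (hK.1 a), if_pos (hK'.1 a')]
      exact h ⟨h₁.resolve_eq, h₄.resolve_eq, h₃.resolve_eq, h₂.resolve_eq⟩
    · rw [if_neg a', if_neg (mt hK'.2 a'), Limits.zero_comp, Limits.comp_zero]
  · rw [if_neg a, if_neg (mt hK.2 a), Limits.zero_comp, Limits.comp_zero]

end Matrices

section Complex

variable (k : Type u) [CommRing k] (χ : D.Coloring) {b c c' : D.Vtx} {p q p' : State D}

/-! ### The differential -/

/-- The part of the differential that changes the state at `c`, without signs. -/
noncomputable def diffAt (c : D.Vtx) : χ.StateMatrix k := fun p q =>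
  restrict c (fun r s r' s' => (r ↔ r') ∧ ¬s ∧ s') (saddleFamily k χ c) p q +
    restrict c (fun r s r' s' => D.kind c = .dbl ∧ ¬r ∧ s ∧ r' ∧ ¬s') (genusFamily k χ c) p q

variable {k χ}

theorem Off.fst_eq (h : Off c p q) (hc : c ∈ p.1 ↔ c ∈ q.1) : q.1 = p.1 := by
  ext v
  by_cases hv : v = c
  · rw [hv, hc]
  · exact (h v hv).1.symm

theorem Off.fst_insert (h : Off c p q) (hc : c ∈ q.1) : q.1 = insert c p.1 := by
  ext v
  by_cases hv : v = c
  · simp [hv, hc]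
  · simp [hv, (h v hv).1]

theorem Off.snd_insert (h : Off c p q) (hc : c ∈ q.2) : q.2 = insert c p.2 := by
  ext v
  by_cases hv : v = c
  · simp [hv, hc]
  · simp [hv, (h v hv).2]

theorem Off.snd_erase (h : Off c p q) (hc : c ∉ q.2) : q.2 = p.2.erase c := by
  ext v
  by_cases hv : v = c
  · simp [hv, hc]
  · simp [hv, (h v hv).2]

theorem off_saddle_iff : (Off c p q ∧ (c ∈ p.1 ↔ c ∈ q.1) ∧ c ∉ p.2 ∧ c ∈ q.2) ↔
    (q.1 = p.1 ∧ c ∉ p.2 ∧ q.2 = insert c p.2) := by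
  constructor
  · rintro ⟨h, h₁, h₂, h₃⟩
    exact ⟨h.fst_eq h₁, h₂, h.snd_insert h₃⟩
  · rintro ⟨h₁, h₂, h₃⟩
    refine ⟨fun v hv => ?_, by rw [h₁], h₂, by simp [h₃]⟩
    simp [h₁, h₃, hv]

theorem off_genus_iff : (Off c p q ∧ D.kind c = .dbl ∧ c ∉ p.1 ∧ c ∈ p.2 ∧ c ∈ q.1 ∧ c ∉ q.2) ↔
    (D.kind c = .dbl ∧ c ∉ p.1 ∧ c ∈ p.2 ∧ q.1 = insert c p.1 ∧ q.2 = p.2.erase c) := by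
  constructor
  · rintro ⟨h, h₀, h₁, h₂, h₃, h₄⟩
    exact ⟨h₀, h₁, h₂, h.fst_insert h₃, h.snd_erase h₄⟩
  · rintro ⟨h₀, h₁, h₂, h₃, h₄⟩
    refine ⟨fun v hv => ?_, h₀, h₁, h₂, by simp [h₃], by simp [h₄]⟩
    simp [h₃, h₄, hv]

/-- Sorts the differential by vertex, replacing equations between whole sets by agreement away from
`c` and memberships at `c`. -/
theorem entry_eq (p q : State D) :
    χ.entry k p.1 p.2 q.1 q.2 = ∑ c, sign p.2 c • diffAt k χ c p q := by
  rw [entry, ← Finset.sum_add_distrib]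
  refine Finset.sum_congr rfl fun c _ => ?_
  rw [diffAt, smul_add]
  congr 1
  · unfold restrict
    by_cases h : q.1 = p.1 ∧ c ∉ p.2 ∧ q.2 = insert c p.2
    · rw [dif_pos h, if_pos (off_saddle_iff.2 h), saddleFamily, dif_pos]
      rw [h.1, h.2.2]
      exact differAt_resolve _ h.2.1
    · rw [dif_neg h, if_neg (mt off_saddle_iff.1 h), smul_zero]
  · unfold restrict
    by_cases h : D.kind c = .dbl ∧ c ∉ p.1 ∧ c ∈ p.2 ∧ q.1 = insert c p.1 ∧ q.2 = p.2.erase c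
    · rw [dif_pos h, if_pos (off_genus_iff.2 h), genusFamily_eq]
      rw [h.2.2.2.1, h.2.2.2.2]
      exact resolve_insert_erase h.1 h.2.1 h.2.2.1
    · rw [dif_neg h, if_neg (mt off_genus_iff.1 h), smul_zero]

theorem diffAt_ne_zero (h : diffAt k χ c p q ≠ 0) : Off c p q ∧
    (((c ∈ p.1 ↔ c ∈ q.1) ∧ c ∉ p.2 ∧ c ∈ q.2) ∨
      (D.kind c = .dbl ∧ c ∉ p.1 ∧ c ∈ p.2 ∧ c ∈ q.1 ∧ c ∉ q.2)) := by
  by_cases h₁ : restrict c (fun r s r' s' => (r ↔ r') ∧ ¬s ∧ s') (saddleFamily k χ c) p q = 0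
  · have h₂ : restrict c (fun r s r' s' => D.kind c = .dbl ∧ ¬r ∧ s ∧ r' ∧ ¬s')
        (genusFamily k χ c) p q ≠ 0 := fun h₂ => h (by rw [diffAt, h₁, h₂, add_zero])
    exact ⟨(restrict_ne_zero h₂).1, .inr (restrict_ne_zero h₂).2⟩
  · exact ⟨(restrict_ne_zero h₁).1, .inl (restrict_ne_zero h₁).2⟩

theorem diffAt_of_saddle (h : Off c p q) (h₁ : c ∈ p.1 ↔ c ∈ q.1) (h₂ : c ∉ p.2) (h₃ : c ∈ q.2) :
    diffAt k χ c p q = saddleFamily k χ c (D.resolve p.1 p.2) (D.resolve q.1 q.2) := by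
  rw [diffAt, restrict, restrict, if_pos ⟨h, h₁, h₂, h₃⟩, if_neg, add_zero]
  exact fun h' => h₂ h'.2.2.2.1

theorem diffAt_of_genus (h : Off c p q) (hk : D.kind c = .dbl) (h₁ : c ∉ p.1) (h₂ : c ∈ p.2)
    (h₃ : c ∈ q.1) (h₄ : c ∉ q.2) :
    diffAt k χ c p q = genusFamily k χ c (D.resolve p.1 p.2) (D.resolve q.1 q.2) := by
  rw [diffAt, restrict, restrict, if_neg, if_pos ⟨h, hk, h₁, h₂, h₃, h₄⟩, zero_add]
  exact fun h' => h₄ h'.2.2.2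

theorem localAt_diffAt : LocalAt c (diffAt k χ c) := by
  intro p q h
  refine (diffAt_ne_zero h).imp_right ?_
  tauto

theorem squareCommute_diffAt (hc : c ≠ c') :
    SquareCommute c c' (diffAt k χ c) (diffAt k χ c') := by
  refine .add_left (.add_right ?_ ?_) (.add_right ?_ ?_) <;> apply squareCommute_restrict hc
  · exact commuting_saddle_saddle k χ hc
  · exact commuting_saddle_genus k χ hc
  · exact (commuting_saddle_genus k χ hc.symm).symm
  · exact commuting_genus_genus k χ hc

theorem saddleFamily_comp_genusFamily {σ τ ρ : D.Vtx → Bool} :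
    saddleFamily k χ c σ τ ≫ genusFamily k χ c τ ρ = 0 := by
  by_cases h : DifferAt σ τ c
  · by_cases h' : τ = ρ
    · rw [genusFamily_eq k χ h', saddleFamily, dif_pos h, ← Category.assoc,
        χ.saddle_comp_genusOne k h, Limits.zero_comp]
    · rw [genusFamily_of_ne k χ h', Limits.comp_zero]
  · rw [saddleFamily, dif_neg h, Limits.zero_comp]

theorem genusFamily_comp_saddleFamily {σ τ ρ : D.Vtx → Bool} :
    genusFamily k χ c σ τ ≫ saddleFamily k χ c τ ρ = 0 := by
  by_cases h' : σ = τ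
  · subst h'
    by_cases h : DifferAt σ ρ c
    · rw [genusFamily_self, saddleFamily, dif_pos h, χ.genusOne_comp_saddle k h]
    · rw [saddleFamily, dif_neg h, Limits.comp_zero]
  · rw [genusFamily_of_ne k χ h', Limits.zero_comp]

/-- Two saddles in a row, or two Φ in a row, are excluded by the memberships of `c`; a saddle and Φ
compose to zero in either order. -/
theorem diffAt_comp_diffAt (p q p' : State D) :
    diffAt k χ c p q ≫ diffAt k χ c q p' = 0 := by
  by_contra hn
  have h₁ : diffAt k χ c p q ≠ 0 := fun h => hn (by rw [h, Limits.zero_comp])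
  have h₂ : diffAt k χ c q p' ≠ 0 := fun h => hn (by rw [h, Limits.comp_zero])
  obtain ⟨o₁, ⟨a₁, a₂, a₃⟩ | ⟨a₀, a₁, a₂, a₃, a₄⟩⟩ := diffAt_ne_zero h₁ <;>
    obtain ⟨o₂, ⟨b₁, b₂, b₃⟩ | ⟨b₀, b₁, b₂, b₃, b₄⟩⟩ := diffAt_ne_zero h₂
  · exact b₂ a₃
  · rw [diffAt_of_saddle o₁ a₁ a₂ a₃, diffAt_of_genus o₂ b₀ b₁ b₂ b₃ b₄] at hn
    exact hn saddleFamily_comp_genusFamily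
  · rw [diffAt_of_genus o₁ a₀ a₁ a₂ a₃ a₄, diffAt_of_saddle o₂ b₁ b₂ b₃] at hn
    exact hn genusFamily_comp_saddleFamily
  · exact b₁ a₃

theorem sum_entry_comp_entry (p p' : State D) :
    ∑ q : State D, χ.entry k p.1 p.2 q.1 q.2 ≫ χ.entry k q.1 q.2 p'.1 p'.2 = 0 := by
  simp only [entry_eq, Preadditive.sum_comp, Preadditive.comp_sum]
  rw [Finset.sum_comm]
  simp only [Finset.sum_comm (s := (Finset.univ : Finset (State D)))]
  rw [← Fintype.sum_prod_type']
  -- Pairs of distinct vertices cancel against the swapped pair, and the diagonal terms vanish by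
  -- themselves.
  refine Finset.sum_involution (fun x _ => x.swap) ?_ ?_ (fun _ _ => Finset.mem_univ _)
    (fun _ _ => rfl)
  · rintro ⟨c, c'⟩ -
    by_cases hc : c = c'
    · subst hc
      simp [diffAt_comp_diffAt]
    · exact sum_sign_comp_sign (Ne.symm hc) (localAt_diffAt (k := k) (χ := χ)) localAt_diffAt
        (squareCommute_diffAt (Ne.symm hc)) p p'
  · rintro ⟨c, c'⟩ - hn he
    obtain rfl : c' = c := congrArg Prod.fst he
    simp [diffAt_comp_diffAt] at hn

/-! ### Degrees -/

variable (D) in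
/-- The states that index the summands in degree `i`. -/
def InDegree (i : ℤ) (p : State D) : Prop :=
  (∀ v ∈ p.1, D.kind v = .dbl) ∧ (p.2.card : ℤ) + 2 * (p.1.card : ℤ) = i

theorem InDegree.unique {i j : ℤ} (h : InDegree D i p) (h' : InDegree D j p) : i = j :=
  h.2.symm.trans h'.2

theorem InDegree.diffAt {i : ℤ} (hp : InDegree D i p) (h : diffAt k χ c p q ≠ 0) :
    InDegree D (i + 1) q := by
  obtain ⟨o, ⟨a₁, a₂, a₃⟩ | ⟨a₀, a₁, a₂, a₃, a₄⟩⟩ := diffAt_ne_zero h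
  · rw [InDegree, o.fst_eq a₁, o.snd_insert a₃, Finset.card_insert_of_notMem a₂]
    refine ⟨hp.1, ?_⟩
    rw [← hp.2]
    push_cast
    ring
  · rw [InDegree, o.fst_insert a₃, o.snd_erase a₄, Finset.card_insert_of_notMem a₁]
    refine ⟨fun v hv => ?_, ?_⟩
    · rcases Finset.mem_insert.1 hv with rfl | hv
      · exact a₀
      · exact hp.1 v hv
    · rw [← hp.2, ← Finset.card_erase_add_one a₂]
      push_cast
      ring

theorem InDegree.entry {i : ℤ} (hp : InDegree D i p)
    (h : χ.entry k p.1 p.2 q.1 q.2 ≠ 0) : InDegree D (i + 1) q := by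
  rw [entry_eq] at h
  obtain ⟨c, -, hc⟩ := Finset.exists_ne_zero_of_sum_ne_zero h
  exact hp.diffAt fun h₀ => hc (by rw [h₀, smul_zero])

/-- Allows sums over the summands of one degree to be taken over all states, as entries leaving that
degree vanish. -/
theorem sum_summand {M : Type*} [AddCommMonoid M] {i : ℤ} [Fintype (Summand D i)]
    (f : State D → M) (hf : ∀ q, f q ≠ 0 → InDegree D i q) :
    ∑ q : Summand D i, f q.1 = ∑ q, f q := by
  refine Fintype.sum_of_injective _ Subtype.val_injective _ _ (fun q hq => ?_) fun _ => rfl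
  by_contra hn
  exact hq ⟨⟨q, hf q hn⟩, rfl⟩

variable (k χ) in
theorem isComplex : χ.IsComplex k := by
  intro i
  refine Mat_.hom_ext _ _ fun p p' => ?_
  refine (sum_summand (i := i + 1)
    (fun q : State D => χ.entry k p.1.1 p.1.2 q.1 q.2 ≫ χ.entry k q.1 q.2 p'.1.1 p'.1.2)
    fun q hq => ?_).trans (sum_entry_comp_entry p.1 p'.1)
  exact InDegree.entry (p := p.1) p.2 fun h₀ => hq (by rw [h₀, Limits.zero_comp])

end Complex

section Homotopy

variable (k : Type u) [CommRing k] (χ : D.Coloring) {b c : D.Vtx} {e : Quad} {p q p' : State D}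

/-! ### The homotopy -/

/-- The null-homotopy of the identity coming from a kink at the double point `b`, without signs. -/
noncomputable def kinkHomotopy (he : D.edge (D.halfAt b e) = D.halfAt b e.vert) :
    χ.StateMatrix k := fun p q =>
  (restrict b (fun r s r' s' => ¬r ∧ s ∧ ¬r' ∧ ¬s') (deathFamily k χ he) p q +
    restrict b (fun r s r' s' => r ∧ s ∧ r' ∧ ¬s') (birthFamily k χ he) p q) +
  (-loopSign e) • restrict b (fun r s r' s' => r ∧ ¬s ∧ ¬r' ∧ s') (deathBirthFamily k χ he) p q

variable {k χ} {he : D.edge (D.halfAt b e) = D.halfAt b e.vert}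

theorem kinkHomotopy_ne_zero (h : kinkHomotopy k χ he p q ≠ 0) : Off b p q ∧
    ((b ∉ p.1 ∧ b ∈ p.2 ∧ b ∉ q.1 ∧ b ∉ q.2) ∨ (b ∈ p.1 ∧ b ∈ p.2 ∧ b ∈ q.1 ∧ b ∉ q.2) ∨
      (b ∈ p.1 ∧ b ∉ p.2 ∧ b ∉ q.1 ∧ b ∈ q.2)) := by
  by_cases h₁ : restrict b (fun r s r' s' => ¬r ∧ s ∧ ¬r' ∧ ¬s') (deathFamily k χ he) p q = 0
  · by_cases h₂ : restrict b (fun r s r' s' => r ∧ s ∧ r' ∧ ¬s') (birthFamily k χ he) p q = 0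
    · have h₃ : restrict b (fun r s r' s' => r ∧ ¬s ∧ ¬r' ∧ s') (deathBirthFamily k χ he) p q ≠ 0 :=
        fun h₃ => h (by rw [kinkHomotopy, h₁, h₂, h₃, smul_zero, add_zero, add_zero])
      exact ⟨(restrict_ne_zero h₃).1, .inr (.inr (restrict_ne_zero h₃).2)⟩
    · exact ⟨(restrict_ne_zero h₂).1, .inr (.inl (restrict_ne_zero h₂).2)⟩
  · exact ⟨(restrict_ne_zero h₁).1, .inl (restrict_ne_zero h₁).2⟩

theorem kinkHomotopy_of_death (h : Off b p q) (h₁ : b ∉ p.1) (h₂ : b ∈ p.2) (h₃ : b ∉ q.1)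
    (h₄ : b ∉ q.2) : kinkHomotopy k χ he p q =
      deathFamily k χ he (D.resolve p.1 p.2) (D.resolve q.1 q.2) := by
  simp [kinkHomotopy, restrict, h, h₁, h₂, h₃, h₄]

theorem kinkHomotopy_of_birth (h : Off b p q) (h₁ : b ∈ p.1) (h₂ : b ∈ p.2) (h₃ : b ∈ q.1)
    (h₄ : b ∉ q.2) : kinkHomotopy k χ he p q =
      birthFamily k χ he (D.resolve p.1 p.2) (D.resolve q.1 q.2) := by
  simp [kinkHomotopy, restrict, h, h₁, h₂, h₃, h₄]

theorem kinkHomotopy_of_deathBirth (h : Off b p q) (h₁ : b ∈ p.1) (h₂ : b ∉ p.2) (h₃ : b ∉ q.1)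
    (h₄ : b ∈ q.2) : kinkHomotopy k χ he p q =
      (-loopSign e) • deathBirthFamily k χ he (D.resolve p.1 p.2) (D.resolve q.1 q.2) := by
  simp [kinkHomotopy, restrict, h, h₁, h₂, h₃, h₄]

theorem localAt_kinkHomotopy : LocalAt b (kinkHomotopy k χ he) := by
  intro p q h
  refine (kinkHomotopy_ne_zero h).imp_right ?_
  tauto

theorem squareCommute_kinkHomotopy (hc : b ≠ c) :
    SquareCommute b c (kinkHomotopy k χ he) (diffAt k χ c) := by
  refine .add_left (.add_left (.add_right ?_ ?_) (.add_right ?_ ?_))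
    (SquareCommute.zsmul_right (.symm (.add_right ?_ ?_)) _).symm <;>
    apply squareCommute_restrict hc
  · exact (commuting_saddle_death k χ he hc.symm).symm
  · exact commuting_death_genus k χ he hc
  · exact commuting_birth_saddle k χ he hc.symm
  · exact commuting_birth_genus k χ he hc
  · exact (commuting_saddle_death k χ he hc.symm).symm.deathBirth he
      (commuting_birth_saddle k χ he hc.symm)
  · exact (commuting_death_genus k χ he hc).deathBirth he (commuting_birth_genus k χ he hc)

/-! ### Evaluation at the kink -/

open Classical in
/-- The state that differs from `p` at most at `b`, where it is prescribed. -/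
noncomputable def setAt (b : D.Vtx) (R S : Prop) (p : State D) : State D :=
  (if R then insert b p.1 else p.1.erase b, if S then insert b p.2 else p.2.erase b)

theorem off_setAt (b : D.Vtx) (R S : Prop) (p : State D) : Off b p (setAt b R S p) := by
  intro v hv
  by_cases hR : R <;> by_cases hS : S <;> simp [setAt, hR, hS, hv]

theorem mem_setAt_fst (b : D.Vtx) (R S : Prop) (p : State D) : b ∈ (setAt b R S p).1 ↔ R := by
  by_cases hR : R <;> simp [setAt, hR]

theorem mem_setAt_snd (b : D.Vtx) (R S : Prop) (p : State D) : b ∈ (setAt b R S p).2 ↔ S := by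
  by_cases hS : S <;> simp [setAt, hS]

theorem eq_setAt (h : Off b p q) : q = setAt b (b ∈ q.1) (b ∈ q.2) p :=
  (h.symm.trans (off_setAt b _ _ p)).eq (mem_setAt_fst b _ _ p).symm (mem_setAt_snd b _ _ p).symm

/-- A double point is smoothed to `)(` exactly when it lies in one of `r` and `s` but not in both.
-/
theorem vertHoriz_resolve (hk : D.kind b = .dbl) (h : Off b p q) (h₁ : b ∈ p.1 ↔ b ∉ p.2)
    (h₂ : b ∈ q.1 ↔ b ∈ q.2) : VertHoriz b (D.resolve p.1 p.2) (D.resolve q.1 q.2) := by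
  refine ⟨?_, ?_, fun v hv => (h.resolve_eq v hv).symm⟩
  · by_cases hp : b ∈ p.2 <;> simp [resolve, hk, h₁, hp]
  · by_cases hq : b ∈ q.2 <;> simp [resolve, hk, h₂, hq]

theorem resolve_eq_of_off (hk : D.kind b = .dbl) (h : Off b p q) (h₁ : b ∈ p.1 ↔ b ∉ p.2)
    (h₂ : b ∈ q.1 ↔ b ∉ q.2) : D.resolve p.1 p.2 = D.resolve q.1 q.2 := by
  funext v
  by_cases hv : v = b
  · subst hv
    by_cases hp : v ∈ p.2 <;> by_cases hq : v ∈ q.2 <;> simp [resolve, hk, h₁, h₂, hp, hq]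
  · exact (h.resolve_eq v hv).symm

theorem genusFamily_comp_deathBirthFamily {σ σ' τ : D.Vtx → Bool} (h : VertHoriz b σ τ)
    (hσ : σ = σ') : deathFamily k χ he σ τ ≫ saddleFamily k χ b τ σ +
      genusFamily k χ b σ σ' ≫ ((-loopSign e) • deathBirthFamily k χ he σ' σ) = 𝟙 _ := by
  subst hσ
  rw [genusFamily_self, deathBirthFamily_self k χ he h, χ.genusOne_eq_loopGenus k h.vert (q := e),
    deathFamily, dif_pos h, saddleFamily, dif_pos h.differAt', Preadditive.zsmul_comp,
    Preadditive.comp_zsmul, smul_smul, ← χ.death_comp_saddle_sub k he h, sub_eq_add_neg]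
  congr 1
  -- Neck cutting subtracts the term with `loopGenus`; this dictates the coefficient of
  -- `deathBirthFamily` in the homotopy.
  have : loopSign e * -loopSign e = -1 := by cases e <;> rfl
  rw [this, neg_one_smul]

theorem deathBirthFamily_comp_genusFamily {σ σ' τ : D.Vtx → Bool} (h : VertHoriz b σ τ)
    (hσ : σ = σ') : saddleFamily k χ b σ τ ≫ birthFamily k χ he τ σ +
      ((-loopSign e) • deathBirthFamily k χ he σ σ') ≫ genusFamily k χ b σ' σ = 𝟙 _ := by
  subst hσ
  rw [genusFamily_self, deathBirthFamily_self k χ he h, χ.genusOne_eq_loopGenus k h.vert (q := e),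
    birthFamily, dif_pos h, saddleFamily, dif_pos h.differAt, Preadditive.zsmul_comp,
    Preadditive.comp_zsmul, smul_smul, ← χ.saddle_comp_birth_sub k he h, sub_eq_add_neg]
  congr 1
  have : -loopSign e * loopSign e = -1 := by cases e <;> rfl
  rw [this, neg_one_smul]

theorem saddleFamily_comp_deathFamily {σ τ : D.Vtx → Bool} (h : VertHoriz b σ τ) :
    saddleFamily k χ b τ σ ≫ deathFamily k χ he σ τ = 𝟙 _ := by
  rw [deathFamily, dif_pos h, saddleFamily, dif_pos h.differAt', χ.cobMap_saddle_death k he h]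

theorem birthFamily_comp_saddleFamily {σ τ : D.Vtx → Bool} (h : VertHoriz b σ τ) :
    birthFamily k χ he τ σ ≫ saddleFamily k χ b σ τ = 𝟙 _ := by
  rw [birthFamily, dif_pos h, saddleFamily, dif_pos h.differAt, χ.cobMap_birth_saddle k he h]

/-- In the four-term sequence at `b` there is one term in each degree, so one step forward and one
back return to the start. Off-diagonal entries of dh + hd therefore vanish. -/
theorem diffAt_kinkHomotopy_eq (h₁ : diffAt k χ b p q ≠ 0) (h₂ : kinkHomotopy k χ he q p' ≠ 0) :
    p = p' := by
  obtain ⟨o₁, a⟩ := diffAt_ne_zero h₁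
  obtain ⟨o₂, a'⟩ := kinkHomotopy_ne_zero h₂
  exact (o₁.trans o₂).eq (by tauto) (by tauto)

theorem kinkHomotopy_diffAt_eq (h₁ : kinkHomotopy k χ he p q ≠ 0) (h₂ : diffAt k χ b q p' ≠ 0) :
    p = p' := by
  obtain ⟨o₁, a⟩ := kinkHomotopy_ne_zero h₁
  obtain ⟨o₂, a'⟩ := diffAt_ne_zero h₂
  exact (o₁.trans o₂).eq (by tauto) (by tauto)

theorem sum_diffAt_kinkHomotopy (R S : Prop)
    (h : ∀ q, diffAt k χ b p q ≠ 0 → kinkHomotopy k χ he q p ≠ 0 →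
      (b ∈ q.1 ↔ R) ∧ (b ∈ q.2 ↔ S)) :
    ∑ q, diffAt k χ b p q ≫ kinkHomotopy k χ he q p =
      diffAt k χ b p (setAt b R S p) ≫ kinkHomotopy k χ he (setAt b R S p) p := by
  refine Fintype.sum_eq_single _ fun q hq => ?_
  by_contra hn
  have h₁ : diffAt k χ b p q ≠ 0 := fun h => hn (by rw [h, Limits.zero_comp])
  have h₂ : kinkHomotopy k χ he q p ≠ 0 := fun h => hn (by rw [h, Limits.comp_zero])
  obtain ⟨hR, hS⟩ := h q h₁ h₂
  rw [← hR, ← hS] at hq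
  exact hq (eq_setAt (diffAt_ne_zero h₁).1)

theorem sum_kinkHomotopy_diffAt (R S : Prop)
    (h : ∀ q, kinkHomotopy k χ he p q ≠ 0 → diffAt k χ b q p ≠ 0 →
      (b ∈ q.1 ↔ R) ∧ (b ∈ q.2 ↔ S)) :
    ∑ q, kinkHomotopy k χ he p q ≫ diffAt k χ b q p =
      kinkHomotopy k χ he p (setAt b R S p) ≫ diffAt k χ b (setAt b R S p) p := by
  refine Fintype.sum_eq_single _ fun q hq => ?_
  by_contra hn
  have h₁ : kinkHomotopy k χ he p q ≠ 0 := fun h => hn (by rw [h, Limits.zero_comp])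
  have h₂ : diffAt k χ b q p ≠ 0 := fun h => hn (by rw [h, Limits.comp_zero])
  obtain ⟨hR, hS⟩ := h q h₁ h₂
  rw [← hR, ← hS] at hq
  exact hq (eq_setAt (kinkHomotopy_ne_zero h₁).1)

/-- One case for each term of the four-term sequence: at the two ends a single composite survives,
and at the two middle terms both survive and neck cutting applies. -/
theorem sum_kink_self (hk : D.kind b = .dbl) (p : State D) :
    ∑ q, diffAt k χ b p q ≫ kinkHomotopy k χ he q p +
      ∑ q, kinkHomotopy k χ he p q ≫ diffAt k χ b q p = 𝟙 _ := by
  have o := fun R S => off_setAt b R S p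
  have m₁ := fun R S => mem_setAt_fst b R S p
  have m₂ := fun R S => mem_setAt_snd b R S p
  by_cases hr : b ∈ p.1 <;> by_cases hs : b ∈ p.2
  · rw [Finset.sum_eq_zero, zero_add, sum_kinkHomotopy_diffAt True False,
      kinkHomotopy_of_birth (o _ _) hr hs (by simp [m₁]) (by simp [m₂]),
      diffAt_of_saddle (o _ _).symm (by simp [m₁, hr]) (by simp [m₂]) hs]
    · exact birthFamily_comp_saddleFamily
        (vertHoriz_resolve hk (o _ _).symm (by simp [m₁, m₂]) (by simp [hr, hs]))
    · intro q h₁ h₂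
      have := kinkHomotopy_ne_zero h₁
      tauto
    · intro q _
      by_contra hn
      have h₁ : diffAt k χ b p q ≠ 0 := fun h => hn (by rw [h, Limits.zero_comp])
      have := diffAt_ne_zero h₁
      tauto
  · rw [sum_diffAt_kinkHomotopy True True, sum_kinkHomotopy_diffAt False True,
      kinkHomotopy_of_deathBirth (o _ _) hr hs (by simp [m₁]) (by simp [m₂]),
      diffAt_of_saddle (o _ _) (by simp [m₁, hr]) hs (by simp [m₂]),
      kinkHomotopy_of_birth (o _ _).symm (by simp [m₁]) (by simp [m₂]) hr hs,
      diffAt_of_genus (o _ _).symm hk (by simp [m₁]) (by simp [m₂]) hr hs]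
    · exact deathBirthFamily_comp_genusFamily
        (vertHoriz_resolve hk (o _ _) (by simp [hr, hs]) (by simp [m₁, m₂]))
        (resolve_eq_of_off hk (o _ _) (by simp [hr, hs]) (by simp [m₁, m₂]))
    · intro q h₁ h₂
      have := kinkHomotopy_ne_zero h₁
      tauto
    · intro q h₁ h₂
      have := diffAt_ne_zero h₁
      tauto
  · rw [add_comm, sum_diffAt_kinkHomotopy True False, sum_kinkHomotopy_diffAt False False,
      kinkHomotopy_of_death (o _ _) hr hs (by simp [m₁]) (by simp [m₂]),
      diffAt_of_saddle (o _ _).symm (by simp [m₁, hr]) (by simp [m₂]) hs,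
      kinkHomotopy_of_deathBirth (o _ _).symm (by simp [m₁]) (by simp [m₂]) hr hs,
      diffAt_of_genus (o _ _) hk hr hs (by simp [m₁]) (by simp [m₂])]
    · exact genusFamily_comp_deathBirthFamily
        (vertHoriz_resolve hk (o _ _) (by simp [hr, hs]) (by simp [m₁, m₂]))
        (resolve_eq_of_off hk (o _ _) (by simp [hr, hs]) (by simp [m₁, m₂]))
    · intro q h₁ h₂
      have := kinkHomotopy_ne_zero h₁
      tauto
    · intro q h₁ h₂
      have := diffAt_ne_zero h₁
      tauto
  · rw [Finset.sum_eq_zero (f := fun q => kinkHomotopy k χ he p q ≫ diffAt k χ b q p), add_zero,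
      sum_diffAt_kinkHomotopy False True,
      kinkHomotopy_of_death (o _ _).symm (by simp [m₁]) (by simp [m₂]) hr hs,
      diffAt_of_saddle (o _ _) (by simp [m₁, hr]) hs (by simp [m₂])]
    · exact saddleFamily_comp_deathFamily
        (vertHoriz_resolve hk (o _ _).symm (by simp [m₁, m₂]) (by simp [hr, hs]))
    · intro q h₁ h₂
      have := diffAt_ne_zero h₁
      tauto
    · intro q _
      by_contra hn
      have h₁ : kinkHomotopy k χ he p q ≠ 0 := fun h => hn (by rw [h, Limits.zero_comp])
      have := kinkHomotopy_ne_zero h₁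
      tauto

/-- The sign at `b` does not count `b` itself, so it is the same before and after the step and
squares to 1. -/
theorem sign_smul_comp_sign_smul {A B : χ.StateMatrix k} (hA : LocalAt b A) (p q p' : State D) :
    (sign p.2 b • A p q) ≫ (sign q.2 b • B q p') = A p q ≫ B q p' := by
  by_cases h : A p q = 0
  · rw [h, smul_zero, Limits.zero_comp, Limits.zero_comp]
  · rw [sign_eq_of_not_lt (fun v hv => ((hA _ _ h).1 v hv).2) (lt_irrefl b),
      Preadditive.zsmul_comp, Preadditive.comp_zsmul, smul_smul, sign_mul_self, one_smul]

/-- In the anticommutator of the differential and the signed homotopy only `b` contributes. -/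
theorem sum_entry_kinkHomotopy (p p' : State D) :
    ∑ q : State D, χ.entry k p.1 p.2 q.1 q.2 ≫ (sign q.2 b • kinkHomotopy k χ he q p') +
      ∑ q : State D, (sign p.2 b • kinkHomotopy k χ he p q) ≫ χ.entry k q.1 q.2 p'.1 p'.2 =
    ∑ q, diffAt k χ b p q ≫ kinkHomotopy k χ he q p' +
      ∑ q, kinkHomotopy k χ he p q ≫ diffAt k χ b q p' := by
  simp only [entry_eq, Preadditive.sum_comp, Preadditive.comp_sum]
  rw [Finset.sum_comm, Finset.sum_comm (s := (Finset.univ : Finset (State D))),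
    ← Finset.sum_add_distrib]
  refine (Fintype.sum_eq_single b fun c hc => ?_).trans ?_
  · rw [add_comm]
    exact sum_sign_comp_sign hc.symm localAt_kinkHomotopy localAt_diffAt
      (squareCommute_kinkHomotopy hc.symm) p p'
  · simp only [sign_smul_comp_sign_smul (localAt_diffAt (k := k) (χ := χ)),
      sign_smul_comp_sign_smul (localAt_kinkHomotopy (k := k) (χ := χ) (he := he))]

/-- Death and birth remove `b` from `s`; the middle map removes it from `r`, worth 2, and adds it to
`s`. -/
theorem InDegree.kinkHomotopy {i : ℤ} (hp : InDegree D (i + 1) p)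
    (h : kinkHomotopy k χ he p q ≠ 0) : InDegree D i q := by
  obtain ⟨o, a⟩ := kinkHomotopy_ne_zero h
  have h₀ := hp.2
  rcases a with ⟨a₁, a₂, a₃, a₄⟩ | ⟨a₁, a₂, a₃, a₄⟩ | ⟨a₁, a₂, a₃, a₄⟩
  · have e := o.fst_eq (iff_of_false a₁ a₃)
    refine ⟨by rw [e]; exact hp.1, ?_⟩
    rw [← Finset.card_erase_add_one a₂, ← o.snd_erase a₄, ← e] at h₀
    push_cast at h₀
    linarith
  · have e := o.fst_eq (iff_of_true a₁ a₃)
    refine ⟨by rw [e]; exact hp.1, ?_⟩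
    rw [← Finset.card_erase_add_one a₂, ← o.snd_erase a₄, ← e] at h₀
    push_cast at h₀
    linarith
  · have e := o.symm.fst_insert a₁
    refine ⟨fun v hv => hp.1 v (by rw [e]; exact Finset.mem_insert_of_mem hv), ?_⟩
    rw [e, Finset.card_insert_of_notMem a₃] at h₀
    rw [o.snd_insert a₄, Finset.card_insert_of_notMem a₂]
    push_cast at h₀ ⊢
    linarith

variable (k χ) in
/-- The null-homotopy of the identity in the bracket complex. -/
noncomputable def bracketHomotopy (he : D.edge (D.halfAt b e) = D.halfAt b e.vert) (i j : ℤ) :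
    χ.bracketObj k i ⟶ χ.bracketObj k j :=
  fun p q => sign p.1.2 b • kinkHomotopy k χ he p.1 q.1

theorem bracketHomotopy_eq_zero {i j : ℤ} (hij : j + 1 ≠ i) :
    bracketHomotopy k χ he i j = 0 := by
  refine Mat_.hom_ext _ _ fun p q => ?_
  by_contra hn
  have h₁ : kinkHomotopy k χ he p.1 q.1 ≠ 0 := fun h₀ => hn (by
    change sign p.1.2 b • kinkHomotopy k χ he p.1 q.1 = 0
    rw [h₀, smul_zero])
  have hp : InDegree D (i - 1 + 1) p.1 := by
    rw [sub_add_cancel]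
    exact p.2
  refine hij ?_
  rw [← InDegree.unique (hp.kinkHomotopy h₁) q.2, sub_add_cancel]

theorem bracketD_comp_bracketHomotopy (hk : D.kind b = .dbl) (j : ℤ) :
    χ.bracketD k (j + 1) ≫ bracketHomotopy k χ he (j + 1 + 1) (j + 1) +
      bracketHomotopy k χ he (j + 1) j ≫ χ.bracketD k j = 𝟙 (χ.bracketObj k (j + 1)) := by
  refine Mat_.hom_ext _ _ fun p p' => ?_
  have h₁ := sum_summand (i := j + 1 + 1) (fun q : State D =>
    χ.entry k p.1.1 p.1.2 q.1 q.2 ≫ (sign q.2 b • kinkHomotopy k χ he q p'.1))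
    fun q hq => InDegree.entry (p := p.1) p.2 fun h₀ => hq (by rw [h₀, Limits.zero_comp])
  have h₂ := sum_summand (i := j) (fun q : State D =>
    (sign p.1.2 b • kinkHomotopy k χ he p.1 q) ≫ χ.entry k q.1 q.2 p'.1.1 p'.1.2)
    fun q hq => InDegree.kinkHomotopy (p := p.1) (he := he) p.2
      fun h₀ => hq (by rw [h₀, smul_zero, Limits.zero_comp])
  refine (congrArg₂ (· + ·) h₁ h₂).trans ((sum_entry_kinkHomotopy p.1 p'.1).trans ?_)
  by_cases hp : p = p'
  · subst hp
    rw [sum_kink_self hk, Mat_.id_apply_self]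
    rfl
  · rw [Mat_.id_apply_of_ne _ _ _ hp]
    have hp' : p.1 ≠ p'.1 := fun h => hp (Subtype.ext h)
    refine (congrArg₂ (· + ·) (Finset.sum_eq_zero fun q _ => ?_)
      (Finset.sum_eq_zero fun q _ => ?_)).trans (add_zero _)
    · by_contra hn
      exact hp' (diffAt_kinkHomotopy_eq (fun h => hn (by rw [h, Limits.zero_comp]))
        fun h => hn (by rw [h, Limits.comp_zero]))
    · by_contra hn
      exact hp' (kinkHomotopy_diffAt_eq (fun h => hn (by rw [h, Limits.zero_comp]))
        fun h => hn (by rw [h, Limits.comp_zero]))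

variable (k χ) in
/-- A kink at a double point contracts the bracket complex. -/
theorem isContractible_bracket (hk : D.kind b = .dbl)
    (he : D.edge (D.halfAt b e) = D.halfAt b e.vert) (h : χ.IsComplex k) :
    IsContractible (χ.bracket k h) := by
  refine ⟨{ hom := fun i j => bracketHomotopy k χ he i j
            zero := fun i j hij => bracketHomotopy_eq_zero hij
            comm := fun i => ?_ }⟩
  -- Now both neighbouring differentials go from some n to n + 1 on the nose, as
  -- `CochainComplex.of_d` requires.
  obtain ⟨j, rfl⟩ : ∃ j, i = j + 1 := ⟨i - 1, by ring⟩
  have h₁ := dNext_eq (C := χ.bracket k h) (D := χ.bracket k h)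
    (fun i j => bracketHomotopy k χ he i j)
    (show (ComplexShape.up ℤ).Rel (j + 1) (j + 1 + 1) from rfl)
  have h₂ := prevD_eq (C := χ.bracket k h) (D := χ.bracket k h)
    (fun i j => bracketHomotopy k χ he i j)
    (show (ComplexShape.up ℤ).Rel j (j + 1) from rfl)
  have d₁ : (χ.bracket k h).d (j + 1) (j + 1 + 1) = χ.bracketD k (j + 1) :=
    CochainComplex.of_d _ _ _
  have d₂ : (χ.bracket k h).d j (j + 1) = χ.bracketD k j := CochainComplex.of_d _ _ _
  rw [d₁] at h₁
  rw [d₂] at h₂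
  refine (bracketD_comp_bracketHomotopy (he := he) hk j).symm.trans ?_
  refine Eq.trans ?_ (add_zero _).symm
  exact congrArg₂ (· + ·) h₁.symm h₂.symm

end Homotopy

end Coloring

end SingularTangleDiagram

end SingTangle

/-! ### The loop of an FI point, shifts, and the conclusion -/

/-- An edge runs from an outgoing to an incoming half-edge. The neighbours joined by the kink are
therefore not both upper or both lower ones, and neighbours on the same side are joined by `)(`. -/
theorem SingTangle.SingularTangleDiagram.IsFIPoint.exists_loop {D : SingTangle.SingularTangleDiagram}
    {b : D.Vtx} (hb : D.IsFIPoint b) :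
    ∃ e : SingTangle.Quad, D.edge (D.halfAt b e) = D.halfAt b e.vert := by
  obtain ⟨-, q, hq, -⟩ := hb
  have h := D.isOut_edge (D.halfAt b q)
  rw [hq] at h
  refine ⟨q, hq.trans ?_⟩
  cases q <;> simp_all [SingTangle.Dart.isOut, SingTangle.Quad.isOut, SingTangle.Quad.rot,
    SingTangle.Quad.vert]

/-- Shifting carries homotopies to homotopies and preserves identities and zero morphisms. -/
theorem SingTangle.IsContractible.shift {C : Type*} [Category C] [Preadditive C]
    {K : CochainComplex C ℤ} (h : SingTangle.IsContractible K) (n : ℤ) :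
    SingTangle.IsContractible ((CategoryTheory.shiftFunctor (CochainComplex C ℤ) n).obj K) := by
  obtain ⟨h⟩ := h
  exact ⟨(Homotopy.ofEq ((CategoryTheory.shiftFunctor (CochainComplex C ℤ) n).map_id K).symm).trans
    ((h.shift n).trans (Homotopy.ofEq (Functor.map_zero _ _ _)))⟩

theorem corollary5p8 {k : Type u} [CommRing k] (D : SingTangle.SingularTangleDiagram)
    (b : D.Vtx) (hb : D.IsFIPoint b) (χ : D.Coloring) :
    ∃ h : χ.IsComplex k, SingTangle.IsContractible (χ.bracket k h) ∧
      (χ.black D.west = false → SingTangle.IsContractible (χ.khovanov k h)) := by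
  obtain ⟨e, he⟩ := hb.exists_loop
  have hc := SingTangle.SingularTangleDiagram.Coloring.isContractible_bracket k χ hb.1 he
    (SingTangle.SingularTangleDiagram.Coloring.isComplex k χ)
  exact ⟨_, hc, fun _ => hc.shift _⟩
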